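/- **Conventions.** A skew shape $A=\lambda/\mu$ is the set of boxes of the Young diagram of a partition $\lambda$ that do not lie in that of a partition $\mu$ contained in $\lambda$ (English convention: row $1$ at the top); its size is its number of boxes. Skew shapes are regarded as equal when their diagrams agree after deletion of empty rows and columns (in particular when they are translates of each other). A partition $\lambda$ also denotes the shape $\lambda/\emptyset$; $A^\circ$ is $A$ rotated by $180^\circ$; $A\oplus B$ is the skew shape obtained by placing $A$ immediately below and to the left of $B$ so that they share no rows or columns; $1^\ell$ denotes $\ell$ parts equal to $1$. For a composition $\alpha=(\alpha_1,\dots,\alpha_k)$ of $n$ let $S(\alpha)=\{\alpha_1,\alpha_1+\alpha_2,\dots,\alpha_1+\cdots+\alpha_{k-1}\}\subseteq[n-1]$, let $M_\alpha=\sum_{i_1<\cdots<i_k}x_{i_1}^{\alpha_1}\cdots x_{i_k}^{\alpha_k}$, and let $F_\alpha=\sum_{S(\alpha)\subseteq S(\beta)}M_\beta$, the sum being over compositions $\beta$ of $n$. For a skew shape $A$ of size $n$, the skew Schur function is $s_A=\sum_T F_{\mathrm{comp}(T)}$ over all standard Young tableaux $T$ of shape $A$, where $\mathrm{comp}(T)$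 is the composition of $n$ with $S(\mathrm{comp}(T))=\{i : i+1 \text{ is in a lower row of } T \text{ than } i\}$. A quasisymmetric function is $F$-positive if all its coefficients in the basis $\{F_\alpha\}$ are nonnegative; $\mathrm{supp}_F(A)$ is the set of $\alpha$ such that $F_\alpha$ has positive coefficient in $s_A$; and $A$ is $F$-multiplicity-free if all coefficients of $s_A$ in the basis $\{F_\alpha\}$ are $0$ or $1$. **Theorem.** Let $A$ and $B$ be $F$-multiplicity-free skew shapes of size $n$. Then $s_A=s_B$ if and only if $B\in\{A,A^\circ\}$. Moreover $s_A-s_B$ is $F$-positive if and only if $\mathrm{supp}_F(A)\supseteq\mathrm{supp}_F(B)$. If $B\notin\{A,A^\circ\}$, then $s_A-s_B$ is $F$-positive if and only if one of the following holds after possibly replacing $A$ by $A^\circ$ and/or $B$ by $B^\circ$: (a) $A=(1^\ell)\oplus(n-\ell)$ and $B\in\{(n-\ell,1^\ell),\,(n-\ell+1,1^{\ell-1})\}$ for some $1\le\ell\le n-1$; (b) $n\ge4$, $A=(1^2)\oplus(n-2)$ and $B=(n-2,2)$; (c) $n\ge4$, $A=(1^{n-2})\oplus(2)$ and $B=(2,2,1^{n-4})$.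 -/

import Mathlib

/-- A skew shape `λ/μ`: a pair of Young diagrams with `μ` contained in `λ`.  As in Mathlib, a box is
a pair `(i, j)` with `i` the row (counted downwards from `0`) and `j` the column. -/
structure SkewShape where
  outer : YoungDiagram
  inner : YoungDiagram
  inner_le : inner ≤ outer

namespace SkewShape

/-- The boxes of `λ/μ`. -/
def cells (A : SkewShape) : Finset (ℕ × ℕ) :=
  A.outer.cells \ A.inner.cells

/-- The number of boxes. -/
def size (A : SkewShape) : ℕ :=
  A.cells.card

/-- The set of boxes after deleting all empty rows and all empty columns: the box `(i, j)` moves to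
(number of nonempty rows above row `i`, number of nonempty columns left of column `j`). -/
def reducedCells (A : SkewShape) : Finset (ℕ × ℕ) :=
  A.cells.image fun c =>
    (((A.cells.image Prod.fst).filter (· < c.1)).card,
      ((A.cells.image Prod.snd).filter (· < c.2)).card)

/-- Skew shapes are identified when their diagrams agree after deleting empty rows and columns
(in particular, when their diagrams are translates of each other). -/
instance : Setoid SkewShape where
  r A B := A.reducedCells = B.reducedCells
  iseqv := ⟨fun _ => rfl, fun h => h.symm, fun h h' => h.trans h'⟩

/-- The straight shape `λ/∅`, where `λ` is the partition with the given multiset of parts. -/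
def straight (parts : Multiset ℕ) : SkewShape where
  outer := YoungDiagram.ofRowLens (parts.sort (· ≥ ·)) (parts.pairwise_sort (· ≥ ·)).sortedGE
  inner := ⊥
  inner_le := bot_le

/-- For `μ ≤ ν`, the complement of `μ` in the smallest rectangle containing `ν`, rotated by
180 degrees. -/
def rotCompl (ν μ : YoungDiagram) : YoungDiagram where
  cells := (Finset.range (ν.colLen 0) ×ˢ Finset.range (ν.rowLen 0)).filter fun c =>
    (ν.colLen 0 - 1 - c.1, ν.rowLen 0 - 1 - c.2) ∉ μ
  isLowerSet := by
    rintro ⟨i, j⟩ ⟨i', j'⟩ h hc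
    obtain ⟨h1, h2⟩ := Prod.mk_le_mk.1 h
    simp only [Finset.coe_filter, Finset.mem_product, Finset.mem_range, Set.mem_ofPred_eq] at hc ⊢
    exact ⟨⟨by omega, by omega⟩, fun hm => hc.2 (μ.up_left_mem (by omega) (by omega) hm)⟩

/-- The antipodal rotation `A°`: the boxes of `A` rotated by 180 degrees inside the smallest
rectangle containing `λ`. -/
def rotate (A : SkewShape) : SkewShape where
  outer := rotCompl A.outer A.inner
  inner := rotCompl A.outer A.outer
  inner_le := by
    rw [← YoungDiagram.cells_subset_iff]
    intro c hc
    simp only [rotCompl, Finset.mem_filter] at hc ⊢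
    exact ⟨hc.1, fun h => hc.2 (A.inner_le h)⟩

/-- Place `lo ≤ α` below and to the left of `hi ≤ β`, and fill the rectangle above `α` and to the
left of `β`. -/
def glue (α β lo hi : YoungDiagram) (hlo : lo ≤ α) (hhi : hi ≤ β) : YoungDiagram where
  cells := Finset.range (β.colLen 0) ×ˢ Finset.range (α.rowLen 0) ∪
    hi.cells.image (fun c => (c.1, c.2 + α.rowLen 0)) ∪
    lo.cells.image (fun c => (c.1 + β.colLen 0, c.2))
  isLowerSet := by
    have hrow : ∀ i j, (i, j) ∈ lo → j < α.rowLen 0 := fun i j h =>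
      YoungDiagram.mem_iff_lt_rowLen.1 (α.up_left_mem (Nat.zero_le i) le_rfl (hlo h))
    have hcol : ∀ i j, (i, j) ∈ hi → i < β.colLen 0 := fun i j h =>
      YoungDiagram.mem_iff_lt_colLen.1 (β.up_left_mem le_rfl (Nat.zero_le j) (hhi h))
    rintro ⟨i, j⟩ ⟨i', j'⟩ h hc
    obtain ⟨h1, h2⟩ := Prod.mk_le_mk.1 h
    simp only [Finset.coe_union, Set.mem_union, Finset.mem_coe, Finset.mem_product,
      Finset.mem_range, Finset.mem_image, Prod.mk.injEq, Prod.exists,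
      YoungDiagram.mem_cells] at hc ⊢
    rcases hc with (hc | ⟨a, b, hab, rfl, rfl⟩) | ⟨a, b, hab, rfl, rfl⟩
    · exact Or.inl (Or.inl ⟨by omega, by omega⟩)
    · have ha := hcol a b hab
      by_cases hj : j' < α.rowLen 0
      · exact Or.inl (Or.inl ⟨by omega, hj⟩)
      · exact Or.inl (Or.inr ⟨i', j' - α.rowLen 0,
          hi.up_left_mem h1 (by omega) hab, rfl, by omega⟩)
    · have hb := hrow a b hab
      by_cases hi' : i' < β.colLen 0
      · exact Or.inl (Or.inl ⟨hi', by omega⟩)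
      · exact Or.inr ⟨i' - β.colLen 0, j',
          lo.up_left_mem (by omega) h2 hab, by omega, rfl⟩

/-- `A ⊕ B`: the shape `A` placed immediately below and to the left of `B`, with no rows or columns
in common. -/
def oplus (A B : SkewShape) : SkewShape where
  outer := glue A.outer B.outer A.outer B.outer le_rfl le_rfl
  inner := glue A.outer B.outer A.inner B.inner A.inner_le B.inner_le
  inner_le := by
    rw [← YoungDiagram.cells_subset_iff]
    exact Finset.union_subset_union
      (Finset.union_subset_union le_rfl
        (Finset.image_subset_image (YoungDiagram.cells_subset_iff.2 B.inner_le)))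
      (Finset.image_subset_image (YoungDiagram.cells_subset_iff.2 A.inner_le))

/-- Standard Young tableaux of shape `A` with `n` boxes: bijective fillings increasing from left to
right along rows and downwards along columns.  The value `k : Fin n` stands for the entry `k + 1`. -/
def SYT (A : SkewShape) : Type :=
  {T : A.cells ≃ Fin A.size //
    (∀ c d : A.cells, c.1.1 = d.1.1 → c.1.2 < d.1.2 → T c < T d) ∧
    (∀ c d : A.cells, c.1.2 = d.1.2 → c.1.1 < d.1.1 → T c < T d)}

instance (A : SkewShape) : Fintype (SYT A) :=
  inferInstanceAs (Fintype {T : A.cells ≃ Fin A.size //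
    (∀ c d : A.cells, c.1.1 = d.1.1 → c.1.2 < d.1.2 → T c < T d) ∧
    (∀ c d : A.cells, c.1.2 = d.1.2 → c.1.1 < d.1.1 → T c < T d)})

/-- The descent set of `T`, a subset of `[n - 1]`, where `i : Fin (n - 1)` stands for the number
`i + 1`: it is a descent if the entry `i + 2` appears in a lower row than the entry `i + 1`. -/
def SYT.descentSet {A : SkewShape} (T : SYT A) : Finset (Fin (A.size - 1)) :=
  Finset.univ.filter fun i =>
    (T.1.symm ⟨i, by omega⟩).1.1 < (T.1.symm ⟨i + 1, by omega⟩).1.1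

end SkewShape

namespace QSym

/-- The bijection `α ↦ S(α) = {α₁, α₁ + α₂, …, α₁ + ⋯ + α_{k-1}}` from compositions of `n` to subsets
of `[n - 1]`, where `i : Fin (n - 1)` stands for the number `i + 1`. -/
def setOfComp (n : ℕ) : Composition n ≃ Finset (Fin (n - 1)) :=
  (compositionEquiv n).trans (compositionAsSetEquiv n)

open Classical in
/-- The monomial quasisymmetric function `M_α`, the sum of the distinct monomials
`x_{i_1}^{α_1} ⋯ x_{i_k}^{α_k}` over all `i_1 < ⋯ < i_k`. -/
noncomputable def monomialQ {n : ℕ} (α : Composition n) : MvPowerSeries ℕ ℚ :=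
  fun d => if ∃ i : Fin α.length → ℕ,
    StrictMono i ∧ d = ∑ k, Finsupp.single (i k) (α.blocksFun k) then 1 else 0

/-- The fundamental quasisymmetric function `F_α`, the sum of `M_β` over all compositions `β` of `n`
with `S(α) ⊆ S(β)`. -/
noncomputable def fundamental {n : ℕ} (α : Composition n) : MvPowerSeries ℕ ℚ :=
  ∑ β ∈ (Finset.univ : Finset (Composition n)).filter
    (fun β => setOfComp n α ⊆ setOfComp n β), monomialQ β

/-- `f = ∑ c_α F_α`, the sum being over the compositions `α` of `n`. -/
def IsFExpansion {n : ℕ} (f : MvPowerSeries ℕ ℚ) (c : Composition n → ℚ) : Prop :=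
  f = ∑ α, c α • fundamental α

/-- `f`, homogeneous of degree `n`, is `F`-positive: its coefficients in the `F`-basis are
nonnegative. -/
def FPositive (n : ℕ) (f : MvPowerSeries ℕ ℚ) : Prop :=
  ∃ c : Composition n → ℚ, IsFExpansion f c ∧ ∀ α, 0 ≤ c α

/-- The `F`-support of `f`, homogeneous of degree `n`: the compositions `α` such that `F_α` has
positive coefficient in the expansion of `f` in the `F`-basis. -/
def fSupport (n : ℕ) (f : MvPowerSeries ℕ ℚ) : Set (Composition n) :=
  {α | ∃ c : Composition n → ℚ, IsFExpansion f c ∧ 0 < c α}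

/-- `f`, homogeneous of degree `n`, is `F`-multiplicity-free: its coefficients in the `F`-basis are
all `0` or `1`. -/
def FMultiplicityFree (n : ℕ) (f : MvPowerSeries ℕ ℚ) : Prop :=
  ∃ c : Composition n → ℚ, IsFExpansion f c ∧ ∀ α, c α = 0 ∨ c α = 1

end QSym

/-- The skew Schur function `s_A`, the sum of `F_{comp(T)}` over all standard Young tableaux `T` of
shape `A`, where `comp(T)` is the composition corresponding to the descent set of `T`. -/
noncomputable def SkewShape.schur (A : SkewShape) : MvPowerSeries ℕ ℚ :=
  ∑ T : A.SYT, QSym.fundamental ((QSym.setOfComp A.size).symm T.descentSet)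

/-!
Standard Young tableaux of shape `A` are linear extensions of the poset of cells of `A`, so
`F`-multiplicity-freeness of `A` says that these linear extensions are determined by their descent
words, and `supp_F(A)` is the set of those words. If two linear extensions of an order-convex set
of cells of `A` share a descent word, so do two of all of `A`; hence a multiplicity-free shape omits
a short list of configurations of cells. This leaves, up to rotation, the hooks, the straight shapes
`(c, 2)`, the 2-by-3 and 2-by-4 rectangles, their transposes, and the sums of a column and a row.
Their descent words are explicit enough to decide which inclusions between them hold.
-/

section LinExt

variable {α β : Type*} [PartialOrder α] [PartialOrder β] {C C₁ C₂ : Finset α} {l m : List α}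

/-- The list `l` is a linear extension of the poset `C`: it enumerates the elements of `C`, never
listing an element after a larger one. -/
structure IsLinExt (C : Finset α) (l : List α) : Prop where
  mem_iff : ∀ x, x ∈ l ↔ x ∈ C
  pairwise : l.Pairwise fun a b => ¬ b ≤ a

namespace IsLinExt

theorem nodup (h : IsLinExt C l) : l.Nodup :=
  h.pairwise.imp fun hab hEq => hab hEq.ge

theorem length_eq (h : IsLinExt C l) : l.length = C.card := by
  classical
  rw [← List.toFinset_card_of_nodup h.nodup]
  congr 1
  ext x
  rw [List.mem_toFinset, h.mem_iff]

theorem not_le (h : IsLinExt C (l ++ m)) {a b : α} (ha : a ∈ l) (hb : b ∈ m) : ¬ b ≤ a :=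
  (List.pairwise_append.1 h.pairwise).2.2 a ha b hb

theorem append (hl : IsLinExt C₁ l) (hm : IsLinExt C₂ m) (hC : ∀ x, x ∈ C ↔ x ∈ C₁ ∨ x ∈ C₂)
    (h : ∀ a ∈ C₁, ∀ b ∈ C₂, ¬ b ≤ a) : IsLinExt C (l ++ m) where
  mem_iff x := by rw [List.mem_append, hl.mem_iff, hm.mem_iff, hC]
  pairwise := List.pairwise_append.2 ⟨hl.pairwise, hm.pairwise, fun a ha b hb =>
    h a ((hl.mem_iff a).1 ha) b ((hm.mem_iff b).1 hb)⟩

theorem map [DecidableEq β] {f : α → β} (hl : IsLinExt C l)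
    (hf : ∀ a ∈ C, ∀ b ∈ C, f a ≤ f b → a ≤ b) : IsLinExt (C.image f) (l.map f) where
  mem_iff x := by simp only [List.mem_map, Finset.mem_image, hl.mem_iff]
  pairwise := List.pairwise_map.2 <| hl.pairwise.imp_of_mem fun ha hb hab hba =>
    hab (hf _ ((hl.mem_iff _).1 hb) _ ((hl.mem_iff _).1 ha) hba)

theorem map_reverse [DecidableEq β] {f : α → β} (hl : IsLinExt C l)
    (hf : ∀ a ∈ C, ∀ b ∈ C, f a ≤ f b → b ≤ a) : IsLinExt (C.image f) (l.reverse.map f) where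
  mem_iff x := by simp only [List.mem_map, List.mem_reverse, Finset.mem_image, hl.mem_iff]
  pairwise := List.pairwise_map.2 <| List.pairwise_reverse.2 <| hl.pairwise.imp_of_mem
    fun ha hb hab hba => hab (hf _ ((hl.mem_iff _).1 ha) _ ((hl.mem_iff _).1 hb) hba)

end IsLinExt

theorem exists_isLinExt (C : Finset α) : ∃ l, IsLinExt C l := by
  classical
  induction C using Finset.strongInduction with
  | H C ih =>
    rcases C.eq_empty_or_nonempty with rfl | hC
    · exact ⟨[], by simp, List.Pairwise.nil⟩
    · obtain ⟨m, hm⟩ := C.exists_minimal hC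
      obtain ⟨l, hl⟩ := ih (C.erase m) (Finset.erase_ssubset hm.prop)
      refine ⟨m :: l, fun x => ?_, List.pairwise_cons.2 ⟨fun b hb hbm => ?_, hl.pairwise⟩⟩
      · rw [List.mem_cons, hl.mem_iff, ← Finset.mem_insert, Finset.insert_erase hm.prop]
      · have hb' := Finset.mem_erase.1 ((hl.mem_iff b).1 hb)
        exact hb'.1 (hm.eq_of_le hb'.2 hbm)

end LinExt

/-- The descent word of a list of cells: for each pair of consecutive cells, whether the second one
lies in a lower row. -/
def desWord : List (ℕ × ℕ) → List Bool
  | [] => []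
  | [_] => []
  | a :: b :: l => decide (a.1 < b.1) :: desWord (b :: l)

section DesWord

variable {k l l' : List (ℕ × ℕ)} {f : ℕ × ℕ → ℕ × ℕ}

@[simp] theorem desWord_singleton (a : ℕ × ℕ) : desWord [a] = [] := rfl

@[simp] theorem desWord_cons_cons (a b : ℕ × ℕ) (l : List (ℕ × ℕ)) :
    desWord (a :: b :: l) = decide (a.1 < b.1) :: desWord (b :: l) := rfl

theorem length_desWord : ∀ l, (desWord l).length = l.length - 1
  | [] => rfl
  | [_] => rfl
  | a :: b :: l => by simp [length_desWord (b :: l)]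

theorem desWord_append_cons : ∀ (k : List (ℕ × ℕ)) (a : ℕ × ℕ) (m : List (ℕ × ℕ)),
    desWord (k ++ a :: m) = desWord (k ++ [a]) ++ desWord (a :: m)
  | [], a, m => by simp
  | [b], a, m => by simp
  | b :: c :: k, a, m => congrArg (_ :: ·) (desWord_append_cons (c :: k) a m)

theorem desWord_concat_concat (k : List (ℕ × ℕ)) (a b : ℕ × ℕ) :
    desWord (k ++ [a, b]) = desWord (k ++ [a]) ++ [decide (a.1 < b.1)] := by
  rw [desWord_append_cons, desWord_cons_cons, desWord_singleton]

theorem desWord_append_right_inj (hlen : l.length = l'.length)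
    (hl : ∀ a ∈ l, ∀ b ∈ k, a.1 < b.1) (hl' : ∀ a ∈ l', ∀ b ∈ k, a.1 < b.1)
    (h : desWord l = desWord l') : desWord (l ++ k) = desWord (l' ++ k) := by
  obtain _ | ⟨b, k⟩ := k
  · simpa using h
  · induction l using List.reverseRecOn generalizing l' with
    | nil => rw [List.length_eq_zero_iff.1 hlen.symm]
    | append_singleton l a _ =>
      induction l' using List.reverseRecOn with
      | nil => simp at hlen
      | append_singleton l' a' _ =>
        have ha : a.1 < b.1 := hl a (by simp) b (by simp)
        have ha' : a'.1 < b.1 := hl' a' (by simp) b (by simp)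
        simp only [List.append_assoc, List.singleton_append]
        rw [desWord_append_cons l, desWord_append_cons l', h]
        simp [ha, ha']

theorem desWord_append_left_inj (hlen : l.length = l'.length)
    (hl : ∀ a ∈ k, ∀ b ∈ l, a.1 < b.1) (hl' : ∀ a ∈ k, ∀ b ∈ l', a.1 < b.1)
    (h : desWord l = desWord l') : desWord (k ++ l) = desWord (k ++ l') := by
  induction k using List.reverseRecOn with
  | nil => exact h
  | append_singleton k a _ =>
    cases l with
    | nil => rw [List.length_eq_zero_iff.1 hlen.symm]
    | cons b l =>
      cases l' with
      | nil => simp at hlen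
      | cons b' l' =>
        have hb : a.1 < b.1 := hl a (by simp) b (by simp)
        have hb' : a.1 < b'.1 := hl' a (by simp) b' (by simp)
        simp only [List.append_assoc, List.singleton_append]
        rw [desWord_append_cons k a, desWord_append_cons k a (b' :: l')]
        simp [hb, hb', h]

theorem desWord_map : ∀ {l : List (ℕ × ℕ)},
    (∀ a ∈ l, ∀ b ∈ l, (f a).1 < (f b).1 ↔ a.1 < b.1) → desWord (l.map f) = desWord l
  | [], _ => rfl
  | [_], _ => rfl
  | a :: b :: l, h => congrArg₂ _ (by simp [h a (by simp) b (by simp)]) <|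
    desWord_map fun x hx y hy => h x (List.mem_cons_of_mem _ hx) y (List.mem_cons_of_mem _ hy)

theorem desWord_map_reverse : ∀ {l : List (ℕ × ℕ)},
    (∀ a ∈ l, ∀ b ∈ l, (f b).1 < (f a).1 ↔ a.1 < b.1) →
    desWord (l.reverse.map f) = (desWord l).reverse
  | [], _ => rfl
  | [_], _ => rfl
  | a :: b :: l, h => by
    have ih := desWord_map_reverse (l := b :: l)
      fun x hx y hy => h x (List.mem_cons_of_mem _ hx) y (List.mem_cons_of_mem _ hy)
    have hab : (f b).1 < (f a).1 ↔ a.1 < b.1 := h a (by simp) b (by simp)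
    simp only [List.reverse_cons, List.map_append, List.map_cons, List.map_nil, List.append_assoc,
      List.cons_append, List.nil_append, desWord_cons_cons] at ih ⊢
    rw [desWord_concat_concat, ih, decide_eq_decide.2 hab]

end DesWord

/-- The set of descent words of the linear extensions of `C`. -/
def words (C : Finset (ℕ × ℕ)) : Set (List Bool) :=
  desWord '' {l | IsLinExt C l}

/-- The combinatorial form of `F`-multiplicity-freeness: distinct linear extensions of `C` have
distinct descent words. -/
def MultFree (C : Finset (ℕ × ℕ)) : Prop :=
  Set.InjOn desWord {l | IsLinExt C l}

/-- Order-convexity; the finite order-convex sets of cells are the skew diagrams up to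
translation. -/
def CellConvex (C : Finset (ℕ × ℕ)) : Prop :=
  ∀ i j i' j', (i, j) ∈ C → (i', j') ∈ C → ∀ a b, i ≤ a → a ≤ i' → j ≤ b → b ≤ j' → (a, b) ∈ C

section Symmetries

variable {C C' C₁ C₂ : Finset (ℕ × ℕ)} {f : ℕ × ℕ → ℕ × ℕ} {w : List Bool} {r c : ℕ}

theorem length_of_mem_words (h : w ∈ words C) : w.length = C.card - 1 := by
  obtain ⟨l, hl, rfl⟩ := h
  rw [length_desWord, hl.length_eq]

theorem image_words_subset {φ : List (ℕ × ℕ) → List (ℕ × ℕ)} {ψ : List Bool → List Bool}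
    (hφ : ∀ l, IsLinExt C l → IsLinExt C' (φ l) ∧ desWord (φ l) = ψ (desWord l)) :
    ψ '' words C ⊆ words C' := by
  rintro _ ⟨_, ⟨l, hl, rfl⟩, rfl⟩
  exact ⟨φ l, (hφ l hl).1, (hφ l hl).2⟩

theorem MultFree.of_linExt_embedding {φ : List (ℕ × ℕ) → List (ℕ × ℕ)} {ψ : List Bool → List Bool}
    (h : MultFree C') (hinj : Set.InjOn φ {l | IsLinExt C l})
    (hφ : ∀ l, IsLinExt C l → IsLinExt C' (φ l) ∧ desWord (φ l) = ψ (desWord l)) :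
    MultFree C := fun l hl l' hl' hw =>
  hinj hl hl' <| h (hφ l hl).1 (hφ l' hl').1 <| by rw [(hφ l hl).2, (hφ l' hl').2, hw]

theorem MultFree.of_rows (h : MultFree C) (hC : ∀ x, x ∈ C ↔ x ∈ C₁ ∨ x ∈ C₂)
    (hr : ∀ a ∈ C₁, ∀ b ∈ C₂, a.1 < b.1) : MultFree C₁ ∧ MultFree C₂ := by
  have hnle : ∀ a ∈ C₁, ∀ b ∈ C₂, ¬ b ≤ a := fun a ha b hb hba => (hr a ha b hb).not_ge hba.1
  have hrow {l k} (hl : IsLinExt C₁ l) (hk : IsLinExt C₂ k) : ∀ a ∈ l, ∀ b ∈ k, a.1 < b.1 :=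
    fun a ha b hb => hr a ((hl.mem_iff a).1 ha) b ((hk.mem_iff b).1 hb)
  constructor
  · intro l hl l' hl' hw
    obtain ⟨k, hk⟩ := exists_isLinExt C₂
    exact List.append_cancel_right <| h (hl.append hk hC hnle) (hl'.append hk hC hnle) <|
      desWord_append_right_inj (hl.length_eq.trans hl'.length_eq.symm) (hrow hl hk) (hrow hl' hk) hw
  · intro l hl l' hl' hw
    obtain ⟨k, hk⟩ := exists_isLinExt C₁
    exact List.append_cancel_left <| h (hk.append hl hC hnle) (hk.append hl' hC hnle) <|
      desWord_append_left_inj (hl.length_eq.trans hl'.length_eq.symm) (hrow hk hl) (hrow hk hl') hw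

theorem MultFree.filter_row_lt (h : MultFree C) (r : ℕ) : MultFree (C.filter (·.1 < r)) :=
  (h.of_rows (C₂ := C.filter (r ≤ ·.1)) (fun x => by grind) (fun a ha b hb => by grind)).1

theorem MultFree.filter_row_ge (h : MultFree C) (r : ℕ) : MultFree (C.filter (r ≤ ·.1)) :=
  (h.of_rows (C₁ := C.filter (·.1 < r)) (fun x => by grind) (fun a ha b hb => by grind)).2

/-- The map `f` preserves and reflects the strict order of the rows and that of the columns of the
cells of `C`. -/
structure IsRenumbering (f : ℕ × ℕ → ℕ × ℕ) (C : Finset (ℕ × ℕ)) : Prop where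
  row_lt_iff : ∀ a ∈ C, ∀ b ∈ C, (f a).1 < (f b).1 ↔ a.1 < b.1
  col_lt_iff : ∀ a ∈ C, ∀ b ∈ C, (f a).2 < (f b).2 ↔ a.2 < b.2

namespace IsRenumbering

theorem le_iff (hf : IsRenumbering f C) {a b : ℕ × ℕ} (ha : a ∈ C) (hb : b ∈ C) :
    f a ≤ f b ↔ a ≤ b := by
  rw [Prod.le_def, Prod.le_def, ← not_lt, ← not_lt, hf.row_lt_iff b hb a ha,
    hf.col_lt_iff b hb a ha, not_lt, not_lt]

theorem injOn (hf : IsRenumbering f C) : Set.InjOn f C := fun _ ha _ hb hab =>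
  le_antisymm ((hf.le_iff ha hb).1 hab.le) ((hf.le_iff hb ha).1 hab.ge)

theorem isLinExt_map (hf : IsRenumbering f C) {l : List (ℕ × ℕ)} (hl : IsLinExt C l) :
    IsLinExt (C.image f) (l.map f) ∧ desWord (l.map f) = desWord l :=
  ⟨hl.map fun _ ha _ hb => (hf.le_iff ha hb).1, desWord_map fun a ha b hb =>
    hf.row_lt_iff a ((hl.mem_iff a).1 ha) b ((hl.mem_iff b).1 hb)⟩

theorem invFunOn (hf : IsRenumbering f C) :
    IsRenumbering (Function.invFunOn f C) (C.image f) := by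
  have hinv := hf.injOn.leftInvOn_invFunOn
  constructor <;> simp only [Finset.forall_mem_image] <;> intro a ha b hb <;>
    rw [hinv ha, hinv hb]
  exacts [(hf.row_lt_iff a ha b hb).symm, (hf.col_lt_iff a ha b hb).symm]

theorem image_invFunOn (hf : IsRenumbering f C) :
    (C.image f).image (Function.invFunOn f C) = C := by
  rw [Finset.image_image]
  conv_rhs => rw [← Finset.image_id (s := C)]
  exact Finset.image_congr hf.injOn.leftInvOn_invFunOn

theorem multFree (hf : IsRenumbering f C) (h : MultFree (C.image f)) : MultFree C := by
  refine h.of_linExt_embedding (φ := List.map f) (ψ := id) ?_ fun _ => hf.isLinExt_map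
  refine Set.LeftInvOn.injOn (f₁' := List.map (Function.invFunOn f C)) fun l hl => ?_
  rw [List.map_map]
  exact (List.map_congr_left fun x hx =>
    hf.injOn.leftInvOn_invFunOn ((hl.mem_iff x).1 hx)).trans l.map_id

theorem words_subset (hf : IsRenumbering f C) : words C ⊆ words (C.image f) := by
  simpa using image_words_subset (ψ := id) fun _ => hf.isLinExt_map

theorem words_image (hf : IsRenumbering f C) : words (C.image f) = words C := by
  refine hf.words_subset.antisymm' ?_
  simpa only [hf.image_invFunOn] using hf.invFunOn.words_subset

theorem multFree_image_iff (hf : IsRenumbering f C) : MultFree (C.image f) ↔ MultFree C := by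
  refine ⟨hf.multFree, fun h => hf.invFunOn.multFree ?_⟩
  rwa [hf.image_invFunOn]

end IsRenumbering

theorem mem_image_swap {x : ℕ × ℕ} : x ∈ C.image Prod.swap ↔ x.swap ∈ C := by
  constructor
  · rw [Finset.mem_image]
    rintro ⟨y, hy, rfl⟩
    rwa [Prod.swap_swap]
  · exact fun hx => Finset.mem_image.2 ⟨_, hx, x.swap_swap⟩

theorem image_swap_swap (C : Finset (ℕ × ℕ)) : (C.image Prod.swap).image Prod.swap = C := by
  rw [Finset.image_image, Prod.swap_swap_eq, Finset.image_id]

namespace CellConvex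

theorem swap (hC : CellConvex C) : CellConvex (C.image Prod.swap) := by
  intro i j i' j' h h' a b h1 h2 h3 h4
  rw [mem_image_swap] at h h' ⊢
  exact hC _ _ _ _ h h' _ _ h3 h4 h1 h2

/-- If `b` were both below and to the right of `a`, the cell at the corner between them would have
to occur between them in the list. -/
theorem col_lt_iff_not_row_lt (hC : CellConvex C) {k m : List (ℕ × ℕ)} {a b : ℕ × ℕ}
    (h : IsLinExt C (k ++ a :: b :: m)) : a.2 < b.2 ↔ ¬ a.1 < b.1 := by
  have hab : ¬ b ≤ a := IsLinExt.not_le (l := k ++ [a]) (m := b :: m) (by simpa using h)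
    (by simp) (by simp)
  rw [Prod.le_def] at hab
  refine ⟨fun hcol hrow => ?_, by omega⟩
  have hcorner : (a.1, b.2) ∈ k ++ a :: b :: m := (h.mem_iff _).2 <|
    hC a.1 a.2 b.1 b.2 ((h.mem_iff a).1 (by simp)) ((h.mem_iff b).1 (by simp)) _ _
      le_rfl hrow.le hcol.le le_rfl
  simp only [List.mem_append, List.mem_cons] at hcorner
  rcases hcorner with hk | ha | hb | hm
  · exact h.not_le hk (b := a) (by simp) ⟨le_rfl, hcol.le⟩
  · exact hcol.ne (congrArg Prod.snd ha).symm
  · exact hrow.ne (congrArg Prod.fst hb.symm).symm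
  · exact IsLinExt.not_le (l := k ++ [a, b]) (by simpa using h) (a := b) (by simp) hm
      ⟨hrow.le, le_rfl⟩

theorem desWord_map_swap (hC : CellConvex C) : ∀ {k m : List (ℕ × ℕ)}, IsLinExt C (k ++ m) →
    desWord (m.map Prod.swap) = (desWord m).map not
  | _, [], _ => rfl
  | _, [_], _ => rfl
  | k, a :: b :: m, h => by
    have ih := desWord_map_swap hC (k := k ++ [a]) (m := b :: m) (by simpa using h)
    have hab := hC.col_lt_iff_not_row_lt h
    simp only [List.map_cons, desWord_cons_cons, Prod.fst_swap, hab, decide_not] at ih ⊢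
    rw [ih]

theorem isLinExt_map_swap (hC : CellConvex C) {l : List (ℕ × ℕ)} (hl : IsLinExt C l) :
    IsLinExt (C.image Prod.swap) (l.map Prod.swap) ∧
      desWord (l.map Prod.swap) = (desWord l).map not :=
  ⟨hl.map fun _ _ _ _ => Prod.swap_le_swap.1, hC.desWord_map_swap (k := []) hl⟩

theorem map_not_words_subset (hC : CellConvex C) :
    List.map not '' words C ⊆ words (C.image Prod.swap) :=
  image_words_subset fun _ => hC.isLinExt_map_swap

theorem words_swap (hC : CellConvex C) : words (C.image Prod.swap) = List.map not '' words C := by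
  refine hC.map_not_words_subset.antisymm' fun w hw => ⟨w.map not, ?_, by simp [Function.comp_def]⟩
  simpa only [image_swap_swap] using hC.swap.map_not_words_subset (Set.mem_image_of_mem _ hw)

end CellConvex

namespace MultFree

theorem swap (h : MultFree C) (hC : CellConvex C) : MultFree (C.image Prod.swap) := by
  rw [← image_swap_swap C] at h
  exact h.of_linExt_embedding (List.map_injective_iff.2 Prod.swap_injective).injOn
    fun _ => hC.swap.isLinExt_map_swap

end MultFree

/-- The part of `C` in the rows from `r₀` up to `r₁` (excluded) and the columns from `c₀` up to `c₁`
(excluded). -/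
def cellWindow (C : Finset (ℕ × ℕ)) (r₀ r₁ c₀ c₁ : ℕ) : Finset (ℕ × ℕ) :=
  C.filter fun x => r₀ ≤ x.1 ∧ x.1 < r₁ ∧ c₀ ≤ x.2 ∧ x.2 < c₁

theorem mem_cellWindow {r₀ r₁ c₀ c₁ : ℕ} {x : ℕ × ℕ} : x ∈ cellWindow C r₀ r₁ c₀ c₁ ↔
    x ∈ C ∧ r₀ ≤ x.1 ∧ x.1 < r₁ ∧ c₀ ≤ x.2 ∧ x.2 < c₁ :=
  Finset.mem_filter

theorem CellConvex.rowSlab (hC : CellConvex C) (r₀ r₁ : ℕ) :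
    CellConvex (C.filter fun x => r₀ ≤ x.1 ∧ x.1 < r₁) := by
  intro i j i' j' h h' a b h1 h2 h3 h4
  rw [Finset.mem_filter] at h h' ⊢
  exact ⟨hC _ _ _ _ h.1 h'.1 _ _ h1 h2 h3 h4, h.2.1.trans h1, h2.trans_lt h'.2.2⟩

theorem MultFree.rowSlab (h : MultFree C) (r₀ r₁ : ℕ) :
    MultFree (C.filter fun x => r₀ ≤ x.1 ∧ x.1 < r₁) := by
  simpa only [Finset.filter_filter] using (h.filter_row_ge r₀).filter_row_lt r₁

theorem MultFree.window (h : MultFree C) (hC : CellConvex C) (r₀ r₁ c₀ c₁ : ℕ) :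
    MultFree (cellWindow C r₀ r₁ c₀ c₁) := by
  have hrow := (h.rowSlab r₀ r₁).swap (hC.rowSlab r₀ r₁)
  have hcol := (hrow.rowSlab c₀ c₁).swap ((hC.rowSlab r₀ r₁).swap.rowSlab c₀ c₁)
  convert hcol using 1
  ext x
  simp only [mem_cellWindow, mem_image_swap, Finset.mem_filter, Prod.fst_swap,
    Prod.swap_swap, and_assoc]

/-- The set `C` rotated by 180 degrees in the box with `r` rows and `c` columns. -/
def rotCells (r c : ℕ) (C : Finset (ℕ × ℕ)) : Finset (ℕ × ℕ) :=
  C.image fun x => (r - 1 - x.1, c - 1 - x.2)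

/-- The set `C` lies in the box with `r` rows and `c` columns. -/
def InBox (r c : ℕ) (C : Finset (ℕ × ℕ)) : Prop :=
  ∀ x ∈ C, x.1 < r ∧ x.2 < c

namespace InBox

theorem mem_rotCells (h : InBox r c C) {x : ℕ × ℕ} :
    x ∈ rotCells r c C ↔ x.1 < r ∧ x.2 < c ∧ (r - 1 - x.1, c - 1 - x.2) ∈ C := by
  rw [rotCells, Finset.mem_image]
  constructor
  · rintro ⟨a, ha, rfl⟩
    have := h a ha
    refine ⟨by dsimp; omega, by dsimp; omega, ?_⟩
    convert ha <;> dsimp <;> omega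
  · rintro ⟨hi, hj, hm⟩
    exact ⟨_, hm, Prod.ext (by dsimp; omega) (by dsimp; omega)⟩

theorem rot (h : InBox r c C) : InBox r c (rotCells r c C) := fun _ hx =>
  ⟨(h.mem_rotCells.1 hx).1, (h.mem_rotCells.1 hx).2.1⟩

theorem rotCells_rotCells (h : InBox r c C) : rotCells r c (rotCells r c C) = C := by
  ext x
  rw [h.rot.mem_rotCells, h.mem_rotCells]
  constructor
  · rintro ⟨h1, h2, -, -, h3⟩
    convert h3 <;> dsimp <;> omega
  · intro hx
    have := h x hx
    refine ⟨this.1, this.2, by dsimp; omega, by dsimp; omega, ?_⟩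
    convert hx <;> dsimp <;> omega

theorem isLinExt_rot (h : InBox r c C) {l : List (ℕ × ℕ)} (hl : IsLinExt C l) :
    IsLinExt (rotCells r c C) (l.reverse.map fun x => (r - 1 - x.1, c - 1 - x.2)) ∧
      desWord (l.reverse.map fun x => (r - 1 - x.1, c - 1 - x.2)) = (desWord l).reverse := by
  refine ⟨hl.map_reverse fun a ha b hb hab => ?_, desWord_map_reverse fun a ha b hb => ?_⟩
  · have := h a ha
    have := h b hb
    rw [Prod.mk_le_mk] at hab
    exact Prod.le_def.2 (by omega)
  · have := h a ((hl.mem_iff a).1 ha)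
    have := h b ((hl.mem_iff b).1 hb)
    omega

theorem reverse_words_subset (h : InBox r c C) :
    List.reverse '' words C ⊆ words (rotCells r c C) :=
  image_words_subset fun _ => h.isLinExt_rot

theorem words_rotCells (h : InBox r c C) :
    words (rotCells r c C) = List.reverse '' words C := by
  refine h.reverse_words_subset.antisymm' fun w hw => ⟨w.reverse, ?_, w.reverse_reverse⟩
  simpa only [h.rotCells_rotCells] using h.rot.reverse_words_subset (Set.mem_image_of_mem _ hw)

end InBox

theorem MultFree.rot (h : MultFree C) (hC : InBox r c C) : MultFree (rotCells r c C) := by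
  rw [← hC.rotCells_rotCells] at h
  refine h.of_linExt_embedding (fun l hl l' hl' hll => ?_) fun _ => hC.rot.isLinExt_rot
  have hinv {k} (hk : IsLinExt (rotCells r c C) k) :
      (k.map fun x => (r - 1 - x.1, c - 1 - x.2)).map
        (fun x => (r - 1 - x.1, c - 1 - x.2)) = k := by
    rw [List.map_map, List.map_congr_left (g := id) fun x hx => ?_, List.map_id]
    have := hC.rot x ((hk.mem_iff x).1 hx)
    exact Prod.ext (by dsimp; omega) (by dsimp; omega)
  rw [List.map_reverse, List.map_reverse, List.reverse_inj] at hll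
  rw [← hinv hl, hll, hinv hl']

end Symmetries

section BadWindows

variable {C : Finset (ℕ × ℕ)} {H W : ℕ} {l l' : List (ℕ × ℕ)}

/-- The lists `l` and `l'` are distinct linear extensions, with the same descent word, of the same
set of cells in a box with `H` rows and `W` columns. -/
def BadPair (H W : ℕ) (l l' : List (ℕ × ℕ)) : Prop :=
  (∀ x ∈ l, x ∈ l') ∧ (∀ x ∈ l', x ∈ l) ∧ (l.Pairwise fun a b => ¬ b ≤ a) ∧
    (l'.Pairwise fun a b => ¬ b ≤ a) ∧ desWord l = desWord l' ∧ l ≠ l' ∧ ∀ x ∈ l, x.1 < H ∧ x.2 < W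

instance (H W : ℕ) (l l' : List (ℕ × ℕ)) : Decidable (BadPair H W l l') := by
  unfold BadPair; infer_instance

theorem BadPair.not_multFree (h : BadPair H W l l') : ¬ MultFree l.toFinset := by
  obtain ⟨h1, h2, hl, hl', hw, hne, -⟩ := h
  exact fun hm => hne <| hm ⟨fun x => List.mem_toFinset.symm, hl⟩
    ⟨fun x => by rw [List.mem_toFinset]; exact ⟨h2 x, h1 x⟩, hl'⟩ hw

theorem BadPair.not_multFree_of_window (h : BadPair H W l l') (hC : CellConvex C) (r₀ c₀ : ℕ)
    (hw : ∀ i < H, ∀ j < W, ((r₀ + i, c₀ + j) ∈ C ↔ (i, j) ∈ l)) : ¬ MultFree C := by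
  intro hm
  have hwindow : cellWindow C r₀ (r₀ + H) c₀ (c₀ + W) =
      l.toFinset.image fun x => (r₀ + x.1, c₀ + x.2) := by
    ext ⟨i, j⟩
    simp only [mem_cellWindow, Finset.mem_image, List.mem_toFinset, Prod.exists, Prod.mk.injEq]
    constructor
    · rintro ⟨hij, h1, h2, h3, h4⟩
      refine ⟨i - r₀, j - c₀, (hw _ (by omega) _ (by omega)).1 ?_, by omega, by omega⟩
      rwa [Nat.add_sub_cancel' h1, Nat.add_sub_cancel' h3]
    · rintro ⟨a, b, hab, rfl, rfl⟩
      have hbox := h.2.2.2.2.2.2 _ hab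
      exact ⟨(hw _ hbox.1 _ hbox.2).2 hab, by dsimp at hbox; omega⟩
  have hrel : IsRenumbering (fun x => (r₀ + x.1, c₀ + x.2)) l.toFinset :=
    ⟨fun _ _ _ _ => Nat.add_lt_add_iff_left, fun _ _ _ _ => Nat.add_lt_add_iff_left⟩
  exact h.not_multFree (hrel.multFree (hwindow ▸ hm.window hC r₀ (r₀ + H) c₀ (c₀ + W)))

/-- A column together with a cell `x` to its left, not above its lowest cell, and a cell `z` to its
right, not below its highest cell. The two words agree whether `x` comes first, or `z` does. -/
theorem not_multFree_of_column {j a b x₁ x₂ z₁ z₂ : ℕ} (hab : a < b)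
    (hx₁ : b ≤ x₁) (hx₂ : x₂ < j) (hz₁ : z₁ ≤ a) (hz₂ : j < z₂)
    (hC : ∀ y, y ∈ C ↔ (y.2 = j ∧ a ≤ y.1 ∧ y.1 ≤ b) ∨ y = (x₁, x₂) ∨ y = (z₁, z₂)) :
    ¬ MultFree C := by
  intro hm
  obtain ⟨k, hk⟩ := exists_isLinExt (C.filter fun y => y.2 = j ∧ a + 2 ≤ y.1)
  have hkmem : ∀ y, y ∈ k ↔ y.2 = j ∧ a + 2 ≤ y.1 ∧ y.1 ≤ b := by
    rintro ⟨y₁, y₂⟩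
    rw [hk.mem_iff, Finset.mem_filter, hC]
    simp only [Prod.mk.injEq]
    omega
  have happend (l : List (ℕ × ℕ)) (hl : l.Pairwise fun a b => ¬ b ≤ a)
      (hmem : ∀ y, y ∈ l ↔ y = (a, j) ∨ y = (a + 1, j) ∨ y = (x₁, x₂) ∨ y = (z₁, z₂)) :
      IsLinExt C (l ++ k) := by
    refine ⟨?_, List.pairwise_append.2 ⟨hl, hk.pairwise, ?_⟩⟩
    · rintro ⟨y₁, y₂⟩
      simp only [List.mem_append, hmem, hkmem, hC, Prod.mk.injEq]
      omega
    · rintro ⟨u₁, u₂⟩ hu ⟨v₁, v₂⟩ hv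
      simp only [hmem, hkmem, Prod.mk.injEq, Prod.mk_le_mk] at hu hv ⊢
      omega
  have hlists := hm
    (happend [(a, j), (z₁, z₂), (x₁, x₂), (a + 1, j)]
      (by simp only [List.pairwise_cons, List.forall_mem_cons, Prod.mk_le_mk]; grind) (by grind))
    (happend [(x₁, x₂), (a, j), (a + 1, j), (z₁, z₂)]
      (by simp only [List.pairwise_cons, List.forall_mem_cons, Prod.mk_le_mk]; grind) (by grind))
    (by
      obtain _ | ⟨v, k⟩ := k
      · simp; omega
      · have hv : a + 2 ≤ v.1 := ((hkmem v).1 (by simp)).2.1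
        simp; omega)
  simp only [List.cons_append, List.cons.injEq, Prod.mk.injEq] at hlists
  omega

end BadWindows

/-- `C` is a skew diagram with `r` nonempty rows and `c` nonempty columns. -/
structure IsSkewDiagram (C : Finset (ℕ × ℕ)) (r c : ℕ) : Prop where
  convex : CellConvex C
  inBox : InBox r c C
  exists_mem_row : ∀ i < r, ∃ j, (i, j) ∈ C
  exists_mem_col : ∀ j < c, ∃ i, (i, j) ∈ C

/-- `(i, j)` is just outside an inner corner of the upper left boundary of `C`: the cells below it
and to its right belong to `C`, but it does not. -/
def InnerNotch (C : Finset (ℕ × ℕ)) (i j : ℕ) : Prop :=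
  (i, j) ∉ C ∧ (i + 1, j) ∈ C ∧ (i, j + 1) ∈ C

/-- The analogue of `InnerNotch` for the lower right boundary of `C`, indexed so that the missing
cell is `(i + 1, j + 1)`. -/
def OuterNotch (C : Finset (ℕ × ℕ)) (i j : ℕ) : Prop :=
  (i + 1, j + 1) ∉ C ∧ (i + 1, j) ∈ C ∧ (i, j + 1) ∈ C

section Notches

variable {C : Finset (ℕ × ℕ)} {r c i j i' j' : ℕ}

theorem CellConvex.rot (hC : CellConvex C) (h : InBox r c C) : CellConvex (rotCells r c C) := by
  intro i j i' j' hij hij' a b h1 h2 h3 h4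
  rw [h.mem_rotCells] at hij hij' ⊢
  exact ⟨by dsimp at *; omega, by dsimp at *; omega,
    hC _ _ _ _ hij'.2.2 hij.2.2 _ _ (by dsimp; omega) (by dsimp; omega) (by dsimp; omega)
      (by dsimp; omega)⟩

namespace IsSkewDiagram

theorem swap (h : IsSkewDiagram C r c) : IsSkewDiagram (C.image Prod.swap) c r where
  convex := h.convex.swap
  inBox _ hx := (h.inBox _ (mem_image_swap.1 hx)).symm
  exists_mem_row i hi := (h.exists_mem_col i hi).imp fun _ => mem_image_swap.2
  exists_mem_col j hj := (h.exists_mem_row j hj).imp fun _ => mem_image_swap.2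

theorem rot (h : IsSkewDiagram C r c) : IsSkewDiagram (rotCells r c C) r c where
  convex := h.convex.rot h.inBox
  inBox := h.inBox.rot
  exists_mem_row i hi := by
    obtain ⟨j, hj⟩ := h.exists_mem_row (r - 1 - i) (by omega)
    have hjc : j < c := (h.inBox _ hj).2
    refine ⟨c - 1 - j, h.inBox.mem_rotCells.2 ⟨hi, by dsimp; omega, ?_⟩⟩
    rwa [show c - 1 - (c - 1 - j) = j by omega]
  exists_mem_col j hj := by
    obtain ⟨i, hi⟩ := h.exists_mem_col (c - 1 - j) (by omega)
    have hir : i < r := (h.inBox _ hi).1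
    refine ⟨r - 1 - i, h.inBox.mem_rotCells.2 ⟨by dsimp; omega, hj, ?_⟩⟩
    rwa [show r - 1 - (r - 1 - i) = i by omega]

end IsSkewDiagram

theorem innerNotch_swap : InnerNotch (C.image Prod.swap) i j ↔ InnerNotch C j i := by
  simp only [InnerNotch, mem_image_swap, Prod.swap_prod_mk]
  tauto

theorem outerNotch_swap : OuterNotch (C.image Prod.swap) i j ↔ OuterNotch C j i := by
  simp only [OuterNotch, mem_image_swap, Prod.swap_prod_mk]
  tauto

theorem InBox.innerNotch_rot (h : InBox r c C) (hi : i + 2 ≤ r) (hj : j + 2 ≤ c) :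
    InnerNotch (rotCells r c C) (r - 2 - i) (c - 2 - j) ↔ OuterNotch C i j := by
  simp only [InnerNotch, OuterNotch, h.mem_rotCells]
  rw [show r - 1 - (r - 2 - i) = i + 1 by omega, show c - 1 - (c - 2 - j) = j + 1 by omega,
    show r - 1 - (r - 2 - i + 1) = i by omega, show c - 1 - (c - 2 - j + 1) = j by omega]
  have h1 : r - 2 - i < r := by omega
  have h2 : c - 2 - j < c := by omega
  have h3 : r - 2 - i + 1 < r := by omega
  have h4 : c - 2 - j + 1 < c := by omega
  simp only [h1, h2, h3, h4, true_and]
  tauto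

theorem InBox.outerNotch_rot (h : InBox r c C) (hi : i + 2 ≤ r) (hj : j + 2 ≤ c) :
    OuterNotch (rotCells r c C) (r - 2 - i) (c - 2 - j) ↔ InnerNotch C i j := by
  rw [← h.rot.innerNotch_rot (by omega) (by omega), h.rotCells_rotCells,
    show r - 2 - (r - 2 - i) = i by omega, show c - 2 - (c - 2 - j) = j by omega]

theorem InBox.innerNotch_bound (h : InBox r c C) (hn : InnerNotch C i j) :
    i + 2 ≤ r ∧ j + 2 ≤ c :=
  ⟨(h _ hn.2.1).1, (h _ hn.2.2).2⟩

end Notches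

/-- `C` is the skew diagram with `r` nonempty rows and `c` nonempty columns whose column `j`
consists of the rows `p j ≤ i < q j`. -/
structure ColRep (C : Finset (ℕ × ℕ)) (r c : ℕ) (p q : ℕ → ℕ) : Prop
    extends IsSkewDiagram C r c where
  mem : ∀ i j, (i, j) ∈ C ↔ j < c ∧ p j ≤ i ∧ i < q j
  lt : ∀ j < c, p j < q j

section Classification

variable {C : Finset (ℕ × ℕ)} {r c : ℕ} {p q : ℕ → ℕ}

theorem CellConvex.exists_col_interval {i₀ j : ℕ} (hC : CellConvex C) (h₀ : (i₀, j) ∈ C) :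
    ∃ p q, p < q ∧ ∀ i, (i, j) ∈ C ↔ p ≤ i ∧ i < q := by
  let S := (C.filter fun x => x.2 = j).image Prod.fst
  have hS : ∀ i, i ∈ S ↔ (i, j) ∈ C := by simp [S]
  have hne : S.Nonempty := ⟨i₀, (hS _).2 h₀⟩
  refine ⟨S.min' hne, S.max' hne + 1, Nat.lt_succ_of_le (S.min'_le_max' hne), fun i => ?_⟩
  refine ⟨fun hi => ?_, fun hi => ?_⟩
  · have hiS := (hS i).2 hi
    exact ⟨S.min'_le i hiS, Nat.lt_succ_of_le (S.le_max' i hiS)⟩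
  · exact hC _ _ _ _ ((hS _).1 (S.min'_mem hne)) ((hS _).1 (S.max'_mem hne)) _ _ hi.1
      (Nat.le_of_lt_succ hi.2) le_rfl le_rfl

theorem IsSkewDiagram.exists_colRep (h : IsSkewDiagram C r c) : ∃ p q, ColRep C r c p q := by
  have hcol : ∀ j, ∃ p q, j < c → p < q ∧ ∀ i, (i, j) ∈ C ↔ p ≤ i ∧ i < q := by
    intro j
    by_cases hj : j < c
    · obtain ⟨i₀, hi₀⟩ := h.exists_mem_col j hj
      obtain ⟨p, q, hpq⟩ := h.convex.exists_col_interval hi₀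
      exact ⟨p, q, fun _ => hpq⟩
    · exact ⟨0, 0, fun hj' => absurd hj' hj⟩
  choose p q hpq using hcol
  refine ⟨p, q, h, fun i j => ⟨fun hij => ?_, fun hij => ?_⟩, fun j hj => (hpq j hj).1⟩
  · have hj := (h.inBox _ hij).2
    exact ⟨hj, ((hpq j hj).2 i).1 hij⟩
  · exact ((hpq j hij.1).2 i).2 hij.2

namespace ColRep

variable (h : ColRep C r c p q) {j j' : ℕ}
include h

theorem top_mem (hj : j < c) : (p j, j) ∈ C := (h.mem _ _).2 ⟨hj, le_rfl, h.lt j hj⟩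

theorem bot_mem (hj : j < c) : (q j - 1, j) ∈ C := by
  have := h.lt j hj
  exact (h.mem _ _).2 ⟨hj, by omega, by omega⟩

theorem p_anti (hj : j ≤ j') (hc : j' < c) : p j' ≤ p j := by
  by_contra! hlt
  have hcell := h.convex _ _ _ _ (h.top_mem (hj.trans_lt hc)) (h.top_mem hc) (p j) j' le_rfl hlt.le
    hj le_rfl
  exact hlt.not_ge ((h.mem _ _).1 hcell).2.1

theorem q_anti (hj : j ≤ j') (hc : j' < c) : q j' ≤ q j := by
  by_contra! hlt
  have hcell := h.convex _ _ _ _ (h.bot_mem (hj.trans_lt hc)) (h.bot_mem hc) (q j' - 1) j (by omega)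
    le_rfl le_rfl hj
  have := ((h.mem _ _).1 hcell).2.2
  omega

theorem p_le_q_succ (hj : j + 1 < c) : p j ≤ q (j + 1) := by
  by_contra! hlt
  have htop := h.top_mem (j := j) (by omega)
  obtain ⟨k, hk⟩ := h.exists_mem_row (q (j + 1)) (hlt.trans (h.inBox _ htop).1)
  rcases Nat.lt_or_ge j k with hjk | hjk
  · have hcell :=
      h.convex _ _ _ _ (h.bot_mem hj) hk (q (j + 1)) (j + 1) (by omega) le_rfl le_rfl hjk
    exact lt_irrefl _ ((h.mem _ _).1 hcell).2.2
  · have hcell := h.convex _ _ _ _ hk htop (q (j + 1)) j le_rfl hlt.le hjk le_rfl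
    exact hlt.not_ge ((h.mem _ _).1 hcell).2.1

theorem q_zero (hc : 0 < c) : q 0 = r := by
  have hbot := h.bot_mem hc
  have hlt := h.lt 0 hc
  have hr : q 0 - 1 < r := (h.inBox _ hbot).1
  obtain ⟨k, hk⟩ := h.exists_mem_row (r - 1) (by omega)
  have hcell := h.convex _ _ _ _ hbot hk (r - 1) 0 (by omega) le_rfl le_rfl (Nat.zero_le _)
  have := ((h.mem _ _).1 hcell).2.2
  omega

theorem p_last (hc : 0 < c) : p (c - 1) = 0 := by
  have htop := h.top_mem (Nat.sub_lt hc one_pos)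
  obtain ⟨k, hk⟩ := h.exists_mem_row 0 (Nat.zero_lt_of_lt (h.inBox _ htop).1)
  have hkc : k < c := (h.inBox _ hk).2
  have hcell := h.convex _ _ _ _ hk htop 0 (c - 1) le_rfl (Nat.zero_le _) (by omega) le_rfl
  exact Nat.le_zero.1 ((h.mem _ _).1 hcell).2.1

theorem innerNotch_iff {a b : ℕ} :
    InnerNotch C a b ↔ b + 1 < c ∧ p b = a + 1 ∧ p (b + 1) < p b := by
  simp only [InnerNotch, h.mem]
  constructor
  · omega
  · rintro ⟨hb, hp, hlt⟩
    have := h.lt b (by omega)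
    have := h.p_le_q_succ hb
    omega

theorem outerNotch_iff {a b : ℕ} :
    OuterNotch C a b ↔ b + 1 < c ∧ q (b + 1) = a + 1 ∧ q (b + 1) < q b := by
  simp only [OuterNotch, h.mem]
  constructor
  · omega
  · rintro ⟨hb, hq, hlt⟩
    have := h.lt (b + 1) (by omega)
    have := h.p_le_q_succ hb
    omega

end ColRep

theorem CellConvex.mem_iff_of_notches {a b a' b' : ℕ} (hC : CellConvex C) (hin : InnerNotch C a b)
    (hout : OuterNotch C a' b') {i j : ℕ} (hi : a ≤ i) (hi' : i ≤ a' + 1) (hj : b ≤ j)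
    (hj' : j ≤ b' + 1) : (i, j) ∈ C ↔ ¬ (i = a ∧ j = b) ∧ ¬ (i = a' + 1 ∧ j = b' + 1) := by
  obtain ⟨hin₀, hin₁, hin₂⟩ := hin
  obtain ⟨hout₀, hout₁, hout₂⟩ := hout
  refine ⟨fun h => ⟨?_, ?_⟩, fun ⟨h, h'⟩ => ?_⟩
  · rintro ⟨rfl, rfl⟩
    exact hin₀ h
  · rintro ⟨rfl, rfl⟩
    exact hout₀ h
  obtain ⟨u, v, huv, hui, hvj⟩ : ∃ u v, (u, v) ∈ C ∧ u ≤ i ∧ v ≤ j := by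
    rcases (by omega : a + 1 ≤ i ∨ b + 1 ≤ j) with h | h
    · exact ⟨_, _, hin₁, h, hj⟩
    · exact ⟨_, _, hin₂, hi, h⟩
  obtain ⟨u', v', huv', hui', hvj'⟩ : ∃ u v, (u, v) ∈ C ∧ i ≤ u ∧ j ≤ v := by
    rcases (by omega : i ≤ a' ∨ j ≤ b') with h | h
    · exact ⟨_, _, hout₂, h, hj'⟩
    · exact ⟨_, _, hout₁, hi', h⟩
  exact hC _ _ _ _ huv huv' _ _ hui hui' hvj hvj'

theorem CellConvex.not_multFree_of_tall_notches {a b a' b' : ℕ} (hC : CellConvex C)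
    (hin : InnerNotch C a b) (hout : OuterNotch C a' b') (ha : a < a') (hb : b ≤ b')
    (hle : b' + a ≤ a' + b) : ¬ MultFree C := by
  have hmem {i j : ℕ} := hC.mem_iff_of_notches (i := i) (j := j) hin hout
  by_cases hbig : a + 3 ≤ a' ∨ a + 2 ≤ a' ∧ b + 1 ≤ b'
  · refine BadPair.not_multFree_of_window (H := 4) (W := 2)
      (l := [(0, 1), (1, 0), (1, 1), (2, 0), (3, 0), (2, 1), (3, 1)])
      (l' := [(1, 0), (2, 0), (0, 1), (1, 1), (3, 0), (2, 1), (3, 1)]) (by decide) hC a b ?_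
    intro i hi j hj
    rw [hmem (by omega) (by omega) (by omega) (by omega)]
    interval_cases j <;> interval_cases i <;> simp <;> omega
  obtain ⟨rfl, rfl⟩ | ⟨rfl, rfl⟩ | ⟨rfl, rfl⟩ :
      (a' = a + 2 ∧ b' = b) ∨ (a' = a + 1 ∧ b' = b) ∨ (a' = a + 1 ∧ b' = b + 1) := by omega
  · refine BadPair.not_multFree_of_window (H := 4) (W := 2)
      (l := [(1, 0), (0, 1), (1, 1), (2, 0), (2, 1), (3, 0)])
      (l' := [(1, 0), (0, 1), (2, 0), (3, 0), (1, 1), (2, 1)]) (by decide) hC a b' ?_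
    intro i hi j hj
    rw [hmem (by omega) (by omega) (by omega) (by omega)]
    interval_cases j <;> interval_cases i <;> simp; omega
  · refine BadPair.not_multFree_of_window (H := 3) (W := 2)
      (l := [(0, 1), (1, 0), (1, 1), (2, 0)])
      (l' := [(1, 0), (2, 0), (0, 1), (1, 1)]) (by decide) hC a b' ?_
    intro i hi j hj
    rw [hmem (by omega) (by omega) (by omega) (by omega)]
    interval_cases j <;> interval_cases i <;> simp; omega
  · refine BadPair.not_multFree_of_window (H := 3) (W := 3)
      (l := [(0, 1), (1, 0), (0, 2), (1, 1), (1, 2), (2, 0), (2, 1)])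
      (l' := [(0, 1), (1, 0), (0, 2), (2, 0), (1, 1), (2, 1), (1, 2)]) (by decide) hC a b ?_
    intro i hi j hj
    rw [hmem (by omega) (by omega) (by omega) (by omega)]
    interval_cases j <;> interval_cases i <;> simp <;> omega

theorem CellConvex.not_multFree_of_notches {a b a' b' : ℕ} (hC : CellConvex C)
    (hin : InnerNotch C a b) (hout : OuterNotch C a' b') (ha : a ≤ a') (hb : b ≤ b')
    (hne : a < a' ∨ b < b') : ¬ MultFree C := by
  rcases le_total (b' + a) (a' + b) with hle | hle
  · exact hC.not_multFree_of_tall_notches hin hout (by omega) hb hle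
  · exact fun hm => hC.swap.not_multFree_of_tall_notches (innerNotch_swap.2 hin)
      (outerNotch_swap.2 hout) (by omega) ha (by omega) (hm.swap hC)

/-- The cells `(i + 1, j)` and `(i, j + 1)` belong to `C`, and touch only in a corner; a skew
diagram is disconnected there. -/
def IsCut (C : Finset (ℕ × ℕ)) (i j : ℕ) : Prop :=
  InnerNotch C i j ∧ OuterNotch C i j

theorem isCut_swap {i j : ℕ} : IsCut (C.image Prod.swap) i j ↔ IsCut C j i :=
  and_congr innerNotch_swap outerNotch_swap

theorem InBox.isCut_rot {i j : ℕ} (h : InBox r c C) (hi : i + 2 ≤ r) (hj : j + 2 ≤ c) :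
    IsCut (rotCells r c C) (r - 2 - i) (c - 2 - j) ↔ IsCut C i j := by
  rw [IsCut, h.innerNotch_rot hi hj, h.outerNotch_rot hi hj, IsCut, and_comm]

namespace ColRep

variable (h : ColRep C r c p q)
include h

theorem not_multFree_of_far {j : ℕ} (hj : j + 2 < c) (hlt : q (j + 2) < p j) : ¬ MultFree C := by
  have hp₁ : p (j + 1) ≤ q (j + 2) := h.p_le_q_succ hj
  have hq₁ : p j ≤ q (j + 1) := h.p_le_q_succ (by omega)
  have hpp : p (j + 1) ≤ p j := h.p_anti (by omega) (by omega)
  have hqq : q (j + 2) ≤ q (j + 1) := h.q_anti (by omega) hj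
  have hlt₀ := h.lt j (by omega)
  have hlt₁ := h.lt (j + 1) (by omega)
  have hlt₂ := h.lt (j + 2) hj
  by_cases hsingle : q (j + 1) = p j ∧ p (j + 1) = q (j + 2) ∧ p j = q (j + 2) + 1
  · refine BadPair.not_multFree_of_window (H := 3) (W := 3) (l := [(0, 2), (2, 0), (1, 1)])
      (l' := [(1, 1), (2, 0), (0, 2)]) (by decide) h.convex (q (j + 2) - 1) j ?_
    intro i hi k hk
    rw [h.mem]
    interval_cases k <;> interval_cases i <;> simp <;> omega
  · refine fun hm => not_multFree_of_column (C := cellWindow C (q (j + 2) - 1) (p j + 1) j (j + 3))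
      (j := j + 1) (a := max (p (j + 1)) (q (j + 2) - 1)) (b := min (q (j + 1) - 1) (p j))
      (x₁ := p j) (x₂ := j) (z₁ := q (j + 2) - 1) (z₂ := j + 2) (by omega) (by omega) (by omega)
      (by omega) (by omega) ?_ (hm.window h.convex _ _ _ _)
    rintro ⟨i, k⟩
    simp only [mem_cellWindow, h.mem, Prod.mk.injEq]
    rcases (by omega : k = j ∨ k = j + 1 ∨ k = j + 2 ∨ k < j ∨ j + 3 ≤ k)
      with rfl | rfl | rfl | hk | hk <;> omega

theorem not_multFree_of_short_third_column {j : ℕ} (hj : j + 2 < c) (hp : p j < q (j + 2))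
    (hq : q (j + 2) + 2 ≤ q (j + 1)) : ¬ MultFree C := by
  have hp₁ : p (j + 1) ≤ p j := h.p_anti (by omega) (by omega)
  have hp₂ : p (j + 2) ≤ p j := h.p_anti (by omega) hj
  have hq₁ : q (j + 1) ≤ q j := h.q_anti (by omega) (by omega)
  refine BadPair.not_multFree_of_window (H := 3) (W := 3)
    (l := [(0, 0), (0, 1), (1, 0), (0, 2), (2, 0), (1, 1), (2, 1)])
    (l' := [(0, 0), (0, 1), (1, 0), (1, 1), (2, 0), (0, 2), (2, 1)]) (by decide) h.convex
    (q (j + 2) - 1) j ?_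
  intro i hi k hk
  rw [h.mem]
  interval_cases k <;> interval_cases i <;> simp <;> omega

theorem not_multFree_of_drop_lt_drop (hcut : ∀ j, j + 1 < c → p j ≠ q (j + 1)) {u v : ℕ}
    (huv : u < v) (hv : v + 1 < c) (hu : p (u + 1) < p u) (hq : q (v + 1) < q v) :
    ¬ MultFree C := by
  induction hn : v - u using Nat.strong_induction_on generalizing u v with | _ n ih
  subst hn
  by_cases hbetween : ∃ w, u < w ∧ w < v ∧ (p (w + 1) < p w ∨ q (w + 1) < q w)
  · obtain ⟨w, huw, hwv, hw | hw⟩ := hbetween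
    · exact ih _ (by omega) hwv hv hw hq rfl
    · exact ih _ (by omega) huw (by omega) hu hw rfl
  push Not at hbetween
  rcases Nat.lt_or_ge (q (v + 1)) (p u) with hlt | hle
  · obtain ⟨x, rfl⟩ : ∃ x, v = x + 1 := ⟨v - 1, by omega⟩
    obtain rfl | hux := (by omega : x = u ∨ u + 1 ≤ x)
    · exact h.not_multFree_of_far hv hlt
    have hconst : ∀ w, u + 1 ≤ w → w ≤ x + 1 → q (u + 1) ≤ q w := by
      intro w hw
      induction w, hw using Nat.le_induction with
      | base => exact fun _ => le_rfl
      | succ w hw ihw => exact fun hwx => (ihw (by omega)).trans (hbetween w hw hwx).2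
    have hpx : p x ≤ p (x + 1) := (hbetween x hux (Nat.lt_succ_self x)).1
    have hpq : p (x + 1) < q (x + 2) := (h.p_le_q_succ hv).lt_of_ne (hcut _ hv)
    have hpq' : p u < q (u + 1) := (h.p_le_q_succ (by omega)).lt_of_ne (hcut _ (by omega))
    have hqx : q (u + 1) ≤ q (x + 1) := hconst _ (by omega) le_rfl
    exact h.not_multFree_of_short_third_column hv (hpx.trans_lt hpq)
      (by change q (x + 2) < p u at hlt; omega)
  · exact h.convex.not_multFree_of_notches (a := p u - 1) (b := u) (a' := q (v + 1) - 1) (b' := v)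
      (h.innerNotch_iff.2 ⟨by omega, by omega, hu⟩) (h.outerNotch_iff.2 ⟨hv, by omega, hq⟩)
      (by omega) huv.le (Or.inr huv)

theorem isCut_of_p_eq_q_succ {j : ℕ} (hj : j + 1 < c) (hpq : p j = q (j + 1)) :
    IsCut C (p j - 1) j := by
  have hlt := h.lt j (by omega)
  have hlt' := h.lt (j + 1) hj
  exact ⟨h.innerNotch_iff.2 ⟨hj, by omega, by omega⟩, h.outerNotch_iff.2 ⟨hj, by omega, by omega⟩⟩

end ColRep

namespace IsSkewDiagram

variable {a b a' b' : ℕ}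

theorem outerNotch_col_le (h : IsSkewDiagram C r c) (hm : MultFree C)
    (hcut : ∀ i j, ¬ IsCut C i j) (hin : InnerNotch C a b) (hout : OuterNotch C a' b') :
    b' ≤ b := by
  obtain ⟨p, q, h⟩ := h.exists_colRep
  by_contra! hlt
  exact h.not_multFree_of_drop_lt_drop
    (fun j hj hpq => hcut _ _ (h.isCut_of_p_eq_q_succ hj hpq)) hlt
    (h.outerNotch_iff.1 hout).1 (h.innerNotch_iff.1 hin).2.2 (h.outerNotch_iff.1 hout).2.2 hm

theorem exists_isCut (h : IsSkewDiagram C r c) (hm : MultFree C) (hin : InnerNotch C a b)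
    (hout : OuterNotch C a' b') : ∃ i j, IsCut C i j := by
  by_contra! hcut
  have hb : b' ≤ b := h.outerNotch_col_le hm hcut hin hout
  have ha : a' ≤ a := h.swap.outerNotch_col_le (hm.swap h.convex)
    (fun i j hij => hcut j i (isCut_swap.1 hij)) (innerNotch_swap.2 hin) (outerNotch_swap.2 hout)
  have hb' : ¬ b' < b := fun hlt => hout.1 <|
    h.convex _ _ _ _ hout.2.2 hin.2.1 _ _ (by omega) (by omega) le_rfl hlt
  have ha' : ¬ a' < a := fun hlt => hout.1 <|
    h.convex _ _ _ _ hout.2.1 hin.2.2 _ _ le_rfl hlt (by omega) (by omega)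
  obtain rfl : a' = a := by omega
  obtain rfl : b' = b := by omega
  exact hcut _ _ ⟨hin, hout⟩

theorem left_mem_of_isCut (h : IsSkewDiagram C r c) (hm : MultFree C) (hcut : IsCut C a b)
    (hb : 0 < b) : (a + 1, b - 1) ∈ C := by
  obtain ⟨p, q, h⟩ := h.exists_colRep
  obtain ⟨hbc, hp, -⟩ := h.innerNotch_iff.1 hcut.1
  obtain ⟨-, hq, -⟩ := h.outerNotch_iff.1 hcut.2
  by_contra hmem
  have hpb : p b ≤ p (b - 1) := h.p_anti (by omega) (by omega)
  have hqb : q b ≤ q (b - 1) := h.q_anti (by omega) (by omega)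
  have hlt := h.lt b (by omega)
  obtain ⟨j, rfl⟩ : ∃ j, b = j + 1 := ⟨b - 1, by omega⟩
  rw [h.mem] at hmem
  refine h.not_multFree_of_far (j := j) hbc ?_ hm
  simp only [Nat.add_sub_cancel] at *
  change q (j + 2) = a + 1 at hq
  omega

theorem below_mem_of_isCut (h : IsSkewDiagram C r c) (hm : MultFree C) (hcut : IsCut C a b)
    (ha : a + 2 < r) : (a + 2, b) ∈ C := by
  have hbox := h.inBox.innerNotch_bound hcut.1
  have hleft := h.rot.swap.left_mem_of_isCut ((hm.rot h.inBox).swap h.rot.convex)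
    (isCut_swap.2 ((h.inBox.isCut_rot hbox.1 hbox.2).2 hcut)) (by omega)
  rw [mem_image_swap, h.inBox.mem_rotCells] at hleft
  convert hleft.2.2 using 2 <;> dsimp <;> omega

theorem col_eq_zero_or_row_eq_of_isCut (h : IsSkewDiagram C r c) (hm : MultFree C)
    (hcut : IsCut C a b) : b = 0 ∨ a + 2 = r := by
  by_contra! hne
  have hbox := h.inBox.innerNotch_bound hcut.1
  have hleft := h.left_mem_of_isCut hm hcut (by omega)
  have hbelow := h.below_mem_of_isCut hm hcut (by omega)
  obtain ⟨p, q, h⟩ := h.exists_colRep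
  obtain ⟨j, rfl⟩ : ∃ j, b = j + 1 := ⟨b - 1, by omega⟩
  obtain ⟨hbc, hp, -⟩ := h.innerNotch_iff.1 hcut.1
  obtain ⟨-, hq, -⟩ := h.outerNotch_iff.1 hcut.2
  have hp₁ : p (j + 1) ≤ p j := h.p_anti (by omega) (by omega)
  have hp₂ : p (j + 2) < q (j + 2) := h.lt _ hbc
  have hq₁ : q (j + 1) ≤ q j := h.q_anti (by omega) (by omega)
  rw [h.mem] at hleft hbelow
  refine BadPair.not_multFree_of_window (H := 3) (W := 3)
    (l := [(1, 0), (0, 2), (2, 0), (1, 1), (2, 1)])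
    (l' := [(1, 0), (1, 1), (2, 0), (0, 2), (2, 1)]) (by decide) h.convex a j ?_ hm
  intro i hi k hk
  rw [h.mem]
  simp only [Nat.add_sub_cancel] at hleft
  change q (j + 2) = a + 1 at hq
  interval_cases k <;> interval_cases i <;> simp <;> omega

theorem row_eq_zero_or_col_eq_of_isCut (h : IsSkewDiagram C r c) (hm : MultFree C)
    (hcut : IsCut C a b) : a = 0 ∨ b + 2 = c :=
  h.swap.col_eq_zero_or_row_eq_of_isCut (hm.swap h.convex) (isCut_swap.2 hcut)

theorem row_eq_of_isCut_of_two_cols (h : IsSkewDiagram C r 2) (hm : MultFree C)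
    (hcut : IsCut C a 0) : a = 0 ∨ a + 2 = r := by
  by_contra! hne
  have hbox := h.inBox.innerNotch_bound hcut.1
  have hbelow := h.below_mem_of_isCut hm hcut (by omega)
  have habove := h.rot.below_mem_of_isCut (hm.rot h.inBox)
    ((h.inBox.isCut_rot hbox.1 hbox.2).2 hcut) (by omega)
  rw [h.inBox.mem_rotCells, show r - 1 - (r - 2 - a + 2) = a - 1 by omega] at habove
  obtain ⟨a, rfl⟩ : ∃ x, a = x + 1 := ⟨a - 1, by omega⟩
  obtain ⟨⟨hleft, hin₁, hin₂⟩, ⟨hright, -, -⟩⟩ := hcut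
  have hleft' : (a, 0) ∉ C := fun hmem => hleft <|
    h.convex _ _ _ _ hmem hin₁ _ _ (by omega) (by omega) le_rfl le_rfl
  have hright' : (a + 3, 1) ∉ C := fun hmem => hright <|
    h.convex _ _ _ _ hin₂ hmem _ _ (by omega) (by omega) le_rfl le_rfl
  refine BadPair.not_multFree_of_window (H := 4) (W := 2) (l := [(0, 1), (2, 0), (1, 1), (3, 0)])
    (l' := [(2, 0), (3, 0), (0, 1), (1, 1)]) (by decide) h.convex a 0 ?_ hm
  intro i hi j hj
  interval_cases j <;> interval_cases i <;> simp_all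

theorem cut_at_corner (h : IsSkewDiagram C r c) (hm : MultFree C) (hcut : IsCut C a b) :
    a = 0 ∧ b = 0 ∨ a + 2 = r ∧ b + 2 = c := by
  have hcol {D : Finset (ℕ × ℕ)} {r c a b : ℕ} (h : IsSkewDiagram D r c) (hm : MultFree D)
      (hcut : IsCut D a b) (hb : b = 0) (hc : b + 2 = c) : a = 0 ∨ a + 2 = r := by
    subst hb hc
    exact h.row_eq_of_isCut_of_two_cols hm hcut
  have h₁ := h.col_eq_zero_or_row_eq_of_isCut hm hcut
  have h₂ := h.row_eq_zero_or_col_eq_of_isCut hm hcut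
  have h₃ := hcol h hm hcut
  have h₄ := hcol h.swap (hm.swap h.convex) (isCut_swap.2 hcut)
  omega

end IsSkewDiagram

end Classification

/-- The multiplicity-free connected diagrams are, up to rotation by 180 degrees, hooks, the straight
shapes `(c, 2)` and their transposes, and small rectangles with two rows and their transposes; the
disconnected ones are sums of a column and a row. -/
inductive Kind
  | hook (r c : ℕ)
  | disc (r c : ℕ)
  | two (c : ℕ)
  | twoT (r : ℕ)
  | rect (c : ℕ)
  | rectT (r : ℕ)

namespace Kind

/-- The number of rows. -/
def rows : Kind → ℕ
  | hook r _ => r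
  | disc r _ => r
  | two _ => 2
  | twoT r => r
  | rect _ => 2
  | rectT r => r

/-- The number of columns. -/
def cols : Kind → ℕ
  | hook _ c => c
  | disc _ c => c
  | two c => c
  | twoT _ => 2
  | rect c => c
  | rectT _ => 2

/-- The parameters are those of a multiplicity-free diagram. -/
def Valid : Kind → Prop
  | hook r c => 1 ≤ r ∧ 1 ≤ c
  | disc r c => 2 ≤ r ∧ 2 ≤ c
  | two c => 2 ≤ c
  | twoT r => 2 ≤ r
  | rect c => c = 3 ∨ c = 4
  | rectT r => r = 3 ∨ r = 4

/-- The cells of the diagram, as a predicate on its bounding box. -/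
def Mem : Kind → ℕ → ℕ → Prop
  | hook _ _, i, j => i = 0 ∨ j = 0
  | disc _ _, i, j => (i = 0 ∧ j ≠ 0) ∨ (i ≠ 0 ∧ j = 0)
  | two _, i, j => i = 0 ∨ j < 2
  | twoT _, i, j => j = 0 ∨ i < 2
  | rect _, _, _ => True
  | rectT _, _, _ => True

open Classical in
/-- The cells of the diagram. -/
noncomputable def cells (k : Kind) : Finset (ℕ × ℕ) :=
  (Finset.range k.rows ×ˢ Finset.range k.cols).filter fun x => k.Mem x.1 x.2

theorem mem_cells {k : Kind} {i j : ℕ} :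
    (i, j) ∈ k.cells ↔ i < k.rows ∧ j < k.cols ∧ k.Mem i j := by
  simp [cells, and_assoc]

theorem inBox (k : Kind) : InBox k.rows k.cols k.cells := by
  rintro ⟨i, j⟩ h
  rw [mem_cells] at h
  exact ⟨h.1, h.2.1⟩

/-- The transposed kind. -/
def tr : Kind → Kind
  | hook r c => hook c r
  | disc r c => disc c r
  | two c => twoT c
  | twoT r => two r
  | rect c => rectT c
  | rectT r => rect r

theorem Valid.tr {k : Kind} (h : k.Valid) : k.tr.Valid := by
  cases k <;> simp only [Valid, Kind.tr] at h ⊢ <;> omega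

theorem rows_tr (k : Kind) : k.tr.rows = k.cols := by cases k <;> rfl

theorem cols_tr (k : Kind) : k.tr.cols = k.rows := by cases k <;> rfl

theorem cells_tr (k : Kind) : k.tr.cells = k.cells.image Prod.swap := by
  ext ⟨i, j⟩
  rw [mem_image_swap, Prod.swap_prod_mk, mem_cells, mem_cells]
  cases k <;> simp only [tr, rows, cols, Mem, and_true] <;> omega

/-- `C`, with bounding box `r` by `c`, is the diagram of the valid kind `k`. -/
structure IsDiagram (k : Kind) (C : Finset (ℕ × ℕ)) (r c : ℕ) : Prop where
  valid : k.Valid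
  rows_eq : k.rows = r
  cols_eq : k.cols = c
  eq_cells : C = k.cells

theorem IsDiagram.of_swap {k : Kind} {C : Finset (ℕ × ℕ)} {r c : ℕ}
    (h : k.IsDiagram (C.image Prod.swap) c r) : k.tr.IsDiagram C r c :=
  ⟨h.valid.tr, k.rows_tr.trans h.cols_eq, k.cols_tr.trans h.rows_eq, by
    rw [cells_tr, ← h.eq_cells, image_swap_swap]⟩

end Kind

namespace ColRep

variable {C : Finset (ℕ × ℕ)} {r c : ℕ} {p q : ℕ → ℕ} (h : ColRep C r c p q)
include h

theorem isDiagram {k : Kind} (hk : k.Valid) (hr : k.rows = r) (hc : k.cols = c)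
    (hmem : ∀ i < r, ∀ j < c, k.Mem i j ↔ p j ≤ i ∧ i < q j) : k.IsDiagram C r c := by
  refine ⟨hk, hr, hc, ?_⟩
  ext ⟨i, j⟩
  rw [Kind.mem_cells, hr, hc]
  refine ⟨fun hij => ?_, fun ⟨hi, hj, hij⟩ => (h.mem _ _).2 ⟨hj, (hmem i hi j hj).1 hij⟩⟩
  obtain ⟨hi, hj⟩ := h.inBox _ hij
  exact ⟨hi, hj, (hmem i hi j hj).2 ((h.mem _ _).1 hij).2⟩

theorem isDiagram_disc (hcut : IsCut C 0 0) : (Kind.disc r c).IsDiagram C r c := by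
  obtain ⟨hc, hp₀, hp₁ : p 1 < p 0⟩ := h.innerNotch_iff.1 hcut.1
  obtain ⟨-, hq₁ : q 1 = 1, hq₁₀ : q 1 < q 0⟩ := h.outerNotch_iff.1 hcut.2
  have hq₀ := h.q_zero (by omega)
  refine h.isDiagram ⟨by omega, by omega⟩ rfl rfl fun i hi j hj => ?_
  obtain rfl | hj₀ := Nat.eq_zero_or_pos j
  · change (i = 0 ∧ 0 ≠ 0) ∨ (i ≠ 0 ∧ 0 = 0) ↔ _
    omega
  · have hpj : p j ≤ p 1 := h.p_anti hj₀ hj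
    have hqj : q j ≤ q 1 := h.q_anti hj₀ hj
    have hlt := h.lt j hj
    simp only [Kind.Mem]
    omega

variable (h₀ : (0, 0) ∈ C)
include h₀

theorem p_eq_zero {j : ℕ} (hj : j < c) : p j = 0 := by
  have hp₀ := ((h.mem _ _).1 h₀).2.1
  have := h.p_anti (Nat.zero_le j) hj
  omega

theorem isDiagram_hook (h₁ : (1, 1) ∉ C) : (Kind.hook r c).IsDiagram C r c := by
  have hc : 0 < c := (h.inBox _ h₀).2
  have hr : 0 < r := (h.inBox _ h₀).1
  have hq₀ := h.q_zero hc
  refine h.isDiagram ⟨hr, hc⟩ rfl rfl fun i hi j hj => ?_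
  have hpj := h.p_eq_zero h₀ hj
  have hlt := h.lt j hj
  obtain rfl | hj₀ := Nat.eq_zero_or_pos j
  · change i = 0 ∨ 0 = 0 ↔ _
    omega
  · have hp₁ := h.p_eq_zero h₀ (j := 1) (by omega)
    have hqj : q j ≤ q 1 := h.q_anti hj₀ hj
    rw [h.mem] at h₁
    simp only [Kind.Mem]
    omega

theorem not_multFree_of_three_rows_cols (h₁ : (1, 1) ∈ C) (hr : 3 ≤ r) (hc : 3 ≤ c) :
    ¬ MultFree C := by
  have hp₂ := h.p_eq_zero h₀ (j := 2) (by omega)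
  have hq₀ := h.q_zero (by omega)
  have hq₁ := ((h.mem _ _).1 h₁).2.2
  have hq₂ := h.lt 2 (by omega)
  have hqq : q 2 ≤ q 1 := h.q_anti (by omega) (by omega)
  have hwindow {l l' : List (ℕ × ℕ)} (hbad : BadPair 3 3 l l')
      (hl : ∀ i < 3, ∀ j < 3, i < q j ↔ (i, j) ∈ l) : ¬ MultFree C := by
    refine hbad.not_multFree_of_window h.convex 0 0 fun i hi j hj => ?_
    rw [Nat.zero_add, Nat.zero_add, ← hl i hi j hj, h.mem, h.p_eq_zero h₀ (hj.trans_le hc)]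
    omega
  rcases (by omega : q 1 = 2 ∧ q 2 = 1 ∨ q 1 = 2 ∧ q 2 = 2 ∨ 3 ≤ q 1 ∧ q 2 = 1 ∨
      3 ≤ q 1 ∧ q 2 = 2 ∨ 3 ≤ q 1 ∧ 3 ≤ q 2) with hq | hq | hq | hq | hq
  · refine hwindow (l := [(0, 0), (0, 1), (1, 0), (0, 2), (2, 0), (1, 1)])
      (l' := [(0, 0), (0, 1), (1, 0), (1, 1), (2, 0), (0, 2)]) (by decide) fun i hi j hj => ?_
    interval_cases j <;> interval_cases i <;> simp <;> omega
  · refine hwindow (l := [(0, 0), (0, 1), (1, 0), (0, 2), (1, 1), (1, 2), (2, 0)])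
      (l' := [(0, 0), (0, 1), (1, 0), (1, 1), (2, 0), (0, 2), (1, 2)]) (by decide)
      fun i hi j hj => ?_
    interval_cases j <;> interval_cases i <;> simp <;> omega
  · refine hwindow (l := [(0, 0), (0, 1), (1, 0), (0, 2), (2, 0), (1, 1), (2, 1)])
      (l' := [(0, 0), (0, 1), (1, 0), (1, 1), (2, 0), (0, 2), (2, 1)]) (by decide)
      fun i hi j hj => ?_
    interval_cases j <;> interval_cases i <;> simp <;> omega
  · refine hwindow (l := [(0, 0), (0, 1), (1, 0), (0, 2), (1, 1), (1, 2), (2, 0), (2, 1)])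
      (l' := [(0, 0), (0, 1), (1, 0), (0, 2), (2, 0), (1, 1), (2, 1), (1, 2)]) (by decide)
      fun i hi j hj => ?_
    interval_cases j <;> interval_cases i <;> simp <;> omega
  · refine hwindow (l := [(0, 0), (0, 1), (1, 0), (0, 2), (2, 0), (1, 1), (2, 1), (1, 2), (2, 2)])
      (l' := [(0, 0), (0, 1), (1, 0), (1, 1), (2, 0), (0, 2), (2, 1), (1, 2), (2, 2)])
      (by decide) fun i hi j hj => ?_
    interval_cases j <;> interval_cases i <;> simp <;> omega

end ColRep

namespace ColRep

variable {C : Finset (ℕ × ℕ)} {c : ℕ} {p q : ℕ → ℕ} (h : ColRep C 2 c p q) (h₀ : (0, 0) ∈ C)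
include h h₀

theorem q_eq_two_of_two_rows (hm : MultFree C) (hq₂ : q 2 = 2) {j : ℕ} (hj₂ : 2 ≤ j)
    (hj : j < c) : q j = 2 := by
  have hq₀ : q 0 = 2 := h.q_zero (by omega)
  have hq {j : ℕ} (hj : j < c) : p j = 0 ∧ 0 < q j ∧ q j ≤ 2 :=
    ⟨h.p_eq_zero h₀ hj, Nat.zero_lt_of_lt (h.lt j hj), hq₀ ▸ h.q_anti (Nat.zero_le j) hj⟩
  induction j, hj₂ using Nat.le_induction with
  | base => exact hq₂
  | succ j hj₂ ih =>
    by_contra hne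
    obtain ⟨k, rfl⟩ : ∃ k, j = k + 2 := ⟨j - 2, by omega⟩
    have hk {x : ℕ} (hx : x ≤ k + 2) : p x = 0 ∧ q x = 2 := by
      have hle : q (k + 2) ≤ q x := h.q_anti hx (by omega)
      have := hq (j := x) (by omega)
      have := ih (by omega)
      omega
    have hlast : p (k + 3) = 0 ∧ 0 < q (k + 3) ∧ q (k + 3) ≤ 2 := hq hj
    have hk₀ := hk (x := k) (by omega)
    have hk₁ := hk (x := k + 1) (by omega)
    have hk₂ := hk (x := k + 2) le_rfl
    change q (k + 3) ≠ 2 at hne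
    refine BadPair.not_multFree_of_window (H := 2) (W := 4)
      (l := [(0, 0), (0, 1), (1, 0), (0, 2), (0, 3), (1, 1), (1, 2)])
      (l' := [(0, 0), (0, 1), (1, 0), (1, 1), (0, 2), (1, 2), (0, 3)])
      (by decide) h.convex 0 k (fun i hi x hx => ?_) hm
    rw [h.mem]
    interval_cases x <;> interval_cases i <;> simp <;> omega

theorem exists_isDiagram_of_two_rows (h₁ : (1, 1) ∈ C) (hm : MultFree C) :
    ∃ k : Kind, k.IsDiagram C 2 c := by
  have hc : 1 < c := (h.inBox _ h₁).2
  have hq₀ : q 0 = 2 := h.q_zero (by omega)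
  have hq {j : ℕ} (hj : j < c) : p j = 0 ∧ 0 < q j ∧ q j ≤ 2 :=
    ⟨h.p_eq_zero h₀ hj, Nat.zero_lt_of_lt (h.lt j hj), hq₀ ▸ h.q_anti (Nat.zero_le j) hj⟩
  have hq₁ : q 1 = 2 := le_antisymm (hq hc).2.2 ((h.mem _ _).1 h₁).2.2
  by_cases hshort : c = 2 ∨ q 2 = 1
  · refine ⟨Kind.two c, h.isDiagram hc rfl rfl fun i hi j hj => ?_⟩
    obtain ⟨hp, hpos, hle⟩ := hq hj
    have hq₂ : 2 ≤ j → q j ≤ q 2 := fun hj₂ => h.q_anti hj₂ hj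
    rcases (by omega : j = 0 ∨ j = 1 ∨ 2 ≤ j) with rfl | rfl | hj₂ <;>
      simp only [Kind.Mem] <;> omega
  obtain ⟨hc₂, hq₂⟩ : 2 < c ∧ q 2 = 2 := by
    have := hq (j := 2)
    omega
  have hfull {j : ℕ} (hj : j < c) : p j = 0 ∧ q j = 2 := by
    refine ⟨(hq hj).1, ?_⟩
    rcases (by omega : j = 0 ∨ j = 1 ∨ 2 ≤ j) with rfl | rfl | hj₂
    exacts [hq₀, hq₁, h.q_eq_two_of_two_rows h₀ hm hq₂ hj₂ hj]
  have hc₄ : c ≤ 4 := by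
    by_contra! hc₄
    refine BadPair.not_multFree_of_window (H := 2) (W := 5)
      (l := [(0, 0), (0, 1), (1, 0), (0, 2), (0, 3), (1, 1), (1, 2), (0, 4), (1, 3), (1, 4)])
      (l' := [(0, 0), (0, 1), (1, 0), (1, 1), (0, 2), (1, 2), (0, 3), (0, 4), (1, 3), (1, 4)])
      (by decide) h.convex 0 0 (fun i hi j hj => ?_) hm
    rw [Nat.zero_add, Nat.zero_add, h.mem, (hfull (hj.trans_le hc₄)).1,
      (hfull (hj.trans_le hc₄)).2]
    interval_cases j <;> interval_cases i <;> simp <;> omega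
  refine ⟨Kind.rect c, h.isDiagram (show c = 3 ∨ c = 4 by omega) rfl rfl fun i hi j hj => ?_⟩
  have := hfull hj
  simp only [Kind.Mem, true_iff]
  omega

end ColRep

namespace IsSkewDiagram

variable {C : Finset (ℕ × ℕ)} {r c : ℕ}

theorem exists_isDiagram_of_straight (h : IsSkewDiagram C r c) (h₀ : (0, 0) ∈ C)
    (hm : MultFree C) : ∃ k : Kind, k.IsDiagram C r c := by
  obtain ⟨p, q, hpq⟩ := h.exists_colRep
  by_cases h₁ : (1, 1) ∈ C
  swap
  · exact ⟨_, hpq.isDiagram_hook h₀ h₁⟩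
  obtain ⟨hr, hc⟩ : 1 < r ∧ 1 < c := h.inBox _ h₁
  rcases (by omega : r = 2 ∨ c = 2 ∨ 3 ≤ r ∧ 3 ≤ c) with rfl | rfl | ⟨hr, hc⟩
  · exact hpq.exists_isDiagram_of_two_rows h₀ h₁ hm
  · obtain ⟨p', q', hpq'⟩ := h.swap.exists_colRep
    obtain ⟨k, hk⟩ := hpq'.exists_isDiagram_of_two_rows (mem_image_swap.2 h₀) (mem_image_swap.2 h₁)
      (hm.swap h.convex)
    exact ⟨_, hk.of_swap⟩
  · exact absurd hm (hpq.not_multFree_of_three_rows_cols h₀ h₁ hr hc)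

theorem zero_mem_of_forall_not_innerNotch (h : IsSkewDiagram C r c) (hc : 0 < c)
    (hin : ∀ i j, ¬ InnerNotch C i j) : (0, 0) ∈ C := by
  obtain ⟨p, q, h⟩ := h.exists_colRep
  have hconst : ∀ j < c, p j = p 0 := by
    intro j
    induction j with
    | zero => exact fun _ => rfl
    | succ j ih =>
      intro hj
      have hle : p (j + 1) ≤ p j := h.p_anti (by omega) hj
      have hnot : ¬ p (j + 1) < p j := fun hlt =>
        hin (p j - 1) j (h.innerNotch_iff.2 ⟨hj, by omega, hlt⟩)
      have := ih (by omega)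
      omega
  have hp : p 0 = 0 := (hconst _ (Nat.sub_lt hc one_pos)).symm.trans (h.p_last hc)
  simpa only [hp] using h.top_mem hc

theorem exists_isDiagram (h : IsSkewDiagram C r c) (hc : 0 < c) (hm : MultFree C) :
    ∃ k : Kind, k.IsDiagram C r c ∨ k.IsDiagram (rotCells r c C) r c := by
  by_cases hin : ∀ i j, ¬ InnerNotch C i j
  · exact (h.exists_isDiagram_of_straight (h.zero_mem_of_forall_not_innerNotch hc hin) hm).imp
      fun _ => Or.inl
  by_cases hout : ∀ i j, ¬ OuterNotch C i j
  · refine (h.rot.exists_isDiagram_of_straight (h.rot.zero_mem_of_forall_not_innerNotch hc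
      fun i j hij => ?_) (hm.rot h.inBox)).imp fun _ => Or.inr
    obtain ⟨hi, hj⟩ := h.inBox.rot.innerNotch_bound hij
    refine hout _ _ ((h.inBox.innerNotch_rot (i := r - 2 - i) (j := c - 2 - j) (by omega)
      (by omega)).1 ?_)
    rwa [show r - 2 - (r - 2 - i) = i by omega, show c - 2 - (c - 2 - j) = j by omega]
  push Not at hin hout
  obtain ⟨⟨a, b, hin⟩, ⟨a', b', hout⟩⟩ := hin, hout
  obtain ⟨i, j, hcut⟩ := h.exists_isCut hm hin hout
  obtain ⟨hi, hj⟩ := h.inBox.innerNotch_bound hcut.1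
  rcases h.cut_at_corner hm hcut with ⟨rfl, rfl⟩ | ⟨rfl, rfl⟩
  · obtain ⟨p, q, hpq⟩ := h.exists_colRep
    exact ⟨_, Or.inl (hpq.isDiagram_disc hcut)⟩
  · obtain ⟨p, q, hpq⟩ := h.rot.exists_colRep
    refine ⟨_, Or.inr (hpq.isDiagram_disc ?_)⟩
    simpa using (h.inBox.isCut_rot hi hj).2 hcut

end IsSkewDiagram

namespace IsLinExt

variable {α : Type*} [PartialOrder α] {C : Finset α} {l m : List α} {x y : α}

theorem eq_head_of_le (h : IsLinExt C (x :: l)) (hy : y ∈ C) (hyx : y ≤ x) : y = x :=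
  (List.mem_cons.1 ((h.mem_iff y).2 hy)).resolve_right fun hyl =>
    (List.pairwise_cons.1 h.pairwise).1 y hyl hyx

theorem tail [DecidableEq α] (h : IsLinExt C (x :: l)) : IsLinExt (C.erase x) l where
  mem_iff y := by
    have hx : x ∉ l := (List.nodup_cons.1 h.nodup).1
    rw [Finset.mem_erase, ← h.mem_iff, List.mem_cons]
    constructor
    · exact fun hy => ⟨fun hyx => hx (hyx ▸ hy), Or.inr hy⟩
    · exact fun hy => hy.2.resolve_left hy.1
  pairwise := (List.pairwise_cons.1 h.pairwise).2

theorem mem_left_of_lt (h : IsLinExt C (l ++ y :: m)) (hx : x ∈ C) (hxy : x < y) : x ∈ l :=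
  (List.mem_append.1 ((h.mem_iff x).2 hx)).resolve_right fun hxm =>
    (List.mem_cons.1 hxm).elim hxy.ne fun hxm =>
      (List.pairwise_cons.1 (List.pairwise_append.1 h.pairwise).2.1).1 x hxm hxy.le

theorem mem_right_of_lt (h : IsLinExt C (l ++ x :: m)) (hy : y ∈ C) (hxy : x < y) : y ∈ m :=
  (List.mem_append.1 ((h.mem_iff y).2 hy)).elim
    (fun hyl => (h.not_le hyl List.mem_cons_self hxy.le).elim)
    fun hym => (List.mem_cons.1 hym).resolve_left hxy.ne'

theorem mem_left (h : IsLinExt C (l ++ m)) (hx : x ∈ C) (hy : y ∈ l) (hxy : x ≤ y) : x ∈ l :=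
  (List.mem_append.1 ((h.mem_iff x).2 hx)).resolve_right fun hxm => h.not_le hy hxm hxy

end IsLinExt

/-! ### Descent words of the diagrams in the classification -/

section Hook

variable {i j r c : ℕ} {w : List Bool} {l : List (ℕ × ℕ)}

/-- The cells of column `0` in rows `i, …, r - 1` and those of row `0` in columns `j, …, c - 1`. -/
def arms (i r j c : ℕ) : Finset (ℕ × ℕ) :=
  Finset.Ico i r ×ˢ {0} ∪ {0} ×ˢ Finset.Ico j c

theorem mem_arms {a b : ℕ} :
    (a, b) ∈ arms i r j c ↔ i ≤ a ∧ a < r ∧ b = 0 ∨ a = 0 ∧ j ≤ b ∧ b < c := by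
  simp only [arms, Finset.mem_union, Finset.mem_product, Finset.mem_Ico, Finset.mem_singleton,
    and_assoc]

theorem card_arms (hi : 1 ≤ i) : (arms i r j c).card = (r - i) + (c - j) := by
  rw [arms, Finset.card_union_of_disjoint]
  · simp only [Finset.card_product, Nat.card_Ico, Finset.card_singleton, mul_one, one_mul]
  · rw [Finset.disjoint_left]
    rintro ⟨a, b⟩
    simp only [Finset.mem_product, Finset.mem_Ico, Finset.mem_singleton]
    omega

theorem arms_erase_column (hi : 1 ≤ i) :
    (arms i r j c).erase (i, 0) = arms (i + 1) r j c := by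
  ext ⟨a, b⟩
  simp only [Finset.mem_erase, mem_arms, ne_eq, Prod.mk.injEq]
  omega

theorem arms_erase_row (hj : 1 ≤ j) :
    (arms i r j c).erase (0, j) = arms i r (j + 1) c := by
  ext ⟨a, b⟩
  simp only [Finset.mem_erase, mem_arms, ne_eq, Prod.mk.injEq]
  omega

/-- The list which goes down column `0` from row `i` at each letter `true` and to the right in row
`0` from column `j` at each letter `false`. -/
def hookList : ℕ → ℕ → List Bool → List (ℕ × ℕ)
  | _, _, [] => []
  | i, j, true :: w => (i, 0) :: hookList (i + 1) j w
  | i, j, false :: w => (0, j) :: hookList i (j + 1) w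

theorem mem_hookList {a b : ℕ} : ∀ {i j : ℕ} {w : List Bool}, (a, b) ∈ hookList i j w ↔
    i ≤ a ∧ a < i + w.count true ∧ b = 0 ∨ a = 0 ∧ j ≤ b ∧ b < j + w.count false
  | i, j, [] => by
    simp only [hookList, List.not_mem_nil, List.count_nil, false_iff]
    omega
  | i, j, true :: w => by
    simp only [hookList, List.mem_cons, Prod.mk.injEq, mem_hookList, List.count_cons_self, ne_eq,
      reduceCtorEq, not_false_eq_true, List.count_cons_of_ne]
    omega
  | i, j, false :: w => by
    simp only [hookList, List.mem_cons, Prod.mk.injEq, mem_hookList, List.count_cons_self, ne_eq,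
      reduceCtorEq, not_false_eq_true, List.count_cons_of_ne]
    omega

theorem pairwise_hookList : ∀ {i j : ℕ} {w : List Bool}, 1 ≤ i → 1 ≤ j →
    (hookList i j w).Pairwise fun a b => ¬ b ≤ a
  | _, _, [], _, _ => List.Pairwise.nil
  | i, j, true :: w, hi, hj => by
    refine List.Pairwise.cons ?_ (pairwise_hookList (by omega) hj)
    rintro ⟨a, b⟩ hab
    rw [mem_hookList] at hab
    rw [Prod.mk_le_mk]
    omega
  | i, j, false :: w, hi, hj => by
    refine List.Pairwise.cons ?_ (pairwise_hookList hi (by omega))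
    rintro ⟨a, b⟩ hab
    rw [mem_hookList] at hab
    rw [Prod.mk_le_mk]
    omega

theorem isLinExt_hookList (hi : 1 ≤ i) (hj : 1 ≤ j) (w : List Bool) :
    IsLinExt (arms i (i + w.count true) j (j + w.count false)) (hookList i j w) where
  mem_iff := fun ⟨a, b⟩ => by rw [mem_hookList, mem_arms]
  pairwise := pairwise_hookList hi hj

theorem exists_eq_hookList : ∀ {l : List (ℕ × ℕ)} {i j : ℕ}, 1 ≤ i → 1 ≤ j → i ≤ r → j ≤ c →
    IsLinExt (arms i r j c) l → ∃ w, l = hookList i j w ∧ i + w.count true = r ∧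
      j + w.count false = c
  | [], i, j, _, _, hir, hjc, hl => by
    have hnot_mem (x : ℕ × ℕ) : x ∉ arms i r j c := fun hx => by simpa using (hl.mem_iff x).2 hx
    have hi := hnot_mem (i, 0)
    have hj := hnot_mem (0, j)
    rw [mem_arms] at hi hj
    exact ⟨[], rfl, by rw [List.count_nil]; omega, by rw [List.count_nil]; omega⟩
  | (a, b) :: l, i, j, hi, hj, hir, hjc, hl => by
    have hhead := mem_arms.1 ((hl.mem_iff (a, b)).1 List.mem_cons_self)
    rcases hhead with ⟨hia, har, rfl⟩ | ⟨rfl, hjb, hbc⟩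
    · obtain ⟨rfl, -⟩ := Prod.mk.inj <| hl.eq_head_of_le (y := (i, 0))
        (mem_arms.2 (by omega)) (Prod.mk_le_mk.2 ⟨hia, le_rfl⟩)
      obtain ⟨w, rfl, hr, hc⟩ := exists_eq_hookList (by omega) hj (by omega) hjc
        (arms_erase_column hi ▸ hl.tail)
      refine ⟨true :: w, rfl, ?_, ?_⟩ <;> simp <;> omega
    · obtain ⟨-, rfl⟩ := Prod.mk.inj <| hl.eq_head_of_le (y := (0, j))
        (mem_arms.2 (by omega)) (Prod.mk_le_mk.2 ⟨le_rfl, hjb⟩)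
      obtain ⟨w, rfl, hr, hc⟩ := exists_eq_hookList hi (by omega) hir (by omega)
        (arms_erase_row hj ▸ hl.tail)
      refine ⟨false :: w, rfl, ?_, ?_⟩ <;> simp <;> omega

theorem desWord_cons_hookList : ∀ {x : ℕ × ℕ} {i j : ℕ} {w : List Bool}, x.1 < i →
    desWord (x :: hookList i j w) = w
  | x, i, j, [], _ => rfl
  | x, i, j, true :: w, h => by
    rw [hookList, desWord_cons_cons, desWord_cons_hookList (Nat.lt_succ_self i),
      decide_eq_true h]
  | x, i, j, false :: w, h => by
    rw [hookList, desWord_cons_cons, desWord_cons_hookList (Nat.zero_lt_of_lt h),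
      decide_eq_false (Nat.not_lt_zero _)]

theorem desWord_hookList (hi : 1 ≤ i) : ∀ w, desWord (hookList i j w) = w.tail
  | [] => rfl
  | true :: _ => desWord_cons_hookList (Nat.lt_succ_self i)
  | false :: _ => desWord_cons_hookList hi

namespace Kind

theorem cells_disc (h : (disc r c).Valid) : (disc r c).cells = arms 1 r 1 c := by
  obtain ⟨hr, hc⟩ : 2 ≤ r ∧ 2 ≤ c := h
  ext ⟨a, b⟩
  simp only [mem_cells, rows, cols, Mem, mem_arms]
  omega

theorem erase_cells_hook (h : (hook r c).Valid) : (hook r c).cells.erase (0, 0) = arms 1 r 1 c := by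
  obtain ⟨hr, hc⟩ : 1 ≤ r ∧ 1 ≤ c := h
  ext ⟨a, b⟩
  simp only [Finset.mem_erase, mem_cells, rows, cols, Mem, mem_arms, ne_eq, Prod.mk.injEq]
  omega

theorem zero_mem_cells_hook (h : (hook r c).Valid) : (0, 0) ∈ (hook r c).cells :=
  mem_cells.2 ⟨h.1, h.2, Or.inl rfl⟩

theorem card_hook (h : (hook r c).Valid) : (hook r c).cells.card + 1 = r + c := by
  rw [← Finset.card_erase_add_one (zero_mem_cells_hook h), erase_cells_hook h, card_arms le_rfl]
  obtain ⟨hr, hc⟩ : 1 ≤ r ∧ 1 ≤ c := h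
  omega

theorem card_disc (h : (disc r c).Valid) : (disc r c).cells.card + 2 = r + c := by
  rw [cells_disc h, card_arms le_rfl]
  obtain ⟨hr, hc⟩ : 2 ≤ r ∧ 2 ≤ c := h
  omega

theorem mem_words_hook (h : (hook r c).Valid) :
    w ∈ words (hook r c).cells ↔ w.length + 2 = r + c ∧ w.count true + 1 = r := by
  have ⟨(hr : 1 ≤ r), (hc : 1 ≤ c)⟩ := h
  rw [← List.count_true_add_count_false w]
  constructor
  · rintro ⟨_ | ⟨x, l⟩, hl, rfl⟩
    · simpa using (hl.mem_iff _).2 (zero_mem_cells_hook h)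
    obtain rfl := hl.eq_head_of_le (zero_mem_cells_hook h) ⟨Nat.zero_le _, Nat.zero_le _⟩
    obtain ⟨w, rfl, hrw, hcw⟩ :=
      exists_eq_hookList le_rfl le_rfl hr hc (erase_cells_hook h ▸ hl.tail)
    rw [desWord_cons_hookList Nat.zero_lt_one]
    omega
  · rintro ⟨hlen, htrue⟩
    refine ⟨(0, 0) :: hookList 1 1 w, ⟨?_, ?_⟩, desWord_cons_hookList Nat.zero_lt_one⟩
    · rintro ⟨a, b⟩
      simp only [List.mem_cons, Prod.mk.injEq, mem_hookList, mem_cells, rows, cols, Mem]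
      omega
    · refine List.Pairwise.cons ?_ (pairwise_hookList le_rfl le_rfl)
      rintro ⟨a, b⟩ hab
      rw [mem_hookList] at hab
      rw [Prod.mk_le_mk]
      omega

theorem mem_words_disc (h : (disc r c).Valid) : w ∈ words (disc r c).cells ↔
    w.length + 3 = r + c ∧ (w.count true + 1 = r ∨ w.count true + 2 = r) := by
  have ⟨(hr : 2 ≤ r), (hc : 2 ≤ c)⟩ := h
  rw [← List.count_true_add_count_false w]
  constructor
  · rintro ⟨l, hl, rfl⟩
    obtain ⟨w, rfl, hrw, hcw⟩ := exists_eq_hookList le_rfl le_rfl (by omega) (by omega)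
      (cells_disc h ▸ hl)
    rw [desWord_hookList le_rfl]
    rcases w with _ | ⟨_ | _, w⟩ <;> simp [-List.count_true_add_count_false] at hrw hcw ⊢ <;> omega
  · have hmem (b : Bool) (hr : 1 + (b :: w).count true = r) (hc : 1 + (b :: w).count false = c) :
        w ∈ words (disc r c).cells :=
      ⟨_, by rw [cells_disc h, ← hr, ← hc]; exact isLinExt_hookList le_rfl le_rfl _,
        desWord_hookList le_rfl _⟩
    rintro ⟨hlen, htrue | htrue⟩
    · exact hmem false (by simp; omega) (by simp; omega)
    · exact hmem true (by simp; omega) (by simp; omega)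

end Kind

end Hook

section TwoRows

variable {c : ℕ} {w : List Bool} {l l₁ l₂ l₃ : List (ℕ × ℕ)} {x y : ℕ × ℕ}

theorem desWord_cons_row_zero : ∀ {l : List (ℕ × ℕ)} {x : ℕ × ℕ}, (∀ z ∈ l, z.1 = 0) →
    desWord (x :: l) = List.replicate l.length false
  | [], _, _ => rfl
  | z :: l, x, hl => by
    rw [List.forall_mem_cons] at hl
    rw [desWord_cons_cons, desWord_cons_row_zero hl.2, hl.1, decide_eq_false (Nat.not_lt_zero _),
      List.length_cons, List.replicate_succ]

theorem desWord_cons_row_zero_concat (hl : ∀ z ∈ l, z.1 = 0) (hx : x.1 = 0 ∨ l ≠ [])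
    (hy : 0 < y.1) : desWord (x :: (l ++ [y])) = List.replicate l.length false ++ [true] := by
  rcases List.eq_nil_or_concat l with rfl | ⟨l, z, rfl⟩
  · rw [List.nil_append, desWord_cons_cons, hx.resolve_right (not_not_intro rfl), decide_eq_true hy]
    rfl
  · rw [List.concat_eq_append] at hl ⊢
    rw [List.append_assoc, List.singleton_append, ← List.cons_append, desWord_concat_concat,
      List.cons_append, desWord_cons_row_zero hl, hl z (by simp), decide_eq_true hy]

/-- The list of cells `l₁, (1, 0), l₂, (1, 1), l₃`. -/
abbrev twoList (l₁ l₂ l₃ : List (ℕ × ℕ)) : List (ℕ × ℕ) :=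
  l₁ ++ (1, 0) :: (l₂ ++ (1, 1) :: l₃)

theorem desWord_twoList (h₁ : ∀ z ∈ x :: l₁, z.1 = 0) (h₂ : ∀ z ∈ l₂, z.1 = 0) (hne : l₂ ≠ [])
    (h₃ : ∀ z ∈ l₃, z.1 = 0) : desWord (twoList (x :: l₁) l₂ l₃) =
      List.replicate l₁.length false ++ true ::
        (List.replicate l₂.length false ++ true :: List.replicate l₃.length false) := by
  rw [List.forall_mem_cons] at h₁
  rw [twoList, desWord_append_cons, List.cons_append,
    desWord_cons_row_zero_concat h₁.2 (Or.inl h₁.1) Nat.one_pos, ← List.cons_append,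
    desWord_append_cons, List.cons_append, desWord_cons_row_zero_concat h₂ (Or.inr hne) Nat.one_pos,
    desWord_cons_row_zero h₃]
  simp only [List.append_assoc, List.singleton_append]

theorem desWord_twoList_nil (h₁ : ∀ z ∈ x :: l₁, z.1 = 0) (h₃ : ∀ z ∈ l₃, z.1 = 0) :
    desWord (twoList (x :: l₁) [] l₃) =
      List.replicate l₁.length false ++ true :: List.replicate (l₃.length + 1) false := by
  rw [List.forall_mem_cons] at h₁
  rw [twoList, desWord_append_cons, List.cons_append,
    desWord_cons_row_zero_concat h₁.2 (Or.inl h₁.1) Nat.one_pos, List.nil_append,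
    desWord_cons_cons, desWord_cons_row_zero h₃, List.append_assoc]
  rfl

/-- Consecutive cells of row `0`. -/
def rowCells (s n : ℕ) : List (ℕ × ℕ) := (List.range' s n).map fun j => (0, j)

theorem mem_rowCells {s n a b : ℕ} : (a, b) ∈ rowCells s n ↔ a = 0 ∧ s ≤ b ∧ b < s + n := by
  simp only [rowCells, List.mem_map, List.mem_range'_1, Prod.mk.injEq]
  constructor
  · rintro ⟨_, h, rfl, rfl⟩; exact ⟨rfl, h⟩
  · rintro ⟨rfl, h⟩; exact ⟨b, h, rfl, rfl⟩

theorem pairwise_rowCells (s n : ℕ) : (rowCells s n).Pairwise fun a b => ¬ b ≤ a := by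
  rw [rowCells, List.pairwise_map]
  refine (List.pairwise_lt_range' (s := s) (n := n)).imp fun hab h => ?_
  exact hab.not_ge (Prod.mk_le_mk.1 h).2

@[simp] theorem length_rowCells (s n : ℕ) : (rowCells s n).length = n := by
  rw [rowCells, List.length_map, List.length_range']

theorem row_of_mem_rowCells {s n : ℕ} : ∀ z ∈ rowCells s n, z.1 = 0 :=
  fun ⟨_, _⟩ h => (mem_rowCells.1 h).1

theorem rowCells_succ (s n : ℕ) : rowCells s (n + 1) = (0, s) :: rowCells (s + 1) n := by
  rw [rowCells, List.range'_succ]; rfl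

namespace Kind

theorem mem_cells_two (hc : 2 ≤ c) {i j : ℕ} :
    (i, j) ∈ (two c).cells ↔ i = 0 ∧ j < c ∨ i = 1 ∧ j < 2 := by
  simp only [mem_cells, rows, cols, Mem]
  omega

theorem isLinExt_two {a b d : ℕ} (hab : 1 ≤ a + b) (hc : a + 1 + b + d = c) :
    IsLinExt (two c).cells
      (twoList (rowCells 0 (a + 1)) (rowCells (a + 1) b) (rowCells (a + 1 + b) d)) where
  mem_iff := fun ⟨i, j⟩ => by
    simp only [List.mem_append, List.mem_cons, mem_rowCells, Prod.mk.injEq,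
      mem_cells_two (c := c) (by omega)]
    omega
  pairwise := by
    simp only [List.pairwise_append, List.pairwise_cons, pairwise_rowCells, true_and, and_true,
      List.mem_append, List.mem_cons]
    refine ⟨⟨?_, ?_, ?_⟩, ?_⟩ <;>
    · simp only [Prod.forall, Prod.mk_le_mk, mem_rowCells, Prod.mk.injEq]
      intros
      omega

theorem card_two (hc : 2 ≤ c) : (two c).cells.card = c + 2 := by
  have h := (isLinExt_two (a := c - 1) (b := 0) (d := 0) (c := c) (by omega) (by omega)).length_eq
  simp only [List.length_append, length_rowCells, List.length_cons] at h
  omega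

theorem exists_eq_twoList (hc : 2 ≤ c) (hl : IsLinExt (two c).cells l) :
    ∃ x l₁ l₂ l₃, l = twoList (x :: l₁) l₂ l₃ ∧ (∀ z ∈ x :: l₁, z.1 = 0) ∧
      (∀ z ∈ l₂, z.1 = 0) ∧ (∀ z ∈ l₃, z.1 = 0) ∧ 1 ≤ l₁.length + l₂.length := by
  have hmem {i j : ℕ} (h : i = 0 ∧ j < c ∨ i = 1 ∧ j < 2) : (i, j) ∈ (two c).cells :=
    (mem_cells_two hc).2 h
  obtain ⟨l₀, m, rfl⟩ := List.append_of_mem ((hl.mem_iff (1, 0)).2 (hmem (by omega)))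
  have h₀₀ : (0, 0) ∈ l₀ := hl.mem_left_of_lt (hmem (by omega)) (by simp)
  have h₁₁ : (1, 1) ∈ m := hl.mem_right_of_lt (hmem (by omega)) (by simp)
  obtain ⟨l₂, l₃, rfl⟩ := List.append_of_mem h₁₁
  have hrow : ∀ z ∈ l₀ ++ (l₂ ++ l₃), z.1 = 0 := by
    rintro ⟨i, j⟩ hz
    have hnd := hl.nodup
    rw [List.nodup_middle, List.nodup_cons, ← List.append_assoc, List.nodup_middle,
      List.nodup_cons] at hnd
    have hz₁₀ : (i, j) ≠ (1, 0) := fun h => hnd.1 (h ▸ by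
      simp only [List.mem_append, List.mem_cons] at hz ⊢; tauto)
    have hz₁₁ : (i, j) ≠ (1, 1) := fun h => hnd.2.1 (h ▸ by simpa using hz)
    have hij := (mem_cells_two hc).1 ((hl.mem_iff (i, j)).1 (by
      simp only [List.mem_append, List.mem_cons] at hz ⊢; tauto))
    grind
  have h₀₁ : (0, 1) ∈ l₀ ∨ (0, 1) ∈ l₂ := by
    rw [← List.cons_append, ← List.append_assoc] at hl
    have h := hl.mem_left_of_lt (x := (0, 1)) (hmem (by omega)) (by simp)
    simpa using h
  obtain ⟨x, l₁, rfl⟩ := List.exists_cons_of_ne_nil (List.ne_nil_of_mem h₀₀)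
  refine ⟨x, l₁, l₂, l₃, rfl, fun z hz => hrow z (by
      simp only [List.mem_append, List.mem_cons] at hz ⊢; tauto),
    fun z hz => hrow z (by simp [hz]), fun z hz => hrow z (by simp [hz]), ?_⟩
  by_contra! hlen
  obtain ⟨rfl, rfl⟩ : l₁ = [] ∧ l₂ = [] := by
    simpa only [Nat.lt_one_iff, Nat.add_eq_zero_iff, List.length_eq_zero_iff] using hlen
  rw [List.mem_singleton] at h₀₀
  subst h₀₀
  simp at h₀₁

theorem mem_words_two (hc : 2 ≤ c) : w ∈ words (two c).cells ↔
    (∃ a b d, 1 ≤ b ∧ a + 1 + b + d = c ∧ w = List.replicate a false ++ true ::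
      (List.replicate b false ++ true :: List.replicate d false)) ∨
    (∃ a d, 1 ≤ a ∧ a + 1 + d = c ∧
      w = List.replicate a false ++ true :: List.replicate (d + 1) false) := by
  constructor
  · rintro ⟨l, hl, rfl⟩
    have hlen : l.length = c + 2 := hl.length_eq.trans (card_two hc)
    obtain ⟨x, l₁, l₂, l₃, rfl, h₁, h₂, h₃, hpos⟩ := exists_eq_twoList hc hl
    simp only [List.length_append, List.length_cons] at hlen
    rcases eq_or_ne l₂ [] with rfl | hne
    · rw [List.length_nil] at hlen hpos
      exact Or.inr ⟨l₁.length, l₃.length, by omega, by omega, desWord_twoList_nil h₁ h₃⟩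
    · have := List.length_pos_iff.2 hne
      exact Or.inl ⟨l₁.length, l₂.length, l₃.length, this, by omega,
        desWord_twoList h₁ h₂ hne h₃⟩
  · have hrow (a : ℕ) : ∀ z ∈ (0, 0) :: rowCells 1 a, z.1 = 0 := by
      rw [← rowCells_succ]
      exact row_of_mem_rowCells
    rintro (⟨a, b, d, hb, habd, rfl⟩ | ⟨a, d, ha, had, rfl⟩)
    · refine ⟨_, isLinExt_two (by omega) habd, ?_⟩
      rw [rowCells_succ, desWord_twoList (hrow a) row_of_mem_rowCells
        (List.ne_nil_of_length_pos (by rwa [length_rowCells])) row_of_mem_rowCells]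
      simp only [length_rowCells]
    · refine ⟨_, isLinExt_two (a := a) (b := 0) ha had, ?_⟩
      rw [rowCells_succ, show rowCells (a + 1) 0 = [] from rfl,
        desWord_twoList_nil (hrow a) row_of_mem_rowCells]
      simp only [length_rowCells]

theorem cells_rect (c : ℕ) : (rect c).cells = Finset.range 2 ×ˢ Finset.range c := by
  classical
  exact Finset.filter_true_of_mem fun _ _ => trivial

theorem card_rect (c : ℕ) : (rect c).cells.card = 2 * c := by
  rw [cells_rect, Finset.card_product, Finset.card_range, Finset.card_range]

theorem desWord_mem_words_rect (hl : l.toFinset = Finset.range 2 ×ˢ Finset.range c)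
    (hp : l.Pairwise fun a b => ¬ b ≤ a) : desWord l ∈ words (rect c).cells :=
  ⟨l, ⟨fun x => by rw [cells_rect, ← hl, List.mem_toFinset], hp⟩, rfl⟩

theorem exists_false_false_mem_words_rect (h : (rect c).Valid) :
    ∃ w, false :: false :: w ∈ words (rect c).cells ∧ w.count true = 1 := by
  rcases h with rfl | rfl
  · exact ⟨_, desWord_mem_words_rect (l := [(0, 0), (0, 1), (0, 2), (1, 0), (1, 1), (1, 2)])
      (by decide) (by decide), rfl⟩
  · exact ⟨_, desWord_mem_words_rect
      (l := [(0, 0), (0, 1), (0, 2), (0, 3), (1, 0), (1, 1), (1, 2), (1, 3)])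
      (by decide) (by decide), rfl⟩

theorem exists_three_le_count_rect (h : (rect c).Valid) :
    ∃ w ∈ words (rect c).cells, 3 ≤ w.count true := by
  rcases h with rfl | rfl
  · exact ⟨_, desWord_mem_words_rect (l := [(0, 0), (1, 0), (0, 1), (1, 1), (0, 2), (1, 2)])
      (by decide) (by decide), by decide⟩
  · exact ⟨_, desWord_mem_words_rect
      (l := [(0, 0), (1, 0), (0, 1), (1, 1), (0, 2), (1, 2), (0, 3), (1, 3)])
      (by decide) (by decide), by decide⟩

end Kind

end TwoRows

section Obstructions

variable {C : Finset (ℕ × ℕ)} {l m : List (ℕ × ℕ)} {x y : ℕ × ℕ}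

theorem pairwise_row_of_desWord_false : ∀ {m : List (ℕ × ℕ)}, (∀ b ∈ desWord m, b = false) →
    m.Pairwise fun a b => b.1 ≤ a.1
  | [], _ => List.Pairwise.nil
  | [_], _ => List.pairwise_singleton _ _
  | a :: b :: m, h => by
    simp only [desWord_cons_cons, List.forall_mem_cons, decide_eq_false_iff_not, not_lt] at h
    have hm := pairwise_row_of_desWord_false h.2
    refine List.Pairwise.cons ?_ hm
    rintro c (_ | ⟨_, hc⟩)
    · exact h.1
    · exact ((List.pairwise_cons.1 hm).1 c hc).trans h.1

theorem IsLinExt.row_le (h : IsLinExt C (l ++ m)) (hm : ∀ b ∈ desWord m, b = false)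
    (hx : x ∈ m) (hy : y ∈ m) (hxy : x < y) : y.1 ≤ x.1 := by
  obtain ⟨k, k', rfl⟩ := List.append_of_mem hx
  rw [← List.append_assoc] at h
  have hyC : y ∈ C := (h.mem_iff y).1 (by
    simp only [List.mem_append, List.mem_cons] at hy ⊢
    tauto)
  have hrow := (List.pairwise_append.1 (pairwise_row_of_desWord_false hm)).2.1
  exact (List.pairwise_cons.1 hrow).1 y (h.mem_right_of_lt hyC hxy)

theorem desWord_drop : ∀ (l : List (ℕ × ℕ)) (n : ℕ), desWord (l.drop n) = (desWord l).drop n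
  | _, 0 => rfl
  | [], n + 1 => by simp [desWord]
  | [a], n + 1 => by simp [desWord]
  | a :: b :: l, n + 1 => by
    rw [List.drop_succ_cons, desWord_drop, desWord_cons_cons, List.drop_succ_cons]

theorem append_replicate_false_not_mem_words {u : List Bool} {n : ℕ}
    (h₀ : ∀ j ≤ u.length, (0, j) ∈ C) (h₁ : (1, u.length) ∈ C) :
    u ++ List.replicate n false ∉ words C := by
  rintro ⟨l, hl, hw⟩
  rw [← List.take_append_drop u.length l] at hl
  have hfalse : ∀ b ∈ desWord (l.drop u.length), b = false := by
    rw [desWord_drop, hw, List.drop_left]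
    exact fun b => List.eq_of_mem_replicate
  have hlt : ((0, u.length) : ℕ × ℕ) < (1, u.length) := by simp
  have hx : (0, u.length) ∉ l.take u.length := fun hmem => by
    have hsub : (Finset.range (u.length + 1)).image (Prod.mk 0) ⊆
        (l.take u.length).toFinset := by
      simp only [Finset.image_subset_iff, Finset.mem_range_succ_iff, List.mem_toFinset]
      exact fun j hj => hl.mem_left (h₀ j hj) hmem (Prod.mk_le_mk.2 ⟨le_rfl, hj⟩)
    have hcard := (Finset.card_le_card hsub).trans (List.toFinset_card_le _)
    rw [Finset.card_image_of_injective _ (Prod.mk_right_injective 0), Finset.card_range,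
      List.length_take] at hcard
    omega
  have hxr := (List.mem_append.1 ((hl.mem_iff _).2 (h₀ _ le_rfl))).resolve_left hx
  have hyr := (List.mem_append.1 ((hl.mem_iff _).2 h₁)).resolve_left
    fun hy => hx (hl.mem_left (h₀ _ le_rfl) hy hlt.le)
  exact Nat.not_succ_le_zero 0 (hl.row_le hfalse hxr hyr hlt)

theorem InBox.true_true_not_mem_words {c : ℕ} (hC : InBox 2 c C) (w : List Bool) :
    true :: true :: w ∉ words C := by
  rintro ⟨_ | ⟨x, _ | ⟨y, _ | ⟨z, l⟩⟩⟩, hl, hw⟩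
  · cases hw
  · cases hw
  · simp only [desWord_cons_cons, desWord_singleton, List.cons.injEq, reduceCtorEq, and_false] at hw
  · simp only [desWord_cons_cons, List.cons.injEq, decide_eq_true_eq] at hw
    have := hC z ((hl.mem_iff z).1 (by simp))
    omega

end Obstructions

/-- The numbers of descents of the linear extensions of `C`. -/
def descentNumbers (C : Finset (ℕ × ℕ)) : Set ℕ := List.count true '' words C

theorem CellConvex.descentNumbers_swap {C : Finset (ℕ × ℕ)} (hC : CellConvex C) :
    descentNumbers (C.image Prod.swap) = (C.card - 1 - ·) '' descentNumbers C := by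
  rw [descentNumbers, hC.words_swap, descentNumbers, Set.image_image, Set.image_image]
  refine Set.image_congr fun w hw => ?_
  have hcount : (w.map not).count true = w.count false :=
    List.count_map_of_injective w not Bool.not_injective false
  rw [hcount, ← length_of_mem_words hw, ← List.count_true_add_count_false w,
    Nat.add_sub_cancel_left]

namespace Kind

variable {r c : ℕ} {k k' : Kind}

theorem convex (k : Kind) : CellConvex k.cells := by
  intro i j i' j' h h' a b h1 h2 h3 h4
  rw [mem_cells] at h h' ⊢
  cases k <;> simp only [rows, cols, Mem, and_true] at h h' ⊢ <;> omega

theorem words_tr (k : Kind) : words k.tr.cells = List.map not '' words k.cells := by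
  rw [cells_tr, k.convex.words_swap]

theorem card_tr (k : Kind) : k.tr.cells.card = k.cells.card := by
  rw [cells_tr, Finset.card_image_of_injective _ Prod.swap_injective]

theorem card_twoT (hr : 2 ≤ r) : (twoT r).cells.card = r + 2 :=
  (card_tr (two r)).trans (card_two hr)

theorem count_true_replicate_append (m n : ℕ) :
    (List.replicate m true ++ List.replicate n false).count true = m := by
  simp [List.count_replicate]

theorem replicate_mem_words_hook (h : (hook r c).Valid) :
    List.replicate (r - 1) true ++ List.replicate (c - 1) false ∈ words (hook r c).cells := by
  have ⟨(hr : 1 ≤ r), (hc : 1 ≤ c)⟩ := h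
  rw [mem_words_hook h, count_true_replicate_append, List.length_append, List.length_replicate,
    List.length_replicate]
  omega

theorem replicate_mem_words_disc (h : (disc r c).Valid) {t : ℕ} (ht : t + 1 = r ∨ t + 2 = r) :
    List.replicate t true ++ List.replicate (r + c - 3 - t) false ∈ words (disc r c).cells := by
  have hc : 2 ≤ c := h.2
  rw [mem_words_disc h, count_true_replicate_append, List.length_append, List.length_replicate,
    List.length_replicate]
  omega

theorem descentNumbers_hook (h : (hook r c).Valid) :
    descentNumbers (hook r c).cells = {r - 1} := by
  refine Set.eq_singleton_iff_unique_mem.2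
    ⟨⟨_, replicate_mem_words_hook h, count_true_replicate_append _ _⟩, ?_⟩
  rintro _ ⟨w, hw, rfl⟩
  have := (mem_words_hook h).1 hw
  omega

theorem descentNumbers_disc (h : (disc r c).Valid) :
    descentNumbers (disc r c).cells = {r - 2, r - 1} := by
  have hr : 2 ≤ r := h.1
  ext t
  constructor
  · rintro ⟨w, hw, rfl⟩
    have := (mem_words_disc h).1 hw
    rw [Set.mem_insert_iff, Set.mem_singleton_iff]
    omega
  · intro ht
    rw [Set.mem_insert_iff, Set.mem_singleton_iff] at ht
    exact ⟨_, replicate_mem_words_disc h (by omega), count_true_replicate_append t _⟩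

theorem descentNumbers_two (hc : 2 ≤ c) : descentNumbers (two c).cells = {1, 2} := by
  ext t
  constructor
  · rintro ⟨w, hw, rfl⟩
    rcases (mem_words_two hc).1 hw with ⟨a, b, d, -, -, rfl⟩ | ⟨a, d, -, -, rfl⟩ <;>
      simp [List.count_replicate]
  · rintro (rfl | rfl)
    · exact ⟨_, (mem_words_two hc).2 (Or.inr ⟨1, c - 2, le_rfl, by omega, rfl⟩),
        by simp [List.count_replicate]⟩
    · exact ⟨_, (mem_words_two hc).2 (Or.inl ⟨0, 1, c - 2, le_rfl, by omega, rfl⟩),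
        by simp [List.count_replicate]⟩

theorem descentNumbers_twoT (hr : 2 ≤ r) : descentNumbers (twoT r).cells = {r, r - 1} := by
  rw [show twoT r = (two r).tr from rfl, cells_tr, (convex _).descentNumbers_swap, card_two hr,
    descentNumbers_two hr, Set.image_pair]
  congr 1

theorem exists_descentNumbers_rect (h : (rect c).Valid) :
    ∃ s ∈ descentNumbers (rect c).cells, ∃ t ∈ descentNumbers (rect c).cells, s + 2 ≤ t := by
  obtain ⟨v, hv, hv₁⟩ := exists_false_false_mem_words_rect h
  obtain ⟨w, hw, hw₃⟩ := exists_three_le_count_rect h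
  exact ⟨1, ⟨_, hv, hv₁⟩, _, ⟨w, hw, rfl⟩, hw₃⟩

theorem exists_descentNumbers_rectT (h : (rectT r).Valid) :
    ∃ s ∈ descentNumbers (rectT r).cells, ∃ t ∈ descentNumbers (rectT r).cells, s + 2 ≤ t := by
  obtain ⟨s, hs, t, ht, hst⟩ := exists_descentNumbers_rect (c := r) h
  have hle : t ≤ (rect r).cells.card - 1 := by
    obtain ⟨w, hw, rfl⟩ := ht
    exact List.count_le_length.trans_eq (length_of_mem_words hw)
  rw [show rectT r = (rect r).tr from rfl, cells_tr, (convex _).descentNumbers_swap]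
  exact ⟨_, Set.mem_image_of_mem _ ht, _, Set.mem_image_of_mem _ hs, by omega⟩

/-- The pairs of kinds whose sets of descent words are comparable for inclusion although their
diagrams differ; these are the cases (a), (b) and (c) of the theorem. -/
def Listed (k k' : Kind) : Prop :=
  ∃ r c, k = disc r c ∧ (k' = hook r (c - 1) ∨ k' = hook (r - 1) c ∨
    (r = 3 ∧ 3 ≤ c ∧ k' = two (c - 1)) ∨ (c = 3 ∧ 3 ≤ r ∧ k' = twoT (r - 1)))

theorem words_subset_words_disc (h : (disc r c).Valid) {C : Finset (ℕ × ℕ)}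
    (hcard : C.card + 2 = r + c) (hsub : descentNumbers C ⊆ {r - 2, r - 1}) :
    words C ⊆ words (disc r c).cells := by
  intro w hw
  have hcount := hsub (Set.mem_image_of_mem _ hw)
  have hlen := length_of_mem_words hw
  obtain ⟨hr, hc⟩ : 2 ≤ r ∧ 2 ≤ c := h
  rw [Set.mem_insert_iff, Set.mem_singleton_iff] at hcount
  exact (mem_words_disc ⟨hr, hc⟩).2 (by omega)

theorem Listed.words_subset (h : Listed k k') (hk : k.Valid) :
    words k'.cells ⊆ words k.cells := by
  obtain ⟨r, c, rfl, h⟩ := h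
  obtain ⟨hr, hc⟩ : 2 ≤ r ∧ 2 ≤ c := hk
  apply words_subset_words_disc ⟨hr, hc⟩
  · rcases h with rfl | rfl | ⟨rfl, h3, rfl⟩ | ⟨rfl, h3, rfl⟩
    · have := card_hook (r := r) (c := c - 1) ⟨by omega, by omega⟩
      omega
    · have := card_hook (r := r - 1) (c := c) ⟨by omega, by omega⟩
      omega
    · have := card_two (c := c - 1) (by omega)
      omega
    · have := card_twoT (r := r - 1) (by omega)
      omega
  · rcases h with rfl | rfl | ⟨rfl, h3, rfl⟩ | ⟨rfl, h3, rfl⟩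
    · simp [descentNumbers_hook (r := r) (c := c - 1) ⟨by omega, by omega⟩]
    · simp [descentNumbers_hook (r := r - 1) (c := c) ⟨by omega, by omega⟩, Nat.sub_sub]
    · simp [descentNumbers_two (c := c - 1) (by omega)]
    · simp [descentNumbers_twoT (r := r - 1) (by omega), Nat.sub_sub, Set.pair_comm]

theorem cells_twoT_two : (twoT 2).cells = (two 2).cells := by
  ext ⟨i, j⟩
  simp only [mem_cells, rows, cols, Mem]
  omega

theorem exists_true_true_mem_words_twoT (hr : 3 ≤ r) :
    ∃ w, true :: true :: w ∈ words (twoT r).cells := by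
  rw [show twoT r = (two r).tr from rfl, words_tr]
  exact ⟨_, _, (mem_words_two (c := r) (by omega)).2 (Or.inr ⟨2, r - 3, by omega, by omega, rfl⟩),
    rfl⟩

theorem exists_true_true_mem_words_rectT (h : (rectT r).Valid) :
    ∃ w, true :: true :: w ∈ words (rectT r).cells := by
  obtain ⟨w, hw, -⟩ := exists_false_false_mem_words_rect (c := r) h
  rw [show rectT r = (rect r).tr from rfl, words_tr]
  exact ⟨_, _, hw, rfl⟩

theorem replicate_append_not_mem_words {C : Finset (ℕ × ℕ)} (hC : InBox 2 c C)
    (h : ∀ i < 2, ∀ j < 2, (i, j) ∈ C) (m n : ℕ) :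
    List.replicate m true ++ List.replicate n false ∉ words C := by
  rcases m with _ | _ | m
  · exact append_replicate_false_not_mem_words (fun j hj => h 0 (by omega) j (by grind))
      (h 1 (by omega) 0 (by omega))
  · exact append_replicate_false_not_mem_words (u := [true])
      (fun j hj => h 0 (by omega) j (by grind)) (h 1 (by omega) 1 (by omega))
  · exact hC.true_true_not_mem_words _

theorem two_or_rect_of_words_subset {C : Finset (ℕ × ℕ)} (hC : InBox 2 c C)
    (h : ∀ i < 2, ∀ j < 2, (i, j) ∈ C) (hk : k.Valid) (hsub : words k.cells ⊆ words C) :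
    (∃ c', 2 ≤ c' ∧ k.cells = (two c').cells) ∨ ∃ c', k = rect c' := by
  cases k with
  | hook r c =>
    exact absurd (hsub (replicate_mem_words_hook hk)) (replicate_append_not_mem_words hC h _ _)
  | disc r c =>
    have hr : 2 ≤ r := hk.1
    exact absurd (hsub (replicate_mem_words_disc hk (t := r - 1) (by omega)))
      (replicate_append_not_mem_words hC h _ _)
  | two c => exact Or.inl ⟨c, hk, rfl⟩
  | twoT r =>
    obtain rfl | hr := eq_or_lt_of_le (α := ℕ) hk
    · exact Or.inl ⟨2, le_rfl, cells_twoT_two⟩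
    · obtain ⟨w, hw⟩ := exists_true_true_mem_words_twoT hr
      exact absurd (hsub hw) (hC.true_true_not_mem_words w)
  | rect c => exact Or.inr ⟨c, rfl⟩
  | rectT r =>
    obtain ⟨w, hw⟩ := exists_true_true_mem_words_rectT hk
    exact absurd (hsub hw) (hC.true_true_not_mem_words w)

theorem descentNumbers_mono {C C' : Finset (ℕ × ℕ)} (h : words C' ⊆ words C) :
    descentNumbers C' ⊆ descentNumbers C :=
  Set.image_mono h

theorem cells_eq_of_words_subset_two (hc : (two c).Valid) (hk : k.Valid)
    (hcard : k.cells.card = (two c).cells.card) (hsub : words k.cells ⊆ words (two c).cells) :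
    k.cells = (two c).cells := by
  have h2 : 2 ≤ c := hc
  have hsq : ∀ i < 2, ∀ j < 2, (i, j) ∈ (two c).cells := fun i hi j hj =>
    (mem_cells_two hc).2 (by omega)
  rcases two_or_rect_of_words_subset (inBox (two c)) hsq hk hsub with ⟨c', hc', h⟩ | ⟨c', rfl⟩
  · rw [h, card_two hc', card_two h2] at hcard
    rw [h, Nat.add_right_cancel hcard]
  · have hdes := descentNumbers_mono hsub
    obtain ⟨s, hs, t, ht, hst⟩ := exists_descentNumbers_rect hk
    have hs' := hdes hs
    have ht' := hdes ht
    rw [descentNumbers_two h2, Set.mem_insert_iff, Set.mem_singleton_iff] at hs' ht'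
    omega

theorem cells_eq_of_words_subset_rect (hc : (rect c).Valid) (hk : k.Valid)
    (hcard : k.cells.card = (rect c).cells.card) (hsub : words k.cells ⊆ words (rect c).cells) :
    k.cells = (rect c).cells := by
  have h3 : 3 ≤ c := by rcases hc with rfl | rfl <;> omega
  have hmem : ∀ i < 2, ∀ j < 3, (i, j) ∈ (rect c).cells := fun i hi j hj =>
    mem_cells.2 ⟨hi, hj.trans_le h3, trivial⟩
  rcases two_or_rect_of_words_subset (inBox (rect c)) (fun i hi j hj => hmem i hi j (by omega)) hk
    hsub with ⟨c', hc', h⟩ | ⟨c', rfl⟩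
  · have hw : [false, true] ++ List.replicate (c' - 1) false ∈ words (two c').cells :=
      (mem_words_two hc').2 (Or.inr ⟨1, c' - 2, le_rfl, by omega, by
        rw [show c' - 1 = c' - 2 + 1 by omega]; rfl⟩)
    exact absurd (hsub (h ▸ hw)) <| append_replicate_false_not_mem_words
      (u := [false, true]) (fun j hj => hmem 0 (by omega) j (by grind))
      (hmem 1 (by omega) 2 (by omega))
  · rw [card_rect, card_rect] at hcard
    rw [show c' = c by omega]

theorem words_subset_words_tr (h : words k'.cells ⊆ words k.cells) :
    words k'.tr.cells ⊆ words k.tr.cells := by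
  rw [words_tr, words_tr]
  exact Set.image_mono h

theorem cells_eq_of_tr (h : k'.tr.cells = k.tr.cells) : k'.cells = k.cells := by
  rw [cells_tr, cells_tr] at h
  exact Finset.image_injective Prod.swap_injective h

theorem cells_eq_of_words_subset_hook (hk : (hook r c).Valid) (hk' : k'.Valid)
    (hcard : k'.cells.card = (hook r c).cells.card)
    (hsub : words k'.cells ⊆ words (hook r c).cells) : k'.cells = (hook r c).cells := by
  have hdes := descentNumbers_mono hsub
  have hrc := card_hook hk
  obtain ⟨hr, hc⟩ : 1 ≤ r ∧ 1 ≤ c := hk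
  rw [descentNumbers_hook ⟨hr, hc⟩] at hdes
  cases k' with
  | hook r' c' =>
    have hrc' := card_hook hk'
    obtain ⟨hr', hc'⟩ : 1 ≤ r' ∧ 1 ≤ c' := hk'
    rw [descentNumbers_hook ⟨hr', hc'⟩, Set.singleton_subset_singleton] at hdes
    rw [show r' = r by omega, show c' = c by omega]
  | disc r' c' =>
    have hr' : 2 ≤ r' := hk'.1
    simp only [descentNumbers_disc hk', Set.pair_subset_iff, Set.mem_singleton_iff] at hdes
    omega
  | two c' =>
    simp only [descentNumbers_two hk', Set.pair_subset_iff, Set.mem_singleton_iff] at hdes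
    omega
  | twoT r' =>
    have hr' : 2 ≤ r' := hk'
    simp only [descentNumbers_twoT hk', Set.pair_subset_iff, Set.mem_singleton_iff] at hdes
    omega
  | rect c' =>
    obtain ⟨s, hs, t, ht, hst⟩ := exists_descentNumbers_rect hk'
    have := (hdes hs).trans (hdes ht).symm
    omega
  | rectT r' =>
    obtain ⟨s, hs, t, ht, hst⟩ := exists_descentNumbers_rectT hk'
    have := (hdes hs).trans (hdes ht).symm
    omega

theorem cells_eq_or_listed_of_words_subset_disc (hk : (disc r c).Valid) (hk' : k'.Valid)
    (hcard : k'.cells.card = (disc r c).cells.card)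
    (hsub : words k'.cells ⊆ words (disc r c).cells) :
    k'.cells = (disc r c).cells ∨ Listed (disc r c) k' := by
  have hdes := descentNumbers_mono hsub
  have hrc := card_disc hk
  obtain ⟨hr, hc⟩ : 2 ≤ r ∧ 2 ≤ c := hk
  rw [descentNumbers_disc ⟨hr, hc⟩] at hdes
  cases k' with
  | hook r' c' =>
    have hrc' := card_hook hk'
    obtain ⟨hr', hc'⟩ : 1 ≤ r' ∧ 1 ≤ c' := hk'
    simp only [descentNumbers_hook ⟨hr', hc'⟩, Set.singleton_subset_iff, Set.mem_insert_iff,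
      Set.mem_singleton_iff] at hdes
    refine Or.inr ⟨r, c, rfl, ?_⟩
    simp only [hook.injEq]
    omega
  | disc r' c' =>
    have hrc' := card_disc hk'
    obtain ⟨hr', hc'⟩ : 2 ≤ r' ∧ 2 ≤ c' := hk'
    simp only [descentNumbers_disc ⟨hr', hc'⟩, Set.pair_subset_iff, Set.mem_insert_iff,
      Set.mem_singleton_iff] at hdes
    rw [show r' = r by omega, show c' = c by omega]
    exact Or.inl rfl
  | two c' =>
    have hc' : 2 ≤ c' := hk'
    rw [card_two hc'] at hcard
    simp only [descentNumbers_two hc', Set.pair_subset_iff, Set.mem_insert_iff,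
      Set.mem_singleton_iff] at hdes
    exact Or.inr ⟨r, c, rfl, Or.inr (Or.inr (Or.inl ⟨by omega, by omega, by
      rw [two.injEq]; omega⟩))⟩
  | twoT r' =>
    have hr' : 2 ≤ r' := hk'
    rw [card_twoT hr'] at hcard
    simp only [descentNumbers_twoT hr', Set.pair_subset_iff, Set.mem_insert_iff,
      Set.mem_singleton_iff] at hdes
    exact Or.inr ⟨r, c, rfl, Or.inr (Or.inr (Or.inr ⟨by omega, by omega, by
      rw [twoT.injEq]; omega⟩))⟩
  | rect c' =>
    obtain ⟨s, hs, t, ht, hst⟩ := exists_descentNumbers_rect hk'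
    have hs' := hdes hs
    have ht' := hdes ht
    rw [Set.mem_insert_iff, Set.mem_singleton_iff] at hs' ht'
    omega
  | rectT r' =>
    obtain ⟨s, hs, t, ht, hst⟩ := exists_descentNumbers_rectT hk'
    have hs' := hdes hs
    have ht' := hdes ht
    rw [Set.mem_insert_iff, Set.mem_singleton_iff] at hs' ht'
    omega

theorem cells_eq_or_listed_of_words_subset (hk : k.Valid) (hk' : k'.Valid)
    (hcard : k'.cells.card = k.cells.card) (hsub : words k'.cells ⊆ words k.cells) :
    k'.cells = k.cells ∨ Listed k k' := by
  have hcard_tr : k'.tr.cells.card = k.tr.cells.card := by rw [card_tr, card_tr, hcard]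
  have hsub_tr := words_subset_words_tr hsub
  cases k with
  | hook r c => exact Or.inl (cells_eq_of_words_subset_hook hk hk' hcard hsub)
  | disc r c => exact cells_eq_or_listed_of_words_subset_disc hk hk' hcard hsub
  | two c => exact Or.inl (cells_eq_of_words_subset_two hk hk' hcard hsub)
  | rect c => exact Or.inl (cells_eq_of_words_subset_rect hk hk' hcard hsub)
  | twoT r =>
    exact Or.inl (cells_eq_of_tr (cells_eq_of_words_subset_two hk.tr hk'.tr hcard_tr hsub_tr))
  | rectT r =>
    exact Or.inl (cells_eq_of_tr (cells_eq_of_words_subset_rect hk.tr hk'.tr hcard_tr hsub_tr))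

theorem Listed.not_symm (h : Listed k k') : ¬ Listed k' k := by
  rintro ⟨r', c', h', -⟩
  obtain ⟨r, c, -, rfl | rfl | ⟨-, -, rfl⟩ | ⟨-, -, rfl⟩⟩ := h <;> cases h'

theorem rotCells_rect : rotCells 2 c (rect c).cells = (rect c).cells := by
  ext ⟨i, j⟩
  rw [(inBox (rect c)).mem_rotCells (r := 2) (c := c), mem_cells, mem_cells]
  simp only [rows, cols, Mem, and_true]
  omega

theorem reverse_mem_words_two (hc : 2 ≤ c) {w : List Bool} (hw : w ∈ words (two c).cells) :
    w.reverse ∈ words (two c).cells := by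
  rw [mem_words_two hc] at hw ⊢
  rcases hw with ⟨a, b, d, hb, habd, rfl⟩ | ⟨a, d, ha, had, rfl⟩
  · exact Or.inl ⟨d, b, a, hb, by omega, by simp⟩
  · refine Or.inr ⟨d + 1, a - 1, by omega, by omega, ?_⟩
    simp [Nat.sub_add_cancel ha]

theorem reverse_mem_words_rect {w : List Bool} (hw : w ∈ words (rect c).cells) :
    w.reverse ∈ words (rect c).cells := by
  have h := (inBox (rect c)).reverse_words_subset (r := 2) (c := c) (Set.mem_image_of_mem _ hw)
  rwa [rotCells_rect] at h

theorem reverse_mem_words_tr (h : ∀ w ∈ words k.cells, w.reverse ∈ words k.cells) :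
    ∀ w ∈ words k.tr.cells, w.reverse ∈ words k.tr.cells := by
  rw [words_tr]
  rintro _ ⟨w, hw, rfl⟩
  exact ⟨w.reverse, h w hw, List.map_reverse⟩

theorem reverse_mem_words (hk : k.Valid) : ∀ w ∈ words k.cells, w.reverse ∈ words k.cells := by
  cases k with
  | hook r c => exact fun w hw => by simpa [mem_words_hook hk] using hw
  | disc r c => exact fun w hw => by simpa [mem_words_disc hk] using hw
  | two c => exact fun w => reverse_mem_words_two hk
  | twoT r => exact reverse_mem_words_tr (k := two r) fun w => reverse_mem_words_two hk
  | rect c => exact fun w => reverse_mem_words_rect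
  | rectT r => exact reverse_mem_words_tr (k := rect r) fun w => reverse_mem_words_rect

end Kind

/-! ### Expansions in the fundamental quasisymmetric functions -/

namespace QSym

section Expansion

variable {n : ℕ}

theorem sum_single_apply {m : ℕ} {i : Fin m → ℕ} (hi : Function.Injective i) (b : Fin m → ℕ)
    (k : Fin m) : (∑ k, Finsupp.single (i k) (b k)) (i k) = b k := by
  rw [Finsupp.finsetSum_apply, Finset.sum_eq_single k, Finsupp.single_eq_same]
  · exact fun k' _ hne => Finsupp.single_eq_of_ne fun h => hne (hi h.symm)
  · exact fun hk => absurd (Finset.mem_univ k) hk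

theorem support_sum_single {m : ℕ} {i : Fin m → ℕ} (hi : Function.Injective i) {b : Fin m → ℕ}
    (hb : ∀ k, b k ≠ 0) :
    (∑ k, Finsupp.single (i k) (b k)).support = (List.ofFn i).toFinset := by
  ext x
  rw [Finsupp.mem_support_iff, List.mem_toFinset, List.mem_ofFn]
  constructor
  · rw [Finsupp.finsetSum_apply]
    intro h
    obtain ⟨k, -, hk⟩ := Finset.exists_ne_zero_of_sum_ne_zero h
    exact ⟨k, of_not_not fun hne => hk (Finsupp.single_eq_of_ne (Ne.symm hne))⟩
  · rintro ⟨k, rfl⟩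
    rw [sum_single_apply hi]
    exact hb k

theorem map_sort_support_sum_single (α : Composition n) {i : Fin α.length → ℕ}
    (hi : StrictMono i) :
    ((∑ k, Finsupp.single (i k) (α.blocksFun k)).support.sort (· ≤ ·)).map
      ⇑(∑ k, Finsupp.single (i k) (α.blocksFun k)) = α.blocks := by
  have hsort : (List.ofFn i).Pairwise (· ≤ ·) :=
    List.pairwise_ofFn.2 fun _ _ h => (hi h).le
  rw [support_sum_single hi.injective fun k =>
    Nat.one_le_iff_ne_zero.1 (α.one_le_blocksFun k),
    (List.toFinset_sort _ (List.nodup_ofFn.2 hi.injective)).2 hsort, List.map_ofFn,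
    ← α.ofFn_blocksFun]
  exact congrArg List.ofFn (funext fun k => sum_single_apply hi.injective _ k)

/-- The exponent of the monomial `x_0^{γ_1} x_1^{γ_2} ⋯`, which occurs in `M_γ` and in no other
monomial quasisymmetric function. -/
noncomputable def leadingExp (γ : Composition n) : ℕ →₀ ℕ :=
  ∑ k : Fin γ.length, Finsupp.single (k : ℕ) (γ.blocksFun k)

theorem coeff_leadingExp_monomialQ (β γ : Composition n) :
    MvPowerSeries.coeff (leadingExp γ) (monomialQ β) = if β = γ then 1 else 0 := by
  classical
  refine if_congr ⟨?_, ?_⟩ rfl rfl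
  · rintro ⟨i, hi, h⟩
    apply Composition.ext
    rw [← map_sort_support_sum_single β hi, ← h]
    exact map_sort_support_sum_single γ Fin.val_strictMono
  · rintro rfl
    exact ⟨_, Fin.val_strictMono, rfl⟩

theorem coeff_leadingExp_sum_fundamental (c : Composition n → ℚ) (γ : Composition n) :
    MvPowerSeries.coeff (leadingExp γ) (∑ α, c α • fundamental α) =
      ∑ α with setOfComp n α ⊆ setOfComp n γ, c α := by
  have hcoeff (α : Composition n) : MvPowerSeries.coeff (leadingExp γ) (fundamental α) =
      if setOfComp n α ⊆ setOfComp n γ then 1 else 0 := by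
    simp only [fundamental, map_sum, coeff_leadingExp_monomialQ, Finset.sum_ite_eq',
      Finset.mem_filter, Finset.mem_univ, true_and]
  simp only [map_sum, map_smul, hcoeff, smul_eq_mul, mul_ite, mul_one, mul_zero,
    Finset.sum_filter]

theorem IsFExpansion.unique {f : MvPowerSeries ℕ ℚ} {c c' : Composition n → ℚ}
    (h : IsFExpansion f c) (h' : IsFExpansion f c') : c = c' := by
  funext γ
  induction hs : setOfComp n γ using Finset.strongInduction generalizing γ with
  | H s ih =>
    have hsum := coeff_leadingExp_sum_fundamental c γ
    rw [← h, h', coeff_leadingExp_sum_fundamental c' γ] at hsum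
    have hγ : γ ∈ Finset.univ.filter fun α => setOfComp n α ⊆ setOfComp n γ := by
      rw [Finset.mem_filter]
      exact ⟨Finset.mem_univ γ, subset_rfl⟩
    rw [← Finset.add_sum_erase _ _ hγ, ← Finset.add_sum_erase _ _ hγ] at hsum
    refine (add_right_cancel (hsum.trans (congrArg _ (Finset.sum_congr rfl fun α hα => ?_)))).symm
    rw [Finset.mem_erase, Finset.mem_filter] at hα
    exact ih _ (hs ▸ hα.2.2.ssubset_of_ne ((setOfComp n).injective.ne hα.1)) α rfl

end Expansion

section Sums

variable {n : ℕ} {ι κ : Type*} [Fintype ι] [Fintype κ] {g : ι → Composition n}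
  {g' : κ → Composition n}

theorem isFExpansion_sum (g : ι → Composition n) : IsFExpansion (∑ i, fundamental (g i))
    fun α => ((Finset.univ.filter fun i => g i = α).card : ℚ) := by
  rw [IsFExpansion, ← Finset.sum_fiberwise (s := Finset.univ) (g := g)]
  refine Finset.sum_congr rfl fun α _ => ?_
  rw [Finset.sum_congr rfl fun i hi => congrArg fundamental (Finset.mem_filter.1 hi).2,
    Finset.sum_const, Nat.cast_smul_eq_nsmul]

theorem injective_of_fMultiplicityFree (h : FMultiplicityFree n (∑ i, fundamental (g i))) :
    Function.Injective g := by
  obtain ⟨c, hc, h01⟩ := h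
  intro i j hij
  have hcard : (Finset.univ.filter fun k => g k = g i).card ≤ 1 := by
    have hcoeff := congrFun (hc.unique (isFExpansion_sum g)) (g i)
    have hle : c (g i) ≤ 1 := by rcases h01 (g i) with h | h <;> simp [h]
    rw [hcoeff] at hle
    exact_mod_cast hle
  exact Finset.card_le_one.1 hcard i (by simp) j (by simp [hij])

theorem isFExpansion_of_injective (hg : Function.Injective g) :
    IsFExpansion (∑ i, fundamental (g i)) ((Set.range g).indicator 1) := by
  convert isFExpansion_sum g using 1
  funext α
  by_cases h : α ∈ Set.range g
  · obtain ⟨i, rfl⟩ := h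
    have hfiber : (Finset.univ.filter fun k => g k = g i) = {i} := by
      ext k
      simp [hg.eq_iff]
    simp [hfiber]
  · rw [Set.indicator_of_notMem h, Finset.filter_false_of_mem fun i _ hi => h ⟨i, hi⟩,
      Finset.card_empty, Nat.cast_zero]

theorem fSupport_of_injective (hg : Function.Injective g) :
    fSupport n (∑ i, fundamental (g i)) = Set.range g := by
  ext α
  constructor
  · rintro ⟨c, hc, hpos⟩
    rw [hc.unique (isFExpansion_of_injective hg)] at hpos
    exact Set.mem_of_indicator_ne_zero hpos.ne'
  · exact fun h => ⟨_, isFExpansion_of_injective hg, by simp [h]⟩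

theorem fPositive_sub_iff (hg : Function.Injective g) (hg' : Function.Injective g') :
    FPositive n ((∑ i, fundamental (g i)) - ∑ i, fundamental (g' i)) ↔
      Set.range g' ⊆ Set.range g := by
  have hsub : IsFExpansion ((∑ i, fundamental (g i)) - ∑ i, fundamental (g' i))
      ((Set.range g).indicator 1 - (Set.range g').indicator 1) := by
    rw [IsFExpansion, isFExpansion_of_injective hg, isFExpansion_of_injective hg',
      ← Finset.sum_sub_distrib]
    exact Finset.sum_congr rfl fun α _ => (sub_smul _ _ _).symm
  constructor
  · rintro ⟨c, hc, hpos⟩ α hα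
    have hα₀ := hpos α
    rw [hc.unique hsub, Pi.sub_apply, Set.indicator_of_mem hα, sub_nonneg] at hα₀
    exact Set.mem_of_indicator_ne_zero (one_pos.trans_le hα₀).ne'
  · refine fun h => ⟨_, hsub, fun α => sub_nonneg.2 ?_⟩
    exact Set.indicator_le_indicator_of_subset h (fun _ => zero_le_one) α

theorem sum_eq_sum_iff (hg : Function.Injective g) (hg' : Function.Injective g') :
    (∑ i, fundamental (g i) = ∑ i, fundamental (g' i)) ↔ Set.range g = Set.range g' := by
  constructor
  · intro h
    rw [← fSupport_of_injective hg, ← fSupport_of_injective hg', h]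
  · intro h
    rw [isFExpansion_of_injective hg, isFExpansion_of_injective hg', h]

end Sums

/-- The subset of `[n - 1]` of the positions of `true` in a word, with the indexing of
`setOfComp`. -/
def wordSet (n : ℕ) (w : List Bool) : Finset (Fin (n - 1)) :=
  Finset.univ.filter fun i => w[(i : ℕ)]? = some true

/-- The composition of `n` whose descent set consists of the positions of `true` in a word. -/
def compOfWord (n : ℕ) (w : List Bool) : Composition n :=
  (setOfComp n).symm (wordSet n w)

theorem compOfWord_injOn (n : ℕ) : Set.InjOn (compOfWord n) {w | w.length = n - 1} := by
  intro w hw w' hw' h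
  have hset := (setOfComp n).symm.injective h
  rw [Set.mem_ofPred_eq] at hw hw'
  refine List.ext_getElem (hw.trans hw'.symm) fun i hi hi' => ?_
  have hmem := Finset.ext_iff.1 hset ⟨i, hw ▸ hi⟩
  simp only [wordSet, Finset.mem_filter, Finset.mem_univ, true_and, List.getElem?_eq_getElem hi,
    List.getElem?_eq_getElem hi', Option.some.injEq] at hmem
  exact Bool.eq_iff_iff.2 hmem

end QSym

/-! ### Tableaux as linear extensions -/

theorem getElem?_desWord : ∀ {l : List (ℕ × ℕ)} {i : ℕ} (h : i + 1 < l.length),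
    (desWord l)[i]? = some (decide (l[i].1 < l[i + 1].1))
  | a :: b :: l, 0, _ => rfl
  | a :: b :: l, i + 1, h => by
    rw [desWord_cons_cons, List.getElem?_cons_succ,
      getElem?_desWord (l := b :: l) (i := i) (by simpa using h)]
    rfl

theorem IsLinExt.lt_of_getElem_lt {α : Type*} [PartialOrder α] {C : Finset α} {l : List α}
    (h : IsLinExt C l) {i j : ℕ} (hi : i < l.length) (hj : j < l.length) (hlt : l[i] < l[j]) :
    i < j := by
  by_contra! hji
  obtain rfl | hji := hji.eq_or_lt
  · exact lt_irrefl _ hlt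
  · exact List.pairwise_iff_getElem.1 h.pairwise j i hj hi hji hlt.le

namespace SkewShape

variable {A B : SkewShape} {n : ℕ}

theorem mem_cells {x : ℕ × ℕ} : x ∈ A.cells ↔ x ∈ A.outer ∧ x ∉ A.inner := by
  simp [cells]

theorem cellConvex (A : SkewShape) : CellConvex A.cells := by
  intro i j i' j' h h' a b h1 h2 h3 h4
  rw [mem_cells] at h h' ⊢
  exact ⟨A.outer.up_left_mem h2 h4 h'.1, fun hab => h.2 (A.inner.up_left_mem h1 h3 hab)⟩

namespace SYT

theorem lt_of_lt (T : SYT A) {x y : A.cells} (h : x.1 < y.1) : T.1 x < T.1 y := by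
  obtain ⟨⟨i, j⟩, hx⟩ := x
  obtain ⟨⟨i', j'⟩, hy⟩ := y
  obtain ⟨hi, hj⟩ := Prod.mk_le_mk.1 h.le
  have hcorner : (i, j') ∈ A.cells := A.cellConvex _ _ _ _ hx hy _ _ le_rfl hi hj le_rfl
  have hrow : j < j' → T.1 ⟨(i, j), hx⟩ < T.1 ⟨(i, j'), hcorner⟩ :=
    T.2.1 ⟨(i, j), hx⟩ ⟨(i, j'), hcorner⟩ rfl
  have hcol : i < i' → T.1 ⟨(i, j'), hcorner⟩ < T.1 ⟨(i', j'), hy⟩ :=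
    T.2.2 ⟨(i, j'), hcorner⟩ ⟨(i', j'), hy⟩ rfl
  rcases hi.eq_or_lt with rfl | hi
  · exact hrow (Prod.mk_lt_mk_iff_right.1 h)
  · rcases hj.eq_or_lt with rfl | hj
    · exact hcol hi
    · exact (hrow hj).trans (hcol hi)

/-- The cells of a tableau in the order of their entries. -/
def toList (T : SYT A) : List (ℕ × ℕ) :=
  List.ofFn fun k => (T.1.symm k).1

theorem isLinExt_toList (T : SYT A) : IsLinExt A.cells T.toList where
  mem_iff x := by
    rw [toList, List.mem_ofFn]
    constructor
    · rintro ⟨k, rfl⟩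
      exact (T.1.symm k).2
    · exact fun hx => ⟨T.1 ⟨x, hx⟩, by rw [Equiv.symm_apply_apply]⟩
  pairwise := List.pairwise_ofFn.2 fun i j hij hle => by
    have hne : (T.1.symm j).1 ≠ (T.1.symm i).1 := fun h =>
      hij.ne' (T.1.symm.injective (Subtype.ext h))
    have hji := T.lt_of_lt (lt_of_le_of_ne hle hne)
    rw [Equiv.apply_symm_apply, Equiv.apply_symm_apply] at hji
    exact lt_asymm hij hji

theorem exists_toList_eq {l : List (ℕ × ℕ)} (hl : IsLinExt A.cells l) :
    ∃ T : SYT A, T.toList = l := by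
  let e : Fin A.size ≃ A.cells := (finCongr hl.length_eq.symm).trans
    ((hl.nodup.getEquiv l).trans (Equiv.subtypeEquivRight hl.mem_iff))
  have hlt : ∀ x y : A.cells, x.1 < y.1 → e.symm x < e.symm y := by
    intro x y hxy
    rw [← e.apply_symm_apply x, ← e.apply_symm_apply y] at hxy
    exact hl.lt_of_getElem_lt _ _ hxy
  exact ⟨⟨e.symm, fun x y hr hc => hlt x y (Prod.lt_iff.2 (Or.inr ⟨hr.le, hc⟩)),
    fun x y hc hr => hlt x y (Prod.lt_iff.2 (Or.inl ⟨hr, hc.le⟩))⟩,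
    List.ext_getElem (by simp [toList, hl.length_eq, size]) fun i _ _ => by
      simp only [toList, List.getElem_ofFn, Equiv.symm_symm]; rfl⟩

theorem descentSet_eq (T : SYT A) :
    T.descentSet = QSym.wordSet A.size (desWord T.toList) := by
  ext i
  have hi : i + 1 < T.toList.length := by
    rw [T.isLinExt_toList.length_eq]
    exact Nat.add_lt_of_lt_sub i.2
  rw [descentSet, QSym.wordSet, Finset.mem_filter, Finset.mem_filter, getElem?_desWord hi]
  simp [toList]

/-- The composition `comp(T)` of a tableau, for `n` the size of the shape. -/
def comp (n : ℕ) (T : SYT A) : Composition n :=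
  QSym.compOfWord n (desWord T.toList)

theorem range_comp (A : SkewShape) (n : ℕ) :
    Set.range (comp (A := A) n) = QSym.compOfWord n '' words A.cells := by
  ext α
  constructor
  · rintro ⟨T, rfl⟩
    exact ⟨_, ⟨T.toList, T.isLinExt_toList, rfl⟩, rfl⟩
  · rintro ⟨_, ⟨l, hl, rfl⟩, rfl⟩
    obtain ⟨T, rfl⟩ := exists_toList_eq hl
    exact ⟨T, rfl⟩

theorem range_comp_subset_iff (hA : A.size = n) (hB : B.size = n) :
    Set.range (comp (A := B) n) ⊆ Set.range (comp (A := A) n) ↔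
      words B.cells ⊆ words A.cells := by
  subst hA
  rw [range_comp, range_comp]
  exact (QSym.compOfWord_injOn A.size).image_subset_image_iff
    (fun _ hw => hB ▸ length_of_mem_words hw) fun _ => length_of_mem_words

end SYT

theorem schur_eq_sum_comp (h : A.size = n) :
    A.schur = ∑ T : A.SYT, QSym.fundamental (T.comp n) := by
  subst h
  exact Finset.sum_congr rfl fun T _ => by rw [SYT.descentSet_eq]; rfl

theorem comp_injective (h : A.size = n) (hA : QSym.FMultiplicityFree n A.schur) :
    Function.Injective (SYT.comp (A := A) n) := by
  rw [schur_eq_sum_comp h] at hA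
  exact QSym.injective_of_fMultiplicityFree hA

theorem multFree_cells (h : A.size = n) (hA : QSym.FMultiplicityFree n A.schur) :
    MultFree A.cells := by
  intro l hl l' hl' hw
  obtain ⟨T, rfl⟩ := SYT.exists_toList_eq hl
  obtain ⟨T', rfl⟩ := SYT.exists_toList_eq hl'
  rw [comp_injective h hA (congrArg (QSym.compOfWord n) hw : T.comp n = T'.comp n)]

section Comparison

variable (hA : A.size = n) (hB : B.size = n) (hfA : QSym.FMultiplicityFree n A.schur)
  (hfB : QSym.FMultiplicityFree n B.schur)

include hA hB hfA hfB

theorem schur_eq_iff : A.schur = B.schur ↔ words A.cells = words B.cells := by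
  rw [schur_eq_sum_comp hA, schur_eq_sum_comp hB, QSym.sum_eq_sum_iff (comp_injective hA hfA)
    (comp_injective hB hfB), Set.Subset.antisymm_iff, Set.Subset.antisymm_iff,
    SYT.range_comp_subset_iff hB hA, SYT.range_comp_subset_iff hA hB]

theorem fPositive_schur_sub_iff :
    QSym.FPositive n (A.schur - B.schur) ↔ words B.cells ⊆ words A.cells := by
  rw [schur_eq_sum_comp hA, schur_eq_sum_comp hB, QSym.fPositive_sub_iff (comp_injective hA hfA)
    (comp_injective hB hfB), SYT.range_comp_subset_iff hA hB]

theorem fSupport_schur_subset_iff :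
    QSym.fSupport n B.schur ⊆ QSym.fSupport n A.schur ↔ words B.cells ⊆ words A.cells := by
  rw [schur_eq_sum_comp hA, schur_eq_sum_comp hB,
    QSym.fSupport_of_injective (comp_injective hA hfA),
    QSym.fSupport_of_injective (comp_injective hB hfB), SYT.range_comp_subset_iff hA hB]

end Comparison

end SkewShape

/-- The number of elements of `S` below `a`. -/
def rankIn (S : Finset ℕ) (a : ℕ) : ℕ := (S.filter (· < a)).card

section RankIn

variable {S : Finset ℕ} {a b k r : ℕ}

theorem rankIn_mono (S : Finset ℕ) : Monotone (rankIn S) := fun _ _ h =>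
  Finset.card_le_card (Finset.monotone_filter_right _ fun _ _ hx => lt_of_lt_of_le hx h)

theorem rankIn_lt_iff (ha : a ∈ S) : rankIn S a < rankIn S b ↔ a < b := by
  refine ⟨fun h => not_le.1 fun hba => (rankIn_mono S hba).not_gt h, fun h => ?_⟩
  refine Finset.card_lt_card ⟨Finset.monotone_filter_right _ fun _ _ hx => lt_trans hx h,
    fun hs => ?_⟩
  simpa only [lt_self_iff_false, and_false, Finset.mem_filter] using
    hs (Finset.mem_filter.2 ⟨ha, h⟩)

theorem rankIn_le_iff (hb : b ∈ S) : rankIn S a ≤ rankIn S b ↔ a ≤ b := by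
  rw [← not_lt, rankIn_lt_iff hb, not_lt]

theorem rankIn_lt_card (ha : a ∈ S) : rankIn S a < S.card :=
  Finset.card_lt_card ⟨Finset.filter_subset _ _, fun hs =>
    lt_irrefl a (Finset.mem_filter.1 (hs ha)).2⟩

theorem exists_rankIn_eq (hk : k < S.card) : ∃ a ∈ S, rankIn S a = k := by
  have hinj : Set.InjOn (rankIn S) S := fun a ha b hb h =>
    le_antisymm ((rankIn_le_iff hb).1 h.le) ((rankIn_le_iff ha).1 h.ge)
  exact Finset.surjOn_of_injOn_of_card_le (t := Finset.range S.card) _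
    (fun a ha => Finset.mem_coe.2 (Finset.mem_range.2 (rankIn_lt_card ha))) hinj
    (Finset.card_range _).le (Finset.mem_coe.2 (Finset.mem_range.2 hk))

theorem rankIn_range (ha : a ≤ r) : rankIn (Finset.range r) a = a := by
  have : (Finset.range r).filter (· < a) = Finset.range a := by
    ext x; simp only [Finset.mem_filter, Finset.mem_range]; omega
  rw [rankIn, this, Finset.card_range]

theorem rankIn_add_card_filter_gt (ha : a ∈ S) :
    rankIn S a + (S.filter (a < ·)).card + 1 = S.card := by
  have hsplit : S.filter (¬ · < a) = insert a (S.filter (a < ·)) := by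
    ext x
    simp only [Finset.mem_filter, Finset.mem_insert, not_lt, le_iff_lt_or_eq]
    grind
  rw [← Finset.card_filter_add_card_filter_not (s := S) (p := (· < a)), hsplit,
    Finset.card_insert_of_notMem (by simp), rankIn, add_assoc]

theorem rankIn_image_sub (hS : ∀ x ∈ S, x < r) (ha : a ∈ S) :
    rankIn (S.image fun x => r - 1 - x) (r - 1 - a) = S.card - 1 - rankIn S a := by
  have himage : (S.image fun x => r - 1 - x).filter (· < r - 1 - a) =
      (S.filter (a < ·)).image fun x => r - 1 - x := by
    rw [Finset.filter_image]
    refine congrArg _ (Finset.filter_congr fun x hx => ?_)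
    have := hS x hx
    omega
  have hinj : Set.InjOn (fun x => r - 1 - x) (S.filter (a < ·) : Finset ℕ) := by
    intro x hx y hy hxy
    have := hS x (Finset.mem_filter.1 hx).1
    have := hS y (Finset.mem_filter.1 hy).1
    dsimp only at hxy
    omega
  rw [rankIn, himage, Finset.card_image_of_injOn hinj, ← rankIn_add_card_filter_gt ha]
  omega

end RankIn

/-- Deletion of the empty rows and columns of `C`. -/
def reduceCells (C : Finset (ℕ × ℕ)) : Finset (ℕ × ℕ) :=
  C.image fun x => (rankIn (C.image Prod.fst) x.1, rankIn (C.image Prod.snd) x.2)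

section Reduce

variable {C : Finset (ℕ × ℕ)} {r c : ℕ}

theorem isRenumbering_reduce (C : Finset (ℕ × ℕ)) : IsRenumbering
    (fun x => (rankIn (C.image Prod.fst) x.1, rankIn (C.image Prod.snd) x.2)) C where
  row_lt_iff _ ha _ _ := rankIn_lt_iff (Finset.mem_image_of_mem _ ha)
  col_lt_iff _ ha _ _ := rankIn_lt_iff (Finset.mem_image_of_mem _ ha)

theorem inBox_reduceCells (C : Finset (ℕ × ℕ)) :
    InBox (C.image Prod.fst).card (C.image Prod.snd).card (reduceCells C) :=
  Finset.forall_mem_image.2 fun _ hx => ⟨rankIn_lt_card (Finset.mem_image_of_mem _ hx),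
    rankIn_lt_card (Finset.mem_image_of_mem _ hx)⟩

theorem CellConvex.reduce (hC : CellConvex C) : CellConvex (reduceCells C) := by
  intro i j i' j' h h' a b h1 h2 h3 h4
  have hb := inBox_reduceCells C _ h'
  obtain ⟨x, hx, rfl⟩ := exists_rankIn_eq (h2.trans_lt hb.1)
  obtain ⟨y, hy, rfl⟩ := exists_rankIn_eq (h4.trans_lt hb.2)
  obtain ⟨u, hu, huij⟩ := Finset.mem_image.1 h
  obtain ⟨v, hv, hvij⟩ := Finset.mem_image.1 h'
  obtain ⟨rfl, rfl⟩ := Prod.mk.inj huij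
  obtain ⟨rfl, rfl⟩ := Prod.mk.inj hvij
  rw [rankIn_le_iff hx] at h1
  rw [rankIn_le_iff (Finset.mem_image_of_mem _ hv)] at h2
  rw [rankIn_le_iff hy] at h3
  rw [rankIn_le_iff (Finset.mem_image_of_mem _ hv)] at h4
  exact Finset.mem_image.2 ⟨(x, y), hC _ _ _ _ hu hv x y h1 h2 h3 h4, rfl⟩

theorem CellConvex.isSkewDiagram_reduceCells (hC : CellConvex C) :
    IsSkewDiagram (reduceCells C) (C.image Prod.fst).card (C.image Prod.snd).card where
  convex := hC.reduce
  inBox := inBox_reduceCells C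
  exists_mem_row i hi := by
    obtain ⟨a, ha, rfl⟩ := exists_rankIn_eq hi
    obtain ⟨x, hx, rfl⟩ := Finset.mem_image.1 ha
    exact ⟨_, Finset.mem_image_of_mem _ hx⟩
  exists_mem_col j hj := by
    obtain ⟨a, ha, rfl⟩ := exists_rankIn_eq hj
    obtain ⟨x, hx, rfl⟩ := Finset.mem_image.1 ha
    exact ⟨_, Finset.mem_image_of_mem _ hx⟩

theorem InBox.card_rotCells (hC : InBox r c C) : (rotCells r c C).card = C.card := by
  refine le_antisymm Finset.card_image_le ?_
  conv_lhs => rw [← hC.rotCells_rotCells]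
  exact Finset.card_image_le

theorem InBox.reduceCells_rotCells (hC : InBox r c C) :
    reduceCells (rotCells r c C) =
      rotCells (C.image Prod.fst).card (C.image Prod.snd).card (reduceCells C) := by
  have hfst : (rotCells r c C).image Prod.fst = (C.image Prod.fst).image fun x => r - 1 - x := by
    simp only [rotCells, Finset.image_image]; rfl
  have hsnd : (rotCells r c C).image Prod.snd = (C.image Prod.snd).image fun x => c - 1 - x := by
    simp only [rotCells, Finset.image_image]; rfl
  rw [reduceCells, hfst, hsnd, rotCells, rotCells, reduceCells]
  refine Finset.image_image.trans ((Finset.image_congr fun x hx => Prod.ext ?_ ?_).trans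
    Finset.image_image.symm)
  · exact rankIn_image_sub (Finset.forall_mem_image.2 fun y hy => (hC y hy).1)
      (Finset.mem_image_of_mem _ hx)
  · exact rankIn_image_sub (Finset.forall_mem_image.2 fun y hy => (hC y hy).2)
      (Finset.mem_image_of_mem _ hx)

namespace IsSkewDiagram

theorem image_fst (h : IsSkewDiagram C r c) : C.image Prod.fst = Finset.range r := by
  refine (Finset.image_subset_iff.2 fun x hx => Finset.mem_range.2 (h.inBox x hx).1).antisymm
    fun i hi => ?_
  obtain ⟨j, hj⟩ := h.exists_mem_row i (Finset.mem_range.1 hi)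
  exact Finset.mem_image_of_mem Prod.fst hj

theorem image_snd (h : IsSkewDiagram C r c) : C.image Prod.snd = Finset.range c := by
  simpa only [Finset.image_image, Function.comp_def, Prod.fst_swap] using h.swap.image_fst

theorem reduceCells_eq (h : IsSkewDiagram C r c) : reduceCells C = C := by
  rw [reduceCells, h.image_fst, h.image_snd]
  refine (Finset.image_congr fun x hx => ?_).trans Finset.image_id
  exact Prod.ext (rankIn_range (h.inBox x hx).1.le) (rankIn_range (h.inBox x hx).2.le)

theorem rows_cols_unique {r' c' : ℕ} (h : IsSkewDiagram C r c) (h' : IsSkewDiagram C r' c') :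
    r = r' ∧ c = c' :=
  ⟨by simpa using congrArg Finset.card (h.image_fst.symm.trans h'.image_fst),
    by simpa using congrArg Finset.card (h.image_snd.symm.trans h'.image_snd)⟩

end IsSkewDiagram

end Reduce

namespace Kind

theorem exists_mem_row {k : Kind} (hk : k.Valid) : ∀ i < k.rows, ∃ j, (i, j) ∈ k.cells := by
  intro i hi
  simp only [mem_cells]
  cases k with
  | disc r c =>
    rcases Nat.eq_zero_or_pos i with rfl | h
    · exact ⟨1, hi, hk.2, Or.inl ⟨rfl, one_ne_zero⟩⟩
    · exact ⟨0, hi, Nat.zero_lt_of_lt hk.2, Or.inr ⟨h.ne', rfl⟩⟩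
  | _ => exact ⟨0, hi, by simp only [Valid, rows, cols] at *; omega, by simp [Mem]⟩

theorem isSkewDiagram {k : Kind} (hk : k.Valid) : IsSkewDiagram k.cells k.rows k.cols where
  convex := k.convex
  inBox := k.inBox
  exists_mem_row := exists_mem_row hk
  exists_mem_col j hj := by
    simpa only [cells_tr, mem_image_swap, Prod.swap_prod_mk] using
      exists_mem_row hk.tr j (k.rows_tr ▸ hj)

end Kind

namespace SkewShape

variable {A B : SkewShape}

theorem reducedCells_eq (A : SkewShape) : A.reducedCells = reduceCells A.cells := rfl

theorem words_reducedCells (A : SkewShape) : words A.reducedCells = words A.cells :=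
  (isRenumbering_reduce A.cells).words_image

theorem multFree_reducedCells : MultFree A.reducedCells ↔ MultFree A.cells :=
  (isRenumbering_reduce A.cells).multFree_image_iff

theorem card_reducedCells (A : SkewShape) : A.reducedCells.card = A.size :=
  Finset.card_image_of_injOn (isRenumbering_reduce A.cells).injOn

theorem isSkewDiagram_reducedCells (A : SkewShape) : IsSkewDiagram A.reducedCells
    (A.cells.image Prod.fst).card (A.cells.image Prod.snd).card :=
  A.cellConvex.isSkewDiagram_reduceCells

theorem inBox_cells (A : SkewShape) : InBox (A.outer.colLen 0) (A.outer.rowLen 0) A.cells := by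
  rintro ⟨i, j⟩ h
  have hij := (mem_cells.1 h).1
  exact ⟨YoungDiagram.mem_iff_lt_colLen.1 (A.outer.up_left_mem le_rfl (Nat.zero_le _) hij),
    YoungDiagram.mem_iff_lt_rowLen.1 (A.outer.up_left_mem (Nat.zero_le _) le_rfl hij)⟩

theorem cells_rotate (A : SkewShape) :
    A.rotate.cells = rotCells (A.outer.colLen 0) (A.outer.rowLen 0) A.cells := by
  ext x
  rw [A.inBox_cells.mem_rotCells, mem_cells, cells, Finset.mem_sdiff]
  change x ∈ (rotCompl A.outer A.inner).cells ∧ x ∉ (rotCompl A.outer A.outer).cells ↔ _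
  simp only [rotCompl, Finset.mem_filter, Finset.mem_product, Finset.mem_range]
  tauto

theorem reducedCells_rotate {r c : ℕ} (h : IsSkewDiagram A.reducedCells r c) :
    A.rotate.reducedCells = rotCells r c A.reducedCells := by
  obtain ⟨rfl, rfl⟩ := h.rows_cols_unique A.isSkewDiagram_reducedCells
  rw [reducedCells_eq, cells_rotate, A.inBox_cells.reduceCells_rotCells, reducedCells_eq]

theorem rotate_congr (h : A ≈ B) : A.rotate ≈ B.rotate := by
  have hAB : A.reducedCells = B.reducedCells := h
  have hA := A.isSkewDiagram_reducedCells
  change A.rotate.reducedCells = B.rotate.reducedCells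
  rw [reducedCells_rotate hA, reducedCells_rotate (hAB ▸ hA), hAB]

theorem rotate_rotate (A : SkewShape) : A.rotate.rotate ≈ A := by
  have hA := A.isSkewDiagram_reducedCells
  have hrot := hA.rot
  rw [← reducedCells_rotate hA] at hrot
  change A.rotate.rotate.reducedCells = A.reducedCells
  rw [reducedCells_rotate hrot, reducedCells_rotate hA, hA.inBox.rotCells_rotCells]

theorem words_congr (h : A ≈ B) : words A.cells = words B.cells := by
  rw [← words_reducedCells, ← words_reducedCells]
  exact congrArg words h

theorem equiv_of_size_eq_zero (hA : A.size = 0) (hB : B.size = 0) : A ≈ B := by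
  rw [← card_reducedCells, Finset.card_eq_zero] at hA hB
  exact hA.trans hB.symm

/-- The diagram of `A` is, up to rotation by 180 degrees, that of the valid kind `k`. -/
structure HasKind (A : SkewShape) (k : Kind) : Prop where
  valid : k.Valid
  exists_eq_cells : ∃ A' ∈ ({A, A.rotate} : Set SkewShape), A'.reducedCells = k.cells

theorem exists_hasKind (hne : A.size ≠ 0) (hA : MultFree A.cells) : ∃ k, A.HasKind k := by
  have h := A.isSkewDiagram_reducedCells
  have hcol : 0 < (A.cells.image Prod.snd).card :=
    Finset.card_pos.2 ((Finset.card_ne_zero.1 hne).image _)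
  obtain ⟨k, hk | hk⟩ := h.exists_isDiagram hcol (multFree_reducedCells.2 hA)
  · exact ⟨k, hk.valid, A, Or.inl rfl, hk.eq_cells⟩
  · exact ⟨k, hk.valid, A.rotate, Or.inr rfl, (reducedCells_rotate h).trans hk.eq_cells⟩

theorem words_rotate_of_reverse_mem (h : ∀ w ∈ words A.cells, w.reverse ∈ words A.cells) :
    words A.rotate.cells = words A.cells := by
  rw [cells_rotate, A.inBox_cells.words_rotCells]
  exact Set.Subset.antisymm (Set.image_subset_iff.2 h)
    fun w hw => ⟨w.reverse, h w hw, w.reverse_reverse⟩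

theorem words_rotate (hA : MultFree A.cells) : words A.rotate.cells = words A.cells := by
  by_cases hne : A.size = 0
  · have hrot : A.rotate.cells = ∅ := by
      rw [cells_rotate, Finset.card_eq_zero.1 hne, rotCells, Finset.image_empty]
    exact words_congr (equiv_of_size_eq_zero (Finset.card_eq_zero.2 hrot) hne)
  obtain ⟨k, hk, A', hA', hcells⟩ := exists_hasKind hne hA
  have hrev : ∀ w ∈ words A'.cells, w.reverse ∈ words A'.cells := by
    rw [← words_reducedCells, hcells]
    exact Kind.reverse_mem_words hk
  rcases hA' with rfl | rfl
  · exact words_rotate_of_reverse_mem hrev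
  · exact (words_rotate_of_reverse_mem hrev).symm.trans (words_congr A.rotate_rotate)

theorem words_eq_of_mem (hA : MultFree A.cells) {A' : SkewShape}
    (hA' : A' ∈ ({A, A.rotate} : Set SkewShape)) : words A'.cells = words A.cells := by
  rcases hA' with rfl | rfl
  · rfl
  · exact words_rotate hA

end SkewShape

theorem sort_coe_of_pairwise_ge {L : List ℕ} (hL : L.Pairwise (· ≥ ·)) :
    (L : Multiset ℕ).sort (· ≥ ·) = L := by
  rw [Multiset.coe_sort, List.mergeSort_of_pairwise (hL.imp fun h => decide_eq_true h)]

theorem pairwise_ge_replicate (l a : ℕ) : (List.replicate l a).Pairwise (· ≥ ·) :=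
  List.pairwise_replicate.2 (Or.inr le_rfl)

namespace SkewShape

variable {A B : SkewShape} {l m i j : ℕ}

theorem mem_outer_straight {L : List ℕ} (hL : L.Pairwise (· ≥ ·)) :
    (i, j) ∈ (straight L).outer ↔ j < L.getD i 0 := by
  simp only [straight, YoungDiagram.mem_ofRowLens, sort_coe_of_pairwise_ge hL]
  by_cases hi : i < L.length <;> simp [hi]

theorem mem_cells_straight {L : List ℕ} (hL : L.Pairwise (· ≥ ·)) :
    (i, j) ∈ (straight L).cells ↔ j < L.getD i 0 := by
  rw [mem_cells, mem_outer_straight hL, and_iff_left]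
  exact YoungDiagram.notMem_bot _

theorem reducedCells_of_cells_eq {k : Kind} (hk : k.Valid) (h : A.cells = k.cells) :
    A.reducedCells = k.cells := by
  rw [reducedCells_eq, h, (Kind.isSkewDiagram hk).reduceCells_eq]

theorem reducedCells_straight_hook (hm : 1 ≤ m) (l : ℕ) :
    (straight (m ::ₘ Multiset.replicate l 1)).reducedCells = (Kind.hook (l + 1) m).cells := by
  refine reducedCells_of_cells_eq ⟨Nat.le_add_left 1 l, hm⟩ (Finset.ext fun ⟨i, j⟩ => ?_)
  have hsorted : (m :: List.replicate l 1).Pairwise (· ≥ ·) :=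
    List.pairwise_cons.2 ⟨fun b hb => List.eq_of_mem_replicate hb ▸ hm, pairwise_ge_replicate l 1⟩
  refine (mem_cells_straight hsorted).trans ?_
  simp only [Kind.mem_cells, Kind.rows, Kind.cols, Kind.Mem]
  rcases i with _ | i
  · simp
  · by_cases hi : i < l <;> simp [hi]
    omega

theorem reducedCells_straight_two (hm : 2 ≤ m) :
    (straight {m, 2}).reducedCells = (Kind.two m).cells := by
  refine reducedCells_of_cells_eq hm (Finset.ext fun ⟨i, j⟩ => ?_)
  refine (mem_cells_straight (L := [m, 2]) (by simpa using hm)).trans ?_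
  simp only [Kind.mem_cells, Kind.rows, Kind.cols, Kind.Mem]
  rcases i with _ | _ | i <;> simp
  omega

theorem reducedCells_straight_twoT (l : ℕ) :
    (straight (2 ::ₘ 2 ::ₘ Multiset.replicate l 1)).reducedCells =
      (Kind.twoT (l + 2)).cells := by
  refine reducedCells_of_cells_eq (k := Kind.twoT (l + 2)) (Nat.le_add_left 2 l)
    (Finset.ext fun ⟨i, j⟩ => ?_)
  have hsorted : (2 :: 2 :: List.replicate l 1).Pairwise (· ≥ ·) := by
    simp [List.pairwise_cons]
  refine (mem_cells_straight hsorted).trans ?_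
  simp only [Kind.mem_cells, Kind.rows, Kind.cols, Kind.Mem]
  rcases i with _ | _ | i
  · simp
  · simp
  · by_cases hi : i < l <;> simp [hi]
    omega

theorem mem_glue {α β lo hi : YoungDiagram} {hlo : lo ≤ α} {hhi : hi ≤ β} :
    (i, j) ∈ glue α β lo hi hlo hhi ↔ (i < β.colLen 0 ∧ j < α.rowLen 0) ∨
      (α.rowLen 0 ≤ j ∧ (i, j - α.rowLen 0) ∈ hi) ∨
      (β.colLen 0 ≤ i ∧ (i - β.colLen 0, j) ∈ lo) := by
  rw [← YoungDiagram.mem_cells]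
  simp only [glue, Finset.mem_union, Finset.mem_product, Finset.mem_range, Finset.mem_image,
    YoungDiagram.mem_cells, Prod.exists, Prod.mk.injEq, or_assoc]
  refine or_congr_right (or_congr ⟨?_, fun h => ?_⟩ ⟨?_, fun h => ?_⟩)
  · rintro ⟨a, b, h, rfl, rfl⟩
    simpa using h
  · exact ⟨i, _, h.2, rfl, Nat.sub_add_cancel h.1⟩
  · rintro ⟨a, b, h, rfl, rfl⟩
    simpa using h
  · exact ⟨_, j, h.2, Nat.sub_add_cancel h.1, rfl⟩

theorem mem_cells_oplus : (i, j) ∈ (A.oplus B).cells ↔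
    (A.outer.rowLen 0 ≤ j ∧ (i, j - A.outer.rowLen 0) ∈ B.cells) ∨
      (B.outer.colLen 0 ≤ i ∧ (i - B.outer.colLen 0, j) ∈ A.cells) := by
  have hB : (i, j - A.outer.rowLen 0) ∈ B.outer → i < B.outer.colLen 0 := fun h =>
    YoungDiagram.mem_iff_lt_colLen.1 (B.outer.up_left_mem le_rfl (Nat.zero_le _) h)
  have hA : (i - B.outer.colLen 0, j) ∈ A.outer → j < A.outer.rowLen 0 := fun h =>
    YoungDiagram.mem_iff_lt_rowLen.1 (A.outer.up_left_mem (Nat.zero_le _) le_rfl h)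
  simp only [mem_cells, oplus, mem_glue]
  grind

theorem rowLen_outer_column (hl : 0 < l) :
    (straight (Multiset.replicate l 1)).outer.rowLen 0 = 1 :=
  eq_of_forall_lt_iff fun j => YoungDiagram.mem_iff_lt_rowLen.symm.trans <|
    (mem_outer_straight (pairwise_ge_replicate l 1)).trans <| by
      simp [hl]

theorem colLen_outer_row (hm : 0 < m) : (straight {m}).outer.colLen 0 = 1 :=
  eq_of_forall_lt_iff fun i => YoungDiagram.mem_iff_lt_colLen.symm.trans <|
    (mem_outer_straight (L := [m]) (List.pairwise_singleton _ _)).trans <| by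
      rcases i with _ | i <;> simp [hm]

theorem reducedCells_column_oplus_row (hl : 1 ≤ l) (hm : 1 ≤ m) :
    ((straight (Multiset.replicate l 1)).oplus (straight {m})).reducedCells =
      (Kind.disc (l + 1) (m + 1)).cells := by
  refine reducedCells_of_cells_eq ⟨Nat.succ_le_succ hl, Nat.succ_le_succ hm⟩
    (Finset.ext fun ⟨i, j⟩ => ?_)
  have hrow : (i, j - 1) ∈ (straight {m}).cells ↔ i = 0 ∧ j - 1 < m :=
    (mem_cells_straight (L := [m]) (List.pairwise_singleton _ _)).trans <| by
      rcases i with _ | i <;> simp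
  have hcolumn : (i - 1, j) ∈ (straight (Multiset.replicate l 1)).cells ↔ i - 1 < l ∧ j = 0 :=
    (mem_cells_straight (pairwise_ge_replicate l 1)).trans <| by
      by_cases hi : i - 1 < l <;> simp [hi]
  rw [mem_cells_oplus, rowLen_outer_column hl, colLen_outer_row hm, hrow, hcolumn]
  simp only [Kind.mem_cells, Kind.rows, Kind.cols, Kind.Mem]
  omega

/-- The pairs of shapes of size `n` in one of the cases (a), (b) and (c) of the theorem, rotations
not being allowed. -/
def ListedPair (n : ℕ) (A B : SkewShape) : Prop :=
  (∃ l : ℕ, 1 ≤ l ∧ l ≤ n - 1 ∧ A ≈ (straight (Multiset.replicate l 1)).oplus (straight {n - l}) ∧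
    (B ≈ straight ((n - l) ::ₘ Multiset.replicate l 1) ∨
      B ≈ straight ((n - l + 1) ::ₘ Multiset.replicate (l - 1) 1))) ∨
  (4 ≤ n ∧ A ≈ (straight (Multiset.replicate 2 1)).oplus (straight {n - 2}) ∧
    B ≈ straight {n - 2, 2}) ∨
  (4 ≤ n ∧ A ≈ (straight (Multiset.replicate (n - 2) 1)).oplus (straight {2}) ∧
    B ≈ straight (2 ::ₘ 2 ::ₘ Multiset.replicate (n - 4) 1))

theorem listedPair_of_listed {k k' : Kind} (hk : k.Valid) (hA : A.reducedCells = k.cells)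
    (hB : B.reducedCells = k'.cells) (h : Kind.Listed k k') : ListedPair A.size A B := by
  obtain ⟨r, c, rfl, h⟩ := h
  obtain ⟨hr, hc⟩ : 2 ≤ r ∧ 2 ≤ c := hk
  have hcard := Kind.card_disc ⟨hr, hc⟩
  rw [← hA, card_reducedCells] at hcard
  obtain ⟨l, rfl⟩ : ∃ l, r = l + 1 := ⟨r - 1, by omega⟩
  obtain ⟨m, rfl⟩ : ∃ m, c = m + 1 := ⟨c - 1, by omega⟩
  obtain hsize : A.size = l + m := by omega
  have hA' : A ≈ (straight (Multiset.replicate l 1)).oplus (straight {m}) :=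
    hA.trans (reducedCells_column_oplus_row (by omega) (by omega)).symm
  rw [hsize, ListedPair]
  rcases h with rfl | rfl | ⟨h1, h2, rfl⟩ | ⟨h1, h2, rfl⟩
  · refine Or.inl ⟨l, by omega, by omega, ?_⟩
    rw [Nat.add_sub_cancel_left]
    exact ⟨hA', Or.inl (hB.trans (reducedCells_straight_hook (by omega) l).symm)⟩
  · obtain ⟨l, rfl⟩ : ∃ i, l = i + 1 := ⟨l - 1, by omega⟩
    refine Or.inl ⟨l + 1, by omega, by omega, ?_⟩
    rw [Nat.add_sub_cancel_left]
    exact ⟨hA', Or.inr (hB.trans (reducedCells_straight_hook (by omega) l).symm)⟩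
  · obtain rfl : l = 2 := by omega
    rw [Nat.add_sub_cancel_left]
    exact Or.inr (Or.inl ⟨by omega, hA', hB.trans (reducedCells_straight_two (by omega)).symm⟩)
  · obtain rfl : m = 2 := by omega
    obtain ⟨l, rfl⟩ : ∃ i, l = i + 2 := ⟨l - 2, by omega⟩
    exact Or.inr (Or.inr ⟨by omega, hA', hB.trans (reducedCells_straight_twoT l).symm⟩)

theorem ListedPair.exists_listed {n : ℕ} (h : ListedPair n A B) :
    ∃ k k' : Kind, k.Valid ∧ A.reducedCells = k.cells ∧ B.reducedCells = k'.cells ∧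
      Kind.Listed k k' := by
  rcases h with ⟨l, h1, h2, hA, hB⟩ | ⟨h4, hA, hB⟩ | ⟨h4, hA, hB⟩
  · obtain ⟨m, rfl⟩ : ∃ m, n = l + m := ⟨n - l, by omega⟩
    rw [Nat.add_sub_cancel_left] at hA hB
    have hdisc := hA.trans (reducedCells_column_oplus_row h1 (by omega))
    refine ⟨Kind.disc (l + 1) (m + 1), ?_⟩
    rcases hB with hB | hB
    · exact ⟨_, ⟨by omega, by omega⟩, hdisc, hB.trans (reducedCells_straight_hook (by omega) l),
        _, _, rfl, Or.inl rfl⟩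
    · obtain ⟨l, rfl⟩ : ∃ i, l = i + 1 := ⟨l - 1, by omega⟩
      exact ⟨_, ⟨by omega, by omega⟩, hdisc, hB.trans (reducedCells_straight_hook (by omega) l),
        _, _, rfl, Or.inr (Or.inl rfl)⟩
  · exact ⟨Kind.disc 3 (n - 2 + 1), _, ⟨by omega, by omega⟩,
      hA.trans (reducedCells_column_oplus_row (by omega) (by omega)),
      hB.trans (reducedCells_straight_two (by omega)), _, _, rfl,
      Or.inr (Or.inr (Or.inl ⟨rfl, by omega, rfl⟩))⟩
  · obtain ⟨n, rfl⟩ : ∃ i, n = i + 4 := ⟨n - 4, by omega⟩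
    exact ⟨Kind.disc (n + 3) 3, _, ⟨by omega, by omega⟩,
      hA.trans (reducedCells_column_oplus_row (by omega) (by omega)),
      hB.trans (reducedCells_straight_twoT n), _, _, rfl,
      Or.inr (Or.inr (Or.inr ⟨rfl, by omega, rfl⟩))⟩

theorem ListedPair.words_subset {n : ℕ} (h : ListedPair n A B) :
    words B.cells ⊆ words A.cells := by
  obtain ⟨k, k', hk, hA, hB, hl⟩ := h.exists_listed
  rw [← words_reducedCells, ← words_reducedCells A, hA, hB]
  exact hl.words_subset hk

end SkewShape

namespace Kind

variable {k k' : Kind}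

theorem cells_eq_of_words_eq (hk : k.Valid) (hk' : k'.Valid)
    (hcard : k'.cells.card = k.cells.card) (h : words k'.cells = words k.cells) :
    k'.cells = k.cells := by
  rcases cells_eq_or_listed_of_words_subset hk hk' hcard h.subset with e | hl
  · exact e
  rcases cells_eq_or_listed_of_words_subset hk' hk hcard.symm h.superset with e | hl'
  · exact e.symm
  · exact absurd hl' hl.not_symm

end Kind

namespace SkewShape

variable {A B A' B' : SkewShape} {k k' : Kind}

theorem equiv_or_equiv_rotate (hA' : A' ∈ ({A, A.rotate} : Set SkewShape))
    (hB' : B' ∈ ({B, B.rotate} : Set SkewShape)) (h : B' ≈ A') : B ≈ A ∨ B ≈ A.rotate := by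
  rcases hB' with rfl | rfl
  · rcases hA' with rfl | rfl
    exacts [Or.inl h, Or.inr h]
  · have hB : B ≈ A'.rotate := B.rotate_rotate.symm.trans (rotate_congr h)
    rcases hA' with rfl | rfl
    exacts [Or.inr hB, Or.inl (hB.trans A.rotate_rotate)]

theorem size_eq_of_mem (hA' : A' ∈ ({A, A.rotate} : Set SkewShape)) : A'.size = A.size := by
  rcases hA' with rfl | rfl
  · rfl
  · rw [size, cells_rotate, A.inBox_cells.card_rotCells, size]

namespace HasKind

theorem card_eq (h : A.HasKind k) : k.cells.card = A.size := by
  obtain ⟨A', hA', hcells⟩ := h.exists_eq_cells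
  rw [← hcells, card_reducedCells, size_eq_of_mem hA']

theorem words_eq (h : A.HasKind k) (hA : MultFree A.cells) : words A.cells = words k.cells := by
  obtain ⟨A', hA', hcells⟩ := h.exists_eq_cells
  rw [← hcells, words_reducedCells, words_eq_of_mem hA hA']

theorem equiv_of_cells_eq (h : A.HasKind k) (h' : B.HasKind k') (e : k'.cells = k.cells) :
    B ≈ A ∨ B ≈ A.rotate := by
  obtain ⟨A', hA', hcells⟩ := h.exists_eq_cells
  obtain ⟨B', hB', hcells'⟩ := h'.exists_eq_cells
  exact equiv_or_equiv_rotate hA' hB' (hcells'.trans (e.trans hcells.symm))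

theorem exists_listedPair (h : A.HasKind k) (h' : B.HasKind k') (hl : k.Listed k') :
    ∃ A' ∈ ({A, A.rotate} : Set SkewShape), ∃ B' ∈ ({B, B.rotate} : Set SkewShape),
      ListedPair A.size A' B' := by
  obtain ⟨A', hA', hcells⟩ := h.exists_eq_cells
  obtain ⟨B', hB', hcells'⟩ := h'.exists_eq_cells
  refine ⟨A', hA', B', hB', ?_⟩
  rw [← size_eq_of_mem hA']
  exact listedPair_of_listed h.valid hcells hcells' hl

end HasKind

theorem equiv_of_words_eq (hA : MultFree A.cells) (hB : MultFree B.cells)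
    (hsize : B.size = A.size) (h : words A.cells = words B.cells) : B ≈ A ∨ B ≈ A.rotate := by
  by_cases hne : A.size = 0
  · exact Or.inl (equiv_of_size_eq_zero (hsize.trans hne) hne)
  obtain ⟨k, hk⟩ := exists_hasKind hne hA
  obtain ⟨k', hk'⟩ := exists_hasKind (hsize ▸ hne) hB
  rw [hk.words_eq hA, hk'.words_eq hB] at h
  exact hk.equiv_of_cells_eq hk' (Kind.cells_eq_of_words_eq hk.valid hk'.valid
    (by rw [hk.card_eq, hk'.card_eq, hsize]) h.symm)

theorem equiv_or_listedPair_of_words_subset (hA : MultFree A.cells) (hB : MultFree B.cells)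
    (hsize : B.size = A.size) (h : words B.cells ⊆ words A.cells) :
    (B ≈ A ∨ B ≈ A.rotate) ∨ ∃ A' ∈ ({A, A.rotate} : Set SkewShape),
      ∃ B' ∈ ({B, B.rotate} : Set SkewShape), ListedPair A.size A' B' := by
  by_cases hne : A.size = 0
  · exact Or.inl (Or.inl (equiv_of_size_eq_zero (hsize.trans hne) hne))
  obtain ⟨k, hk⟩ := exists_hasKind hne hA
  obtain ⟨k', hk'⟩ := exists_hasKind (hsize ▸ hne) hB
  rw [hk.words_eq hA, hk'.words_eq hB] at h
  exact (Kind.cells_eq_or_listed_of_words_subset hk.valid hk'.valid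
    (by rw [hk.card_eq, hk'.card_eq, hsize]) h).imp (hk.equiv_of_cells_eq hk')
    (hk.exists_listedPair hk')

end SkewShape

theorem theorem6p2 (n : ℕ) (A B : SkewShape) (hAn : A.size = n) (hBn : B.size = n)
    (hA : QSym.FMultiplicityFree n A.schur) (hB : QSym.FMultiplicityFree n B.schur) :
    (A.schur = B.schur ↔ B ≈ A ∨ B ≈ A.rotate) ∧
    (QSym.FPositive n (A.schur - B.schur) ↔
      QSym.fSupport n B.schur ⊆ QSym.fSupport n A.schur) ∧
    (¬ (B ≈ A ∨ B ≈ A.rotate) →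
      (QSym.FPositive n (A.schur - B.schur) ↔
        ∃ A' ∈ ({A, A.rotate} : Set SkewShape), ∃ B' ∈ ({B, B.rotate} : Set SkewShape),
          (∃ l : ℕ, 1 ≤ l ∧ l ≤ n - 1 ∧
            A' ≈ (SkewShape.straight (Multiset.replicate l 1)).oplus
              (SkewShape.straight {n - l}) ∧
            (B' ≈ SkewShape.straight ((n - l) ::ₘ Multiset.replicate l 1) ∨
              B' ≈ SkewShape.straight ((n - l + 1) ::ₘ Multiset.replicate (l - 1) 1))) ∨
          (4 ≤ n ∧
            A' ≈ (SkewShape.straight (Multiset.replicate 2 1)).oplus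
              (SkewShape.straight {n - 2}) ∧
            B' ≈ SkewShape.straight {n - 2, 2}) ∨
          (4 ≤ n ∧
            A' ≈ (SkewShape.straight (Multiset.replicate (n - 2) 1)).oplus
              (SkewShape.straight {2}) ∧
            B' ≈ SkewShape.straight (2 ::ₘ 2 ::ₘ Multiset.replicate (n - 4) 1)))) := by
  have mA := SkewShape.multFree_cells hAn hA
  have mB := SkewShape.multFree_cells hBn hB
  have hsize : B.size = A.size := hBn.trans hAn.symm
  have hpos := SkewShape.fPositive_schur_sub_iff hAn hBn hA hB
  rw [SkewShape.schur_eq_iff hAn hBn hA hB, SkewShape.fSupport_schur_subset_iff hAn hBn hA hB]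
  refine ⟨⟨SkewShape.equiv_of_words_eq mA mB hsize, ?_⟩, hpos, fun hne => hpos.trans ⟨?_, ?_⟩⟩
  · rintro (h | h)
    · exact (SkewShape.words_congr h).symm
    · exact ((SkewShape.words_congr h).trans (SkewShape.words_rotate mA)).symm
  · subst hAn
    exact fun h => (SkewShape.equiv_or_listedPair_of_words_subset mA mB hsize h).resolve_left hne
  · rintro ⟨A', hA', B', hB', h⟩
    rw [← SkewShape.words_eq_of_mem mA hA', ← SkewShape.words_eq_of_mem mB hB']
    exact SkewShape.ListedPair.words_subset (n := n) h
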